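/- Let $N\ge 1$, $0<s<1$, $2<p<\infty$, $c>0$, and let $\Omega\subset\mathbb{R}^N$ be a bounded open set. Functions on $\Omega$ are extended by zero to $\mathbb{R}^N$. Let $$J_{p,s}(v)=\frac1p\int_{\mathbb{R}^N}\int_{\mathbb{R}^N}\frac{|v(x)-v(y)|^p}{|x-y|^{N+sp}}\,dx\,dy ,$$ and let $W_0^{s,p}(\Omega)$ be the closure of $C_c^\infty(\Omega)$ for the norm given by $\|v\|^p=J_{p,s}(v)+\int_{\mathbb{R}^N}|v|^p\,dx$. For $u,f\in L^2(\Omega)$ we write $\mathcal{L}_{p,s}u=f$ (and say that $\mathcal{L}_{p,s}u\in L^2(\Omega)$) if $u\in W_0^{s,p}(\Omega)$ and, for every $\varphi\in C_c^\infty(\Omega)$, $$\frac c2\int_{\mathbb{R}^N}\int_{\mathbb{R}^N}\frac{|u(x)-u(y)|^{p-2}(u(x)-u(y))(\varphi(x)-\varphi(y))}{|x-y|^{N+sp}}\,dx\,dy=\int_\Omega f\varphi\,dx ,$$ which is the weak form of $\mathcal{L}_{p,s}u(x)=c\ \mathrm{p.v.}\!\int_{\mathbb{R}^N}\frac{|u(x)-u(y)|^{p-2}(u(x)-u(y))}{|x-y|^{N+sp}}\,dy$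 in $\Omega$ with $u=0$ outside $\Omega$. A strong solution of the Dirichlet problem is a function $u\in C([0,\infty);L^2(\Omega))$ that is absolutely continuous on every compact subinterval of $(0,\infty)$ and such that, for a.e. $t>0$, $u$ is differentiable at $t$ in $L^2(\Omega)$, $\mathcal{L}_{p,s}u(t)\in L^2(\Omega)$, and $\frac{du}{dt}(t)=-\mathcal{L}_{p,s}u(t)$; its initial datum is $u(0)$. **Theorem.** For every $u_0\in L^2(\Omega)$ there is a unique strong solution $u$ with $u(0)=u_0$. It satisfies: (i) $u\in C([0,\infty);L^2(\Omega))$; (ii) $\mathcal{L}_{p,s}u(t)\in L^2(\Omega)$ for every $t>0$; (iii) for every $t>0$, $u$ is differentiable at $t$ as a function with values in $L^2(\Omega)$, and $\partial_tu(t)+\mathcal{L}_{p,s}u(t)=0$ a.e. in $\Omega$. Conversely, every function that satisfies (i), (ii) and (iii) is a strong solution. Moreover, for any two strong solutions $u_1,u_2$ with initial data $u_{01},u_{02}\in L^2(\Omega)$ and every $t>0$, $$\|(u_1(t)-u_2(t))_+\|_{L^1(\Omega)}\le\|(u_{01}-u_{02})_+\|_{L^1(\Omega)},\qquad \|u_1(t)-u_2(t)\|_{L^q(\Omega)}\le\|u_{01}-u_{02}\|_{L^q(\Omega)}\quad\text{for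 all }1\le q\le\infty,$$ where the right-hand side of the last inequality may be $+\infty$. -/

import Mathlib

open MeasureTheory Set Filter
open scoped ENNReal ContDiff

/-- The space `L²(Ω)`, for Lebesgue measure restricted to `Ω ⊆ ℝᴺ`. -/
abbrev L2 {N : ℕ} (Ω : Set (EuclideanSpace ℝ (Fin N))) : Type :=
  Lp ℝ 2 ((volume : Measure (EuclideanSpace ℝ (Fin N))).restrict Ω)

/-- The extension by zero outside `Ω` of a function on `Ω`. -/
noncomputable def zeroExt {N : ℕ} (Ω : Set (EuclideanSpace ℝ (Fin N))) (u : L2 Ω) :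
    EuclideanSpace ℝ (Fin N) → ℝ :=
  Ω.indicator (fun x => u x)

/-- The Gagliardo functional
`J_{p,s}(v) = (1/p) ∬ |v(x) - v(y)|ᵖ / |x - y|^(N + s p) dx dy`, with values in `[0, ∞]`. -/
noncomputable def gagliardo {N : ℕ} (s p : ℝ) (v : EuclideanSpace ℝ (Fin N) → ℝ) : ℝ≥0∞ :=
  ENNReal.ofReal (1 / p) *
    ∫⁻ z : EuclideanSpace ℝ (Fin N) × EuclideanSpace ℝ (Fin N),
      ENNReal.ofReal (|v z.1 - v z.2| ^ p / ‖z.1 - z.2‖ ^ ((N : ℝ) + s * p))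

/-- The `p`-th power of the norm of `W^{s,p}(ℝᴺ)`: `J_{p,s}(v) + ∫ |v|ᵖ`. -/
noncomputable def sobolevNormPow {N : ℕ} (s p : ℝ) (v : EuclideanSpace ℝ (Fin N) → ℝ) : ℝ≥0∞ :=
  gagliardo s p v + ∫⁻ x, ENNReal.ofReal (|v x| ^ p)

/-- `φ ∈ C_c^∞(Ω)`, viewed as a function on `ℝᴺ`. -/
def IsTestFunction {N : ℕ} (Ω : Set (EuclideanSpace ℝ (Fin N)))
    (φ : EuclideanSpace ℝ (Fin N) → ℝ) : Prop :=
  ContDiff ℝ ∞ φ ∧ HasCompactSupport φ ∧ tsupport φ ⊆ Ω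

/-- `v ∈ W_0^{s,p}(Ω)`: `v` is in the closure of `C_c^∞(Ω)` for the norm of `W^{s,p}(ℝᴺ)`. -/
def MemW0 {N : ℕ} (s p : ℝ) (Ω : Set (EuclideanSpace ℝ (Fin N)))
    (v : EuclideanSpace ℝ (Fin N) → ℝ) : Prop :=
  ∀ ε : ℝ≥0∞, 0 < ε → ∃ φ, IsTestFunction Ω φ ∧ sobolevNormPow s p (fun x => v x - φ x) < ε

/-- The weak form
`(c/2) ∬ |v(x) - v(y)|^(p-2) (v(x) - v(y)) (φ(x) - φ(y)) / |x - y|^(N + s p) dx dy`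
of the operator `c · p.v. ∫ |v(x) - v(y)|^(p-2) (v(x) - v(y)) / |x - y|^(N + s p) dy`.
For `c = 2` it is the directional derivative of `J_{p,s}` at `v` in the direction `φ`. -/
noncomputable def weakForm {N : ℕ} (c s p : ℝ) (v φ : EuclideanSpace ℝ (Fin N) → ℝ) : ℝ :=
  c / 2 * ∫ z : EuclideanSpace ℝ (Fin N) × EuclideanSpace ℝ (Fin N),
    |v z.1 - v z.2| ^ (p - 2) * (v z.1 - v z.2) * (φ z.1 - φ z.2)
      / ‖z.1 - z.2‖ ^ ((N : ℝ) + s * p)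

/-- `u` is in the domain of the Dirichlet operator `L_{p,s}` on `L²(Ω)`, and `L_{p,s} u = f`:
the zero extension of `u` is in `W_0^{s,p}(Ω)`, and the weak form at `u` is represented on
`C_c^∞(Ω)` by the function `f ∈ L²(Ω)`. -/
def IsFracPLaplacian {N : ℕ} (c s p : ℝ) (Ω : Set (EuclideanSpace ℝ (Fin N)))
    (u f : L2 Ω) : Prop :=
  MemW0 s p Ω (zeroExt Ω u) ∧
    ∀ φ, IsTestFunction Ω φ → weakForm c s p (zeroExt Ω u) φ = ∫ x in Ω, f x * φ x

/-- Strong solutions of `∂ₜ u + L_{p,s} u = 0` in `Ω`, `u = 0` outside `Ω`, as orbits in `L²(Ω)`: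
continuous on `[0, ∞)`, absolutely continuous on the compact subintervals of `(0, ∞)`, and for
almost every `t > 0` differentiable at `t` with `L_{p,s} u(t) ∈ L²(Ω)` and
`du/dt (t) = - L_{p,s} u(t)`. Values at negative times are irrelevant. -/
structure IsStrongSolution {N : ℕ} (c s p : ℝ) (Ω : Set (EuclideanSpace ℝ (Fin N)))
    (u : ℝ → L2 Ω) : Prop where
  continuousOn : ContinuousOn u (Ici 0)
  absolutelyContinuous : ∀ a b : ℝ, 0 < a → a ≤ b → AbsolutelyContinuousOnInterval u a b
  equation : ∀ᵐ t : ℝ, 0 < t → ∃ f : L2 Ω, IsFracPLaplacian c s p Ω (u t) f ∧ HasDerivAt u (-f) t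

/-!
The operator `L_{p,s}` is a single-valued maximal monotone operator of `L²(Ω)` with dense domain,
homogeneous of degree `p - 1 > 1`, so that its negative generates a contraction semigroup, whose
orbits turn out to be the strong solutions.

*The operator.* The space `W_0^{s,p}(Ω)` is encoded by a closed subspace of pairs: the functions and
their difference quotients of order `s`, in `L²(Ω) × Lᵖ(ℝᴺ × ℝᴺ)` (`energyGraph`). The fractional
Poincaré inequality (`exists_poincare`) shows that the `Lᵖ` part of the Sobolev norm is redundant.
In these terms the weak form is the duality map of `Lᵖ`, and the equation `u + lam L u = f` is the
Euler equation of a minimum problem that Clarkson's inequality solves without weak compactness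
(`exists_minimizer`, `maxMonotone_isFracPLaplacian`).

*The semigroup.* It is constructed by the implicit Euler scheme: Kobayashi's estimate
(`MaxMonotone.sq_norm_iterate_sub_iterate_le`) gives its convergence. By homogeneity the rescaled
orbits `κ • u (κ ^ (p - 2) * t)` are orbits too; comparing them with `u` by contraction shows that
`u` is locally Lipschitz on `(0, ∞)` with values in the domain
(`MaxMonotone.norm_semi_sub_le_of_homogeneous`).

*Differentiability at every positive time.* For an orbit `u` of speed `W = L u`, the right derivative
exists at each positive time, and `‖W‖` decreases; the left derivative exists at `t` unless
`‖W‖` jumps there. For a general maximal monotone operator it may jump. Here the monotonicity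
`⟪L u - L v, u - v⟫` is comparable from both sides to `‖U u - U v‖ ^ 2` for the map
`U u = |D u|^((p-2)/2) D u` into `L²(ℝᴺ × ℝᴺ)`, where `D u` is the difference quotient of `u`
(`energyPow_sub`). Hence `U ∘ u` is a continuous path of finite energy, with energy bounded by the
decrease of `‖W‖ ^ 2`, and which bounds this decrease in turn. As a continuous path does not see a
jump, a jump of `‖W‖ ^ 2` at `t` would imply one immediately after `t`, against the right continuity
of `‖W‖` (`EnergyPath.eventually_norm_lt`, `MaxMonotone.hasDerivAt_semi`).

*Uniqueness and contraction.* The squared distance of two strong solutions is absolutely continuous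
with nonpositive derivative. The operator is accretive with respect to smooth increasing functions
of the difference (`inner_sub_compLp_nonneg`). Hence its resolvents decrease `∫ (u - v - k)₊` for
`k ≥ 0`, and so does the semigroup. The `L^q` norms are superpositions of these functionals
(`eLpNorm_le_of_lintegral_sub_le`).
-/

open Topology

/-! ### Nonlinear contraction semigroups: the exponential formula -/

/-- An operator `A ⊆ H × H` that is monotone, whose resolvents `(1 + lam A)⁻¹` are everywhere defined
(so that it is maximal monotone), and which is single-valued; `A x w` means that `x` is in the
domain and `A x = w`. -/
structure MaxMonotone {H : Type*} [NormedAddCommGroup H] [InnerProductSpace ℝ H]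
    (A : H → H → Prop) : Prop where
  mono : ∀ {x w y z}, A x w → A y z → 0 ≤ inner ℝ (w - z) (x - y)
  range : ∀ {lam : ℝ}, 0 < lam → ∀ f, ∃ x w, A x w ∧ x + lam • w = f
  single : ∀ {x w z}, A x w → A x z → w = z

/-- The resolvent `(1 + lam A)⁻¹ f`; a junk value if `f` is not in the range of `1 + lam A`. -/
noncomputable def resolv {H : Type*} [NormedAddCommGroup H] [InnerProductSpace ℝ H]
    (A : H → H → Prop) (lam : ℝ) (f : H) : H :=
  Classical.epsilon fun x => A x (lam⁻¹ • (f - x))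

/-- The Yosida approximation `(f - (1 + lam A)⁻¹ f) / lam`. -/
noncomputable def yosida {H : Type*} [NormedAddCommGroup H] [InnerProductSpace ℝ H]
    (A : H → H → Prop) (lam : ℝ) (f : H) : H :=
  lam⁻¹ • (f - resolv A lam f)

namespace MaxMonotone

variable {H : Type*} [NormedAddCommGroup H] [InnerProductSpace ℝ H] {A : H → H → Prop}

lemma apply_resolv (hA : MaxMonotone A) {lam : ℝ} (hl : 0 < lam) (f : H) :
    A (resolv A lam f) (yosida A lam f) := by
  apply Classical.epsilon_spec (p := fun x => A x (lam⁻¹ • (f - x)))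
  obtain ⟨x, w, h, rfl⟩ := hA.range hl f
  refine ⟨x, ?_⟩
  rwa [add_sub_cancel_left, inv_smul_smul₀ hl.ne']

lemma resolv_add_smul_yosida {lam : ℝ} (hl : 0 < lam) (f : H) :
    resolv A lam f + lam • yosida A lam f = f := by
  rw [yosida, smul_inv_smul₀ hl.ne', add_sub_cancel]

lemma norm_sub_le_norm_add_smul_sub (hA : MaxMonotone A) {lam : ℝ} (hl : 0 < lam) {x w y z : H}
    (h1 : A x w) (h2 : A y z) : ‖x - y‖ ≤ ‖(x + lam • w) - (y + lam • z)‖ := by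
  have h := hA.mono h1 h2
  have e : (x + lam • w) - (y + lam • z) = (x - y) + lam • (w - z) := by module
  rw [e]
  have h3 : ‖x - y‖ * ‖x - y‖ ≤ ‖(x - y) + lam • (w - z)‖ * ‖x - y‖ := by
    calc ‖x - y‖ * ‖x - y‖ = inner ℝ (x - y) (x - y) := (real_inner_self_eq_norm_mul_norm _).symm
      _ ≤ inner ℝ ((x - y) + lam • (w - z)) (x - y) := by
        rw [inner_add_left, real_inner_smul_left]; nlinarith
      _ ≤ _ := real_inner_le_norm _ _
  by_cases h0 : ‖x - y‖ = 0
  · rw [h0]; positivity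
  · exact le_of_mul_le_mul_right h3 (lt_of_le_of_ne (norm_nonneg _) (Ne.symm h0))

lemma norm_resolv_sub_le (hA : MaxMonotone A) {lam : ℝ} (hl : 0 < lam) (f g : H) :
    ‖resolv A lam f - resolv A lam g‖ ≤ ‖f - g‖ := by
  have := hA.norm_sub_le_norm_add_smul_sub hl (hA.apply_resolv hl f) (hA.apply_resolv hl g)
  rwa [resolv_add_smul_yosida hl, resolv_add_smul_yosida hl] at this

lemma resolv_eq (hA : MaxMonotone A) {lam : ℝ} (hl : 0 < lam) {x w : H} (h : A x w) :
    resolv A lam (x + lam • w) = x := by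
  have := hA.norm_sub_le_norm_add_smul_sub hl (hA.apply_resolv hl (x + lam • w)) h
  rw [resolv_add_smul_yosida hl, sub_self, norm_zero, norm_le_zero_iff] at this
  exact sub_eq_zero.mp this

lemma norm_sub_resolv_le (hA : MaxMonotone A) {lam : ℝ} (hl : 0 < lam) {x w : H} (h : A x w) :
    ‖x - resolv A lam x‖ ≤ lam * ‖w‖ := by
  have := hA.norm_resolv_sub_le hl (x + lam • w) x
  rwa [hA.resolv_eq hl h, add_sub_cancel_left, norm_smul, Real.norm_of_nonneg hl.le] at this

lemma norm_yosida_le (hA : MaxMonotone A) {lam : ℝ} (hl : 0 < lam) {x w : H} (h : A x w) :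
    ‖yosida A lam x‖ ≤ ‖w‖ := by
  rw [yosida, norm_smul, norm_inv, Real.norm_of_nonneg hl.le, inv_mul_le_iff₀ hl]
  exact hA.norm_sub_resolv_le hl h

lemma norm_iterate_sub_le (hA : MaxMonotone A) {lam : ℝ} (hl : 0 < lam) (k : ℕ) (f g : H) :
    ‖(resolv A lam)^[k] f - (resolv A lam)^[k] g‖ ≤ ‖f - g‖ := by
  induction k with
  | zero => simp
  | succ k ih =>
    rw [Function.iterate_succ_apply', Function.iterate_succ_apply']
    exact (hA.norm_resolv_sub_le hl _ _).trans ih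

lemma exists_apply_iterate (hA : MaxMonotone A) {lam : ℝ} (hl : 0 < lam) {x w : H} (h : A x w)
    (k : ℕ) : ∃ z, A ((resolv A lam)^[k] x) z ∧ ‖z‖ ≤ ‖w‖ := by
  induction k with
  | zero => exact ⟨w, h, le_rfl⟩
  | succ k ih =>
    obtain ⟨z, hz, hzw⟩ := ih
    rw [Function.iterate_succ_apply']
    exact ⟨_, hA.apply_resolv hl _, (hA.norm_yosida_le hl hz).trans hzw⟩

lemma norm_iterate_sub_self_le (hA : MaxMonotone A) {lam : ℝ} (hl : 0 < lam) {x w : H} (h : A x w)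
    (k : ℕ) : ‖(resolv A lam)^[k] x - x‖ ≤ k * lam * ‖w‖ := by
  induction k with
  | zero => simp
  | succ k ih =>
    obtain ⟨z, hz, hzw⟩ := hA.exists_apply_iterate hl h k
    rw [Function.iterate_succ_apply']
    have h1 := hA.norm_sub_resolv_le hl hz
    have h2 : lam * ‖z‖ ≤ lam * ‖w‖ := by gcongr
    rw [norm_sub_rev] at h1
    have := norm_sub_le_norm_sub_add_norm_sub (resolv A lam ((resolv A lam)^[k] x))
      ((resolv A lam)^[k] x) x
    push_cast
    linarith

lemma sq_norm_resolv_sub_le (hA : MaxMonotone A) {lam mu : ℝ} (hl : 0 < lam) (hm : 0 < mu)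
    (x y : H) :
    (lam + mu) * ‖resolv A lam x - resolv A mu y‖ ^ 2 ≤
      mu * ‖x - resolv A mu y‖ ^ 2 + lam * ‖resolv A lam x - y‖ ^ 2 := by
  have h := hA.mono (hA.apply_resolv hl x) (hA.apply_resolv hm y)
  set a := resolv A lam x with ha
  set b := resolv A mu y with hb
  have e : (lam * mu) * inner ℝ (yosida A lam x - yosida A mu y) (a - b) =
      mu * inner ℝ (x - b) (a - b) + lam * inner ℝ (a - y) (a - b)
        - (lam + mu) * ‖a - b‖ ^ 2 := by
    rw [yosida, yosida, ← ha, ← hb, ← real_inner_self_eq_norm_sq, ← real_inner_smul_left,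
      ← real_inner_smul_left, ← real_inner_smul_left, ← real_inner_smul_left, ← inner_add_left,
      ← inner_sub_left]
    congr 1
    have h1 : lam * mu * lam⁻¹ = mu := by field_simp
    have h2 : lam * mu * mu⁻¹ = lam := by field_simp
    rw [smul_sub, smul_smul, smul_smul, h1, h2]
    module
  have h0 : 0 ≤ (lam * mu) * inner ℝ (yosida A lam x - yosida A mu y) (a - b) := by positivity
  have key : ∀ c : H, inner ℝ c (a - b) ≤ (‖c‖ ^ 2 + ‖a - b‖ ^ 2) / 2 := fun c => by
    have := real_inner_le_norm c (a - b)
    nlinarith [sq_nonneg (‖c‖ - ‖a - b‖)]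
  have k1 := mul_le_mul_of_nonneg_left (key (x - b)) hm.le
  have k2 := mul_le_mul_of_nonneg_left (key (a - y)) hl.le
  linarith

/-- Kobayashi's estimate: two implicit Euler schemes for `u' + A u = 0` with the same initial
value and with different steps stay close as long as the elapsed times are. -/
lemma sq_norm_iterate_sub_iterate_le (hA : MaxMonotone A) {lam mu : ℝ} (hl : 0 < lam)
    (hm : 0 < mu) {x w : H} (h : A x w) (m n : ℕ) :
    ‖(resolv A lam)^[m] x - (resolv A mu)^[n] x‖ ^ 2 ≤
      ‖w‖ ^ 2 * ((m * lam - n * mu) ^ 2 + m * lam ^ 2 + n * mu ^ 2) := by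
  induction m generalizing n with
  | zero =>
    have h1 := hA.norm_iterate_sub_self_le hm h n
    rw [norm_sub_rev] at h1
    have h2 := pow_le_pow_left₀ (norm_nonneg _) h1 2
    simp only [Function.iterate_zero, id_eq, Nat.cast_zero]
    have : 0 ≤ ‖w‖ ^ 2 * (n * mu ^ 2) := by positivity
    nlinarith
  | succ m ihm =>
    induction n with
    | zero =>
      have h1 := hA.norm_iterate_sub_self_le hl h (m + 1)
      have h2 := pow_le_pow_left₀ (norm_nonneg _) h1 2
      simp only [Function.iterate_zero, id_eq, Nat.cast_zero] at h2 ⊢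
      have : 0 ≤ ‖w‖ ^ 2 * ((m + 1 : ℕ) * lam ^ 2) := by positivity
      nlinarith
    | succ n ihn =>
      have h1 := hA.sq_norm_resolv_sub_le hl hm ((resolv A lam)^[m] x)
        ((resolv A mu)^[n] x)
      rw [← Function.iterate_succ_apply' (resolv A lam) m,
        ← Function.iterate_succ_apply' (resolv A mu) n] at h1
      have h2 := mul_le_mul_of_nonneg_left (ihm (n + 1)) hm.le
      have h3 := mul_le_mul_of_nonneg_left ihn hl.le
      refine le_of_mul_le_mul_left (h1.trans ((add_le_add h2 h3).trans (le_of_eq ?_)))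
        (add_pos hl hm)
      push_cast
      ring

/-- The Bénilan inequality for the implicit Euler scheme. -/
lemma iterate_benilan (hA : MaxMonotone A) {lam : ℝ} (hl : 0 < lam) {x w y z : H} (h : A x w)
    (hy : A y z) (k : ℕ) :
    ‖(resolv A lam)^[k] x - y‖ ^ 2 / 2 - ‖x - y‖ ^ 2 / 2 ≤
      -(k * lam * inner ℝ z (x - y)) + (k * lam) ^ 2 * (‖z‖ * ‖w‖) := by
  induction k with
  | zero => simp
  | succ k ih =>
    rw [Function.iterate_succ_apply']
    set v := (resolv A lam)^[k] x with hv
    have h1 := hA.mono (hA.apply_resolv hl v) hy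
    have h2 := hA.norm_iterate_sub_self_le hl h (k + 1)
    rw [Function.iterate_succ_apply', ← hv] at h2
    have h3 := resolv_add_smul_yosida (A := A) hl v
    set a := resolv A lam v with ha
    set b := yosida A lam v with hb
    have h4 : ‖a - y‖ ^ 2 / 2 - ‖v - y‖ ^ 2 / 2 ≤ - lam * inner ℝ b (a - y) := by
      have : v - y = (a - y) + lam • b := by rw [← h3]; abel
      rw [this, norm_add_sq_real, real_inner_smul_right, real_inner_comm]
      nlinarith [sq_nonneg ‖lam • b‖]
    rw [inner_sub_left] at h1
    have h5 : -inner ℝ z (a - y) ≤ -inner ℝ z (x - y) + ‖z‖ * ((k + 1 : ℕ) * lam * ‖w‖) := by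
      have h6 : inner ℝ z (a - y) = inner ℝ z (a - x) + inner ℝ z (x - y) := by
        rw [← inner_add_right]; congr 1; abel
      have h7 := neg_le_of_abs_le (abs_real_inner_le_norm z (a - x))
      have h8 : ‖z‖ * ‖a - x‖ ≤ ‖z‖ * ((k + 1 : ℕ) * lam * ‖w‖) := by gcongr
      linarith
    have h9 := mul_le_mul_of_nonneg_left h5 hl.le
    have h10 := mul_nonneg hl.le h1
    have h11 : 0 ≤ k * lam ^ 2 * (‖z‖ * ‖w‖) := by positivity
    push_cast at h9 ⊢
    nlinarith

lemma isClosed_graph (hA : MaxMonotone A) {ι : Type*} {l : Filter ι} [l.NeBot] {f g : ι → H}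
    {x w : H} (h : ∀ i, A (f i) (g i)) (hf : Tendsto f l (𝓝 x)) (hg : Tendsto g l (𝓝 w)) :
    A x w := by
  have h1 : ∀ i, resolv A 1 (f i + g i) = f i := fun i => by
    simpa using hA.resolv_eq one_pos (h i)
  have h2 : resolv A 1 (x + w) = x := by
    refine tendsto_nhds_unique (f := fun i => resolv A 1 (f i + g i)) (l := l) ?_
      (by simpa only [h1] using hf)
    rw [tendsto_iff_norm_sub_tendsto_zero]
    have h3 := tendsto_iff_norm_sub_tendsto_zero.mp (hf.add hg)
    exact squeeze_zero (fun _ => norm_nonneg _)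
      (fun i => hA.norm_resolv_sub_le one_pos _ _) h3
  have h3 := hA.apply_resolv one_pos (x + w)
  rw [yosida, h2] at h3
  simpa using h3

lemma sq_norm_yosida_sub_le (hA : MaxMonotone A) {lam mu : ℝ} (hl : 0 < lam) (hlm : lam < mu)
    (x : H) :
    ‖yosida A lam x - yosida A mu x‖ ^ 2 ≤ ‖yosida A lam x‖ ^ 2 - ‖yosida A mu x‖ ^ 2 := by
  have h := hA.mono (hA.apply_resolv hl x) (hA.apply_resolv (hl.trans hlm) x)
  have e1 := resolv_add_smul_yosida (A := A) hl x
  have e2 := resolv_add_smul_yosida (A := A) (hl.trans hlm) x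
  set a := yosida A lam x
  set b := yosida A mu x
  have e : resolv A lam x - resolv A mu x = (mu - lam) • b - lam • (a - b) := by
    rw [eq_sub_of_add_eq e1, eq_sub_of_add_eq e2]; module
  rw [e, inner_sub_right, real_inner_smul_right, real_inner_smul_right,
    real_inner_self_eq_norm_sq] at h
  have h1 : 0 ≤ (mu - lam) * inner ℝ (a - b) b := by nlinarith [sq_nonneg ‖a - b‖]
  have h2 : 0 ≤ inner ℝ (a - b) b := nonneg_of_mul_nonneg_right h1 (by linarith)
  have h3 : a = (a - b) + b := by abel
  have h4 : ‖a‖ ^ 2 = ‖a - b‖ ^ 2 + 2 * inner ℝ (a - b) b + ‖b‖ ^ 2 := by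
    conv_lhs => rw [h3]
    exact norm_add_sq_real _ _
  linarith

/-- If the Yosida approximations of `x` are bounded, then `x` is in the domain of `A`, and they
converge strongly to `A x`. -/
lemma exists_apply_of_yosida_le [CompleteSpace H] (hA : MaxMonotone A) {x : H} {M : ℝ}
    (hM : ∀ lam, 0 < lam → ‖yosida A lam x‖ ≤ M) :
    ∃ w, A x w ∧ ‖w‖ ≤ M ∧ Tendsto (fun n : ℕ => yosida A (1 / ((n : ℝ) + 1)) x) atTop (𝓝 w) := by
  set r : ℕ → ℝ := fun n => 1 / ((n : ℝ) + 1) with hr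
  have hr0 : ∀ n, 0 < r n := fun n => Nat.one_div_pos_of_nat
  have hrt : Tendsto r atTop (𝓝 0) := tendsto_one_div_add_atTop_nhds_zero_nat
  set a : ℕ → H := fun n => yosida A (r n) x with ha
  have key : ∀ m n, m ≤ n → ‖a n - a m‖ ^ 2 ≤ ‖a n‖ ^ 2 - ‖a m‖ ^ 2 := by
    intro m n hmn
    rcases hmn.eq_or_lt with rfl | h
    · simp
    · exact hA.sq_norm_yosida_sub_le (hr0 n) (Nat.one_div_lt_one_div h) x
  have hmono : Monotone fun n => ‖a n‖ ^ 2 := fun m n hmn => by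
    have := key m n hmn
    simp only
    nlinarith [sq_nonneg ‖a n - a m‖]
  have hbdd : BddAbove (Set.range fun n => ‖a n‖ ^ 2) := by
    refine ⟨M ^ 2, ?_⟩
    rintro _ ⟨n, rfl⟩
    exact pow_le_pow_left₀ (norm_nonneg _) (hM _ (hr0 n)) 2
  have hc := (tendsto_atTop_ciSup hmono hbdd).cauchySeq
  have hcau : CauchySeq a := by
    rw [Metric.cauchySeq_iff'] at hc ⊢
    intro ε hε
    obtain ⟨m, hm⟩ := hc (ε ^ 2) (by positivity)
    refine ⟨m, fun n hn => ?_⟩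
    have h1 := hm n hn
    rw [Real.dist_eq] at h1
    rw [dist_eq_norm]
    exact lt_of_pow_lt_pow_left₀ 2 hε.le ((key m n hn).trans_lt ((le_abs_self _).trans_lt h1))
  obtain ⟨w, hw⟩ := cauchySeq_tendsto_of_complete hcau
  refine ⟨w, ?_, le_of_tendsto hw.norm (Eventually.of_forall fun n => hM _ (hr0 n)), hw⟩
  refine hA.isClosed_graph (l := atTop) (fun n => hA.apply_resolv (hr0 n) x) ?_ hw
  have h1 : ∀ n, resolv A (r n) x = x - r n • a n := fun n =>
    eq_sub_of_add_eq (resolv_add_smul_yosida (hr0 n) x)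
  simp only [h1]
  simpa using tendsto_const_nhds.sub (hrt.smul hw)

lemma tendsto_yosida [CompleteSpace H] (hA : MaxMonotone A) {x w : H} (h : A x w) :
    Tendsto (fun n : ℕ => yosida A (1 / ((n : ℝ) + 1)) x) atTop (𝓝 w) := by
  obtain ⟨z, hz, -, hz2⟩ := hA.exists_apply_of_yosida_le (fun lam hl => hA.norm_yosida_le hl h)
  rwa [hA.single h hz]

/-- A criterion for strong convergence to `A x`, without weak compactness: an upper bound of the
norms, and a lower bound of the products with the points `x - y`, for `y` in the domain. -/
lemma tendsto_of_inner_ge [CompleteSpace H] (hA : MaxMonotone A) {x w : H} (h : A x w)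
    {ι : Type*} {l : Filter ι} {q : ι → H}
    (h1 : ∀ ε, 0 < ε → ∀ᶠ i in l, ‖q i‖ ≤ ‖w‖ + ε)
    (h2 : ∀ y z, A y z → ∀ ε, 0 < ε → ∀ᶠ i in l, inner ℝ z (x - y) - ε ≤ inner ℝ (q i) (x - y)) :
    Tendsto q l (𝓝 w) := by
  rw [Metric.tendsto_nhds]
  intro ε hε
  -- the bounds tested with `y = (1 + lam A)⁻¹ x`, for which `x - y` is a multiple of `A y`
  obtain ⟨d, hd0, hd⟩ : ∃ d : ℝ, 0 < d ∧ d * (8 * ‖w‖ + 3 * d + 2) < ε ^ 2 := by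
    have : Tendsto (fun d : ℝ => d * (8 * ‖w‖ + 3 * d + 2)) (𝓝[>] 0) (𝓝 0) := by
      have : Continuous (fun d : ℝ => d * (8 * ‖w‖ + 3 * d + 2)) := by fun_prop
      simpa using (this.tendsto 0).mono_left nhdsWithin_le_nhds
    obtain ⟨d, hd1, hd2⟩ := ((this.eventually (gt_mem_nhds (by positivity : 0 < ε ^ 2))).and
      self_mem_nhdsWithin).exists
    exact ⟨d, hd2, hd1⟩
  obtain ⟨n, hn⟩ := ((Metric.tendsto_nhds.mp (hA.tendsto_yosida h)) d hd0).exists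
  set lam : ℝ := 1 / ((n : ℝ) + 1)
  have hl : 0 < lam := Nat.one_div_pos_of_nat
  have h3 := h2 _ _ (hA.apply_resolv hl x) (lam * d) (by positivity)
  have e : x - resolv A lam x = lam • yosida A lam x :=
    sub_eq_of_eq_add' (resolv_add_smul_yosida hl x).symm
  rw [e] at h3
  filter_upwards [h1 d hd0, h3] with i hi1 hi2
  set a := yosida A lam x
  rw [dist_eq_norm] at hn ⊢
  rw [real_inner_smul_right, real_inner_smul_right, real_inner_self_eq_norm_sq] at hi2
  have hi3 : ‖a‖ ^ 2 - d ≤ inner ℝ (q i) a := by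
    refine le_of_mul_le_mul_left ?_ hl
    linarith
  have h4 : inner ℝ (q i) a ≤ inner ℝ (q i) w + (‖w‖ + d) * d := by
    have h5 : inner ℝ (q i) a = inner ℝ (q i) w + inner ℝ (q i) (a - w) := by
      rw [← inner_add_right]; congr 1; abel
    have h6 := real_inner_le_norm (q i) (a - w)
    have h7 : ‖q i‖ * ‖a - w‖ ≤ (‖w‖ + d) * d := by gcongr
    linarith
  have h5 : ‖w‖ - d ≤ ‖a‖ := by
    have := norm_sub_norm_le w a
    rw [norm_sub_rev] at this
    linarith
  have h6 : ‖w‖ ^ 2 - 2 * d * ‖w‖ ≤ ‖a‖ ^ 2 := by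
    rcases le_total d ‖w‖ with hdw | hdw
    · nlinarith [pow_le_pow_left₀ (by linarith) h5 2, sq_nonneg d]
    · nlinarith [norm_nonneg w, sq_nonneg ‖a‖]
  have h7 := norm_sub_sq_real (q i) w
  have h8 : ‖q i‖ ^ 2 ≤ (‖w‖ + d) ^ 2 := pow_le_pow_left₀ (norm_nonneg _) hi1 2
  refine lt_of_pow_lt_pow_left₀ 2 hε.le ?_
  nlinarith [norm_nonneg w, hd0]

lemma exists_uniform_bound (hA : MaxMonotone A) (hd : Dense {x | ∃ w, A x w}) (x : H) (t : ℝ)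
    {ε : ℝ} (hε : 0 < ε) : ∃ δ, 0 < δ ∧ ∀ (lam mu : ℝ) (m n : ℕ), 0 < lam → 0 < mu → lam < δ →
      mu < δ → |m * lam - t| < δ → |n * mu - t| < δ →
      ‖(resolv A lam)^[m] x - (resolv A mu)^[n] x‖ < ε := by
  obtain ⟨y, ⟨w, hw⟩, hxy⟩ := hd.exists_dist_lt x (by positivity : 0 < ε / 4)
  rw [dist_eq_norm] at hxy
  obtain ⟨δ, hδ0, hδ⟩ : ∃ d : ℝ, 0 < d ∧
      ‖w‖ ^ 2 * ((2 * d) ^ 2 + (|t| + d) * d + (|t| + d) * d) < (ε / 4) ^ 2 := by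
    have : Tendsto (fun d : ℝ => ‖w‖ ^ 2 * ((2 * d) ^ 2 + (|t| + d) * d + (|t| + d) * d))
        (𝓝[>] 0) (𝓝 0) := by
      have : Continuous (fun d : ℝ => ‖w‖ ^ 2 * ((2 * d) ^ 2 + (|t| + d) * d + (|t| + d) * d)) := by
        fun_prop
      simpa using (this.tendsto 0).mono_left nhdsWithin_le_nhds
    obtain ⟨d, hd1, hd2⟩ := ((this.eventually
      (gt_mem_nhds (by positivity : 0 < (ε / 4) ^ 2))).and self_mem_nhdsWithin).exists
    exact ⟨d, hd2, hd1⟩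
  refine ⟨δ, hδ0, fun lam mu m n hl hm hlδ hmδ hmt hnt => ?_⟩
  have h1 := hA.norm_iterate_sub_le hl m x y
  have h2 := hA.norm_iterate_sub_le hm n y x
  rw [norm_sub_rev y x] at h2
  have h3 := hA.sq_norm_iterate_sub_iterate_le hl hm hw m n
  have e1 : m * lam ≤ |t| + δ := by linarith [(abs_lt.mp hmt).2, le_abs_self t]
  have e2 : n * mu ≤ |t| + δ := by linarith [(abs_lt.mp hnt).2, le_abs_self t]
  have e3 : (m * lam - n * mu) ^ 2 ≤ (2 * δ) ^ 2 := by
    apply sq_le_sq'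
    · linarith [(abs_lt.mp hmt).1, (abs_lt.mp hnt).2]
    · linarith [(abs_lt.mp hmt).2, (abs_lt.mp hnt).1]
  have e4 : m * lam ^ 2 ≤ (|t| + δ) * δ := by
    calc m * lam ^ 2 = (m * lam) * lam := by ring
      _ ≤ _ := by gcongr
  have e5 : n * mu ^ 2 ≤ (|t| + δ) * δ := by
    calc n * mu ^ 2 = (n * mu) * mu := by ring
      _ ≤ _ := by gcongr
  have h4 : ‖(resolv A lam)^[m] y - (resolv A mu)^[n] y‖ < ε / 4 := by
    refine lt_of_pow_lt_pow_left₀ 2 (by positivity) (h3.trans_lt (lt_of_le_of_lt ?_ hδ))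
    gcongr
  have h5 := norm_add₃_le (a := (resolv A lam)^[m] x - (resolv A lam)^[m] y)
    (b := (resolv A lam)^[m] y - (resolv A mu)^[n] y)
    (c := (resolv A mu)^[n] y - (resolv A mu)^[n] x)
  rw [sub_add_sub_cancel, sub_add_sub_cancel] at h5
  linarith

end MaxMonotone

/-- The contraction semigroup generated by `-A`, by the exponential formula: `semi A t x` is the
limit of the implicit Euler scheme. It is meaningful for `t ≥ 0` and `A` of dense domain. -/
noncomputable def semi {H : Type*} [NormedAddCommGroup H] [InnerProductSpace ℝ H]
    (A : H → H → Prop) (t : ℝ) (x : H) : H :=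
  limUnder atTop fun n : ℕ => (resolv A (1 / ((n : ℝ) + 1)))^[⌊t * (n + 1)⌋₊] x

namespace MaxMonotone

variable {H : Type*} [NormedAddCommGroup H] [InnerProductSpace ℝ H] [CompleteSpace H]
  {A : H → H → Prop}

lemma tendsto_floor_mul {lam : ℕ → ℝ} (hl0 : ∀ n, 0 < lam n) (hl : Tendsto lam atTop (𝓝 0))
    {t : ℝ} (ht : 0 ≤ t) : Tendsto (fun n => (⌊t / lam n⌋₊ : ℝ) * lam n) atTop (𝓝 t) := by
  refine tendsto_of_tendsto_of_tendsto_of_le_of_le (g := fun n => t - lam n) (h := fun _ => t)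
    (by simpa using tendsto_const_nhds.sub hl) tendsto_const_nhds (fun n => ?_) (fun n => ?_)
  · have h := (Nat.lt_floor_add_one (t / lam n)).le
    rw [div_le_iff₀ (hl0 n)] at h
    simp only
    linarith
  · have h := Nat.floor_le (div_nonneg ht (hl0 n).le)
    rwa [le_div_iff₀ (hl0 n)] at h

/-- Every implicit Euler scheme whose steps tend to `0` converges to the semigroup. -/
lemma tendsto_semi (hA : MaxMonotone A) (hd : Dense {x | ∃ w, A x w}) (x : H) {t : ℝ}
    (ht : 0 ≤ t) {lam : ℕ → ℝ} {k : ℕ → ℕ} (hl0 : ∀ n, 0 < lam n)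
    (hl : Tendsto lam atTop (𝓝 0)) (hk : Tendsto (fun n => k n * lam n) atTop (𝓝 t)) :
    Tendsto (fun n => (resolv A (lam n))^[k n] x) atTop (𝓝 (semi A t x)) := by
  set r : ℕ → ℝ := fun n => 1 / ((n : ℝ) + 1) with hr
  have hr0 : ∀ n, 0 < r n := fun n => Nat.one_div_pos_of_nat
  have hrt : Tendsto r atTop (𝓝 0) := tendsto_one_div_add_atTop_nhds_zero_nat
  have hrk : Tendsto (fun n : ℕ => (⌊t * (n + 1)⌋₊ : ℝ) * r n) atTop (𝓝 t) := by
    convert tendsto_floor_mul hr0 hrt ht using 5 with n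
    simp [hr]
  have ev : ∀ {lam : ℕ → ℝ} {k : ℕ → ℕ}, (Tendsto lam atTop (𝓝 0)) →
      (Tendsto (fun n => k n * lam n) atTop (𝓝 t)) → ∀ δ, 0 < δ →
      ∀ᶠ n in atTop, lam n < δ ∧ |k n * lam n - t| < δ := by
    intro lam k hl hk δ hδ
    filter_upwards [hl.eventually (gt_mem_nhds hδ), Metric.tendsto_nhds.mp hk δ hδ] with n h1 h2
    exact ⟨h1, h2⟩
  have hcau : CauchySeq fun n : ℕ => (resolv A (r n))^[⌊t * (n + 1)⌋₊] x := by
    rw [Metric.cauchySeq_iff]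
    intro ε hε
    obtain ⟨δ, hδ, h⟩ := hA.exists_uniform_bound hd x t hε
    obtain ⟨n0, hn0⟩ := eventually_atTop.mp (ev hrt hrk δ hδ)
    refine ⟨n0, fun m hm n hn => ?_⟩
    rw [dist_eq_norm]
    exact h _ _ _ _ (hr0 m) (hr0 n) (hn0 m hm).1 (hn0 n hn).1 (hn0 m hm).2 (hn0 n hn).2
  have hlim := hcau.tendsto_limUnder
  refine (tendsto_iff_of_dist ?_).mp hlim
  rw [Metric.tendsto_nhds]
  intro ε hε
  obtain ⟨δ, hδ, h⟩ := hA.exists_uniform_bound hd x t hε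
  filter_upwards [ev hrt hrk δ hδ, ev hl hk δ hδ] with n h1 h2
  rw [Real.dist_eq, sub_zero, abs_of_nonneg dist_nonneg, dist_eq_norm]
  exact h _ _ _ _ (hr0 n) (hl0 n) h1.1 h2.1 h1.2 h2.2

/-- The Euler scheme of step `1 / (n + 1)` and the number of steps up to the time `t`. -/
lemma exists_tendsto_semi (hA : MaxMonotone A) (hd : Dense {x | ∃ w, A x w}) {t : ℝ}
    (ht : 0 ≤ t) : ∃ (lam : ℕ → ℝ) (k : ℕ → ℕ), (∀ n, 0 < lam n) ∧ Tendsto lam atTop (𝓝 0) ∧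
      Tendsto (fun n => k n * lam n) atTop (𝓝 t) ∧
      ∀ x, Tendsto (fun n => (resolv A (lam n))^[k n] x) atTop (𝓝 (semi A t x)) := by
  refine ⟨fun n => 1 / ((n : ℝ) + 1), fun n => ⌊t / (1 / ((n : ℝ) + 1))⌋₊,
    fun n => Nat.one_div_pos_of_nat, tendsto_one_div_add_atTop_nhds_zero_nat,
    tendsto_floor_mul (fun n => Nat.one_div_pos_of_nat)
      tendsto_one_div_add_atTop_nhds_zero_nat ht, fun x => ?_⟩
  exact hA.tendsto_semi hd x ht (fun n => Nat.one_div_pos_of_nat)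
    tendsto_one_div_add_atTop_nhds_zero_nat (tendsto_floor_mul (fun n => Nat.one_div_pos_of_nat)
      tendsto_one_div_add_atTop_nhds_zero_nat ht)

lemma semi_zero (hA : MaxMonotone A) (hd : Dense {x | ∃ w, A x w}) (x : H) :
    semi A 0 x = x := by
  have := hA.tendsto_semi hd x le_rfl (lam := fun n => 1 / ((n : ℝ) + 1)) (k := fun _ => 0)
    (fun n => Nat.one_div_pos_of_nat) tendsto_one_div_add_atTop_nhds_zero_nat (by simp)
  exact tendsto_nhds_unique this (by simp)

lemma norm_semi_sub_le (hA : MaxMonotone A) (hd : Dense {x | ∃ w, A x w}) {t : ℝ} (ht : 0 ≤ t)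
    (x y : H) : ‖semi A t x - semi A t y‖ ≤ ‖x - y‖ := by
  obtain ⟨lam, k, hl, -, -, h⟩ := hA.exists_tendsto_semi hd ht
  exact le_of_tendsto ((h x).sub (h y)).norm
    (Eventually.of_forall fun n => hA.norm_iterate_sub_le (hl n) _ _ _)

lemma norm_semi_sub_self_le (hA : MaxMonotone A) (hd : Dense {x | ∃ w, A x w}) {t : ℝ}
    (ht : 0 ≤ t) {x w : H} (hx : A x w) : ‖semi A t x - x‖ ≤ t * ‖w‖ := by
  obtain ⟨lam, k, hl, -, hk, h⟩ := hA.exists_tendsto_semi hd ht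
  exact le_of_tendsto_of_tendsto ((h x).sub_const x).norm (hk.mul_const ‖w‖)
    (Eventually.of_forall fun n => hA.norm_iterate_sub_self_le (hl n) hx _)

lemma semi_benilan (hA : MaxMonotone A) (hd : Dense {x | ∃ w, A x w}) {t : ℝ} (ht : 0 ≤ t)
    {x w y z : H} (hx : A x w) (hy : A y z) :
    ‖semi A t x - y‖ ^ 2 / 2 - ‖x - y‖ ^ 2 / 2 ≤
      -(t * inner ℝ z (x - y)) + t ^ 2 * (‖z‖ * ‖w‖) := by
  obtain ⟨lam, k, hl, -, hk, h⟩ := hA.exists_tendsto_semi hd ht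
  exact le_of_tendsto_of_tendsto (((((h x).sub_const y).norm.pow 2).div_const 2).sub_const _)
    ((hk.mul_const _).neg.add ((hk.pow 2).mul_const _))
    (Eventually.of_forall fun n => hA.iterate_benilan (hl n) hx hy _)

lemma semi_add (hA : MaxMonotone A) (hd : Dense {x | ∃ w, A x w}) {s t : ℝ} (hs : 0 ≤ s)
    (ht : 0 ≤ t) (x : H) : semi A (s + t) x = semi A t (semi A s x) := by
  obtain ⟨lam, k, hl, hl0, hk, h⟩ := hA.exists_tendsto_semi hd hs
  have hj := tendsto_floor_mul hl hl0 ht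
  set j : ℕ → ℕ := fun n => ⌊t / lam n⌋₊ with hjdef
  have h1 := hA.tendsto_semi hd (semi A s x) ht hl hl0 hj
  have h2 : Tendsto (fun n => (resolv A (lam n))^[j n + k n] x) atTop (𝓝 (semi A (s + t) x)) := by
    refine hA.tendsto_semi hd x (add_nonneg hs ht) hl hl0 ?_
    convert hk.add hj using 2 with n
    · push_cast; ring
  refine tendsto_nhds_unique h2 ((tendsto_iff_of_dist ?_).mp h1)
  refine squeeze_zero (fun _ => dist_nonneg) (fun n => ?_)
    ((tendsto_iff_norm_sub_tendsto_zero.mp (h x)))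
  rw [dist_comm, dist_eq_norm, Function.iterate_add_apply]
  exact hA.norm_iterate_sub_le (hl n) _ _ _

lemma exists_apply_semi (hA : MaxMonotone A) (hd : Dense {x | ∃ w, A x w}) {t : ℝ}
    (ht : 0 ≤ t) {x w : H} (hx : A x w) : ∃ z, A (semi A t x) z ∧ ‖z‖ ≤ ‖w‖ := by
  obtain ⟨lam, k, hl, -, -, h⟩ := hA.exists_tendsto_semi hd ht
  suffices hM : ∀ mu, 0 < mu → ‖yosida A mu (semi A t x)‖ ≤ ‖w‖ by
    obtain ⟨z, hz, hzw, -⟩ := hA.exists_apply_of_yosida_le hM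
    exact ⟨z, hz, hzw⟩
  intro mu hm
  refine le_of_tendsto (x := atTop) (f := fun n => ‖yosida A mu ((resolv A (lam n))^[k n] x)‖)
    (Tendsto.norm ?_) (Eventually.of_forall fun n => ?_)
  · refine (Tendsto.sub (h x) ?_).const_smul _
    rw [tendsto_iff_norm_sub_tendsto_zero]
    exact squeeze_zero (fun _ => norm_nonneg _) (fun n => hA.norm_resolv_sub_le hm _ _)
      (tendsto_iff_norm_sub_tendsto_zero.mp (h x))
  · obtain ⟨z, hz, hzw⟩ := hA.exists_apply_iterate (hl n) hx (k n)
    exact (hA.norm_yosida_le hm hz).trans hzw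

/-- Relations between initial values that all the resolvents preserve are preserved by the
semigroup. -/
lemma semi_mem_of_isClosed (hA : MaxMonotone A) (hd : Dense {x | ∃ w, A x w}) {R : Set (H × H)}
    (hR : IsClosed R)
    (h : ∀ lam, 0 < lam → ∀ x y, (x, y) ∈ R → (resolv A lam x, resolv A lam y) ∈ R) {t : ℝ}
    (ht : 0 ≤ t) {x y : H} (hxy : (x, y) ∈ R) : (semi A t x, semi A t y) ∈ R := by
  obtain ⟨lam, k, hl, -, -, hk⟩ := hA.exists_tendsto_semi hd ht
  refine hR.mem_of_tendsto ((hk x).prodMk_nhds (hk y)) (Eventually.of_forall fun n => ?_)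
  have : ∀ j, ((resolv A (lam n))^[j] x, (resolv A (lam n))^[j] y) ∈ R := by
    intro j
    induction j with
    | zero => exact hxy
    | succ j ih =>
      rw [Function.iterate_succ_apply', Function.iterate_succ_apply']
      exact h _ (hl n) _ _ ih
  exact this _

lemma continuousOn_semi (hA : MaxMonotone A) (hd : Dense {x | ∃ w, A x w}) (x : H) :
    ContinuousOn (fun t => semi A t x) (Ici 0) := by
  have lip : ∀ y w, A y w → ∀ s t, 0 ≤ s → s ≤ t →
      ‖semi A t y - semi A s y‖ ≤ (t - s) * ‖w‖ := by
    intro y w hy s t hs hst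
    obtain ⟨z, hz, hzw⟩ := hA.exists_apply_semi hd hs hy
    have := hA.norm_semi_sub_self_le hd (sub_nonneg.mpr hst) hz
    rw [← hA.semi_add hd hs (sub_nonneg.mpr hst), add_sub_cancel] at this
    exact this.trans (mul_le_mul_of_nonneg_left hzw (sub_nonneg.mpr hst))
  have lip' : ∀ y w, A y w → ∀ s t, 0 ≤ s → 0 ≤ t →
      ‖semi A t y - semi A s y‖ ≤ |t - s| * ‖w‖ := by
    intro y w hy s t hs ht
    rcases le_total s t with h | h
    · rw [abs_of_nonneg (sub_nonneg.mpr h)]; exact lip y w hy s t hs h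
    · rw [abs_sub_comm, abs_of_nonneg (sub_nonneg.mpr h), norm_sub_rev]; exact lip y w hy t s ht h
  rw [Metric.continuousOn_iff]
  intro s hs ε hε
  obtain ⟨y, ⟨w, hw⟩, hxy⟩ := hd.exists_dist_lt x (by positivity : 0 < ε / 4)
  rw [dist_eq_norm] at hxy
  refine ⟨ε / 4 / (‖w‖ + 1), by positivity, fun t ht hst => ?_⟩
  rw [Real.dist_eq, lt_div_iff₀ (by positivity)] at hst
  have h1 := hA.norm_semi_sub_le hd ht x y
  have h2 := hA.norm_semi_sub_le hd hs y x
  rw [norm_sub_rev y x] at h2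
  have h3 := lip' y w hw s t hs ht
  have h5 := norm_add₃_le (a := semi A t x - semi A t y)
    (b := semi A t y - semi A s y) (c := semi A s y - semi A s x)
  rw [sub_add_sub_cancel, sub_add_sub_cancel] at h5
  rw [dist_eq_norm]
  nlinarith [abs_nonneg (t - s)]

end MaxMonotone

/-! ### Continuity of the norm of the speed along paths of finite energy -/

lemma hasDerivWithinAt_Ici_of_tendsto {H : Type*} [NormedAddCommGroup H] [NormedSpace ℝ H]
    {u : ℝ → H} {t : ℝ} {w : H}
    (h : Tendsto (fun h : ℝ => h⁻¹ • (u t - u (t + h))) (𝓝[>] 0) (𝓝 w)) :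
    HasDerivWithinAt u (-w) (Ici t) t := by
  rw [← hasDerivWithinAt_Ioi_iff_Ici, hasDerivWithinAt_iff_tendsto_slope' (by simp)]
  have h1 : Tendsto (fun s : ℝ => s - t) (𝓝[>] t) (𝓝[>] 0) := by
    refine tendsto_nhdsWithin_iff.mpr ⟨?_, ?_⟩
    · have : Tendsto (fun s : ℝ => s - t) (𝓝 t) (𝓝 (t - t)) :=
        (continuous_id.sub continuous_const).tendsto t
      rw [sub_self] at this
      exact this.mono_left nhdsWithin_le_nhds
    · filter_upwards [self_mem_nhdsWithin] with s hs
      simpa using hs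
  refine ((h.comp h1).neg).congr fun s => ?_
  simp only [Function.comp, slope, vsub_eq_sub, add_sub_cancel]
  rw [← smul_neg, neg_sub]

lemma hasDerivWithinAt_Iic_of_tendsto {H : Type*} [NormedAddCommGroup H] [NormedSpace ℝ H]
    {u : ℝ → H} {t : ℝ} {w : H}
    (h : Tendsto (fun h : ℝ => h⁻¹ • (u (t - h) - u t)) (𝓝[>] 0) (𝓝 w)) :
    HasDerivWithinAt u (-w) (Iic t) t := by
  rw [← hasDerivWithinAt_Iio_iff_Iic, hasDerivWithinAt_iff_tendsto_slope' (by simp)]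
  have h1 : Tendsto (fun s : ℝ => t - s) (𝓝[<] t) (𝓝[>] 0) := by
    refine tendsto_nhdsWithin_iff.mpr ⟨?_, ?_⟩
    · have : Tendsto (fun s : ℝ => t - s) (𝓝 t) (𝓝 (t - t)) :=
        (continuous_const.sub continuous_id).tendsto t
      rw [sub_self] at this
      exact this.mono_left nhdsWithin_le_nhds
    · filter_upwards [self_mem_nhdsWithin] with s hs
      simpa using hs
  refine ((h.comp h1).neg).congr fun s => ?_
  simp only [Function.comp, slope, vsub_eq_sub, sub_sub_cancel]
  rw [← neg_sub s t, inv_neg, neg_smul, neg_neg]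

/-- A path `u` of speed `W` at each time `t ≥ 0`, with decreasing norm `‖W‖`, together with a path
`r` for which `⟪W s - W t, u s - u t⟫` is comparable to `‖r s - r t‖ ^ 2`. -/
structure EnergyPath {H K : Type*} [NormedAddCommGroup H] [InnerProductSpace ℝ H]
    [NormedAddCommGroup K] (u W : ℝ → H) (r : ℝ → K) (C : ℝ) : Prop where
  pos : 0 < C
  cont : Continuous u
  cont_r : Continuous r
  anti : Antitone fun t => ‖W t‖
  lip : ∀ s t, s ≤ t → ‖u t - u s‖ ≤ (t - s) * ‖W s‖
  deriv : ∀ t, 0 ≤ t → Tendsto (fun h : ℝ => h⁻¹ • (u t - u (t + h))) (𝓝[>] 0) (𝓝 (W t))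
  lower : ∀ s t, ‖r s - r t‖ ^ 2 ≤ C * inner ℝ (W s - W t) (u s - u t)
  upper : ∀ s t, inner ℝ (W s - W t) (u s - u t) ≤ C * ‖r s - r t‖ ^ 2

namespace EnergyPath

variable {H K : Type*} [NormedAddCommGroup H] [InnerProductSpace ℝ H] [NormedAddCommGroup K]
  {u W : ℝ → H} {r : ℝ → K} {C : ℝ}

lemma anti_sq (hu : EnergyPath u W r C) : Antitone fun t => ‖W t‖ ^ 2 :=
  fun _ _ h => pow_le_pow_left₀ (norm_nonneg _) (hu.anti h) 2

lemma continuous_diff (hu : EnergyPath u W r C) (h : ℝ) :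
    Continuous fun t => ‖r (t + h) - r t‖ ^ 2 :=
  (((hu.cont_r.comp (continuous_id.add continuous_const)).sub hu.cont_r).norm.pow 2)

lemma hasDerivWithinAt_sq (hu : EnergyPath u W r C) {t h : ℝ} (ht : 0 ≤ t) (hh : 0 < h) :
    HasDerivWithinAt (fun t => ‖u (t + h) - u t‖ ^ 2)
      (-(2 * inner ℝ (W (t + h) - W t) (u (t + h) - u t))) (Ici t) t := by
  have h1 := hasDerivWithinAt_Ici_of_tendsto (hu.deriv t ht)
  have h2 := hasDerivWithinAt_Ici_of_tendsto (hu.deriv (t + h) (by positivity))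
  have h3 : HasDerivWithinAt (fun t => u (t + h)) (-W (t + h)) (Ici t) t := by
    have := HasDerivWithinAt.scomp (h := fun t => t + h) (h' := (1 : ℝ)) (s := Ici t) t h2
      ((hasDerivWithinAt_id t _).add_const h)
      (fun s (hs : t ≤ s) => add_le_add_left hs h)
    simpa [Function.comp_def] using this
  have h4 := (h3.sub h1).inner ℝ (h3.sub h1)
  simp only [Pi.sub_apply, real_inner_self_eq_norm_sq] at h4
  refine h4.congr_deriv ?_
  rw [real_inner_comm, ← two_mul]
  rw [show -W (t + h) - -W t = -(W (t + h) - W t) by abel, inner_neg_left]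
  ring

lemma sq_sub_le_integral (hu : EnergyPath u W r C) {a b h : ℝ} (ha : 0 ≤ a) (hab : a ≤ b)
    (hh : 0 < h) :
    ‖u (a + h) - u a‖ ^ 2 - ‖u (b + h) - u b‖ ^ 2 ≤
      2 * C * ∫ t in a..b, ‖r (t + h) - r t‖ ^ 2 := by
  have hc := hu.continuous_diff h
  have hcu : Continuous fun t => ‖u (t + h) - u t‖ ^ 2 :=
    (((hu.cont.comp (continuous_id.add continuous_const)).sub hu.cont).norm.pow 2)
  have hI : ∀ x, HasDerivAt (fun x => ∫ t in a..x, ‖r (t + h) - r t‖ ^ 2)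
      (‖r (x + h) - r x‖ ^ 2) x := fun x =>
    intervalIntegral.integral_hasDerivAt_right (hc.intervalIntegrable _ _)
      (hc.stronglyMeasurableAtFilter _ _) hc.continuousAt
  have hIc : Continuous fun x => ∫ t in a..x, ‖r (t + h) - r t‖ ^ 2 :=
    continuous_iff_continuousAt.mpr fun x => (hI x).continuousAt
  have := image_le_of_deriv_right_le_deriv_boundary (a := a) (b := b)
    (f := fun x => -‖u (x + h) - u x‖ ^ 2)
    (B := fun x => 2 * C * (∫ t in a..x, ‖r (t + h) - r t‖ ^ 2) - ‖u (a + h) - u a‖ ^ 2)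
    hcu.neg.continuousOn
    (fun x hx => (hu.hasDerivWithinAt_sq (ha.trans hx.1) hh).neg) (by simp)
    ((hIc.const_mul _).sub continuous_const).continuousOn
    (fun x hx => (((hI x).const_mul (2 * C)).sub_const _).hasDerivWithinAt)
    (fun x hx => by
      have := hu.upper (x + h) x
      linarith) (right_mem_Icc.mpr hab)
  linarith

lemma integral_le_sq_sub (hu : EnergyPath u W r C) {a b h : ℝ} (ha : 0 ≤ a) (hab : a ≤ b)
    (hh : 0 < h) :
    2 * (∫ t in a..b, ‖r (t + h) - r t‖ ^ 2) ≤
      C * (‖u (a + h) - u a‖ ^ 2 - ‖u (b + h) - u b‖ ^ 2) := by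
  have hc := hu.continuous_diff h
  have hcu : Continuous fun t => ‖u (t + h) - u t‖ ^ 2 :=
    (((hu.cont.comp (continuous_id.add continuous_const)).sub hu.cont).norm.pow 2)
  have hI : ∀ x, HasDerivAt (fun x => ∫ t in a..x, ‖r (t + h) - r t‖ ^ 2)
      (‖r (x + h) - r x‖ ^ 2) x := fun x =>
    intervalIntegral.integral_hasDerivAt_right (hc.intervalIntegrable _ _)
      (hc.stronglyMeasurableAtFilter _ _) hc.continuousAt
  have hIc : Continuous fun x => ∫ t in a..x, ‖r (t + h) - r t‖ ^ 2 :=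
    continuous_iff_continuousAt.mpr fun x => (hI x).continuousAt
  have := image_le_of_deriv_right_le_deriv_boundary (a := a) (b := b)
    (f := fun x => C * ‖u (x + h) - u x‖ ^ 2 + 2 * ∫ t in a..x, ‖r (t + h) - r t‖ ^ 2)
    (B := fun x => C * ‖u (a + h) - u a‖ ^ 2) (B' := fun _ => 0)
    ((hcu.const_mul _).add (hIc.const_mul _)).continuousOn
    (fun x hx => ((hu.hasDerivWithinAt_sq (ha.trans hx.1) hh).const_mul C).add
      ((hI x).const_mul 2).hasDerivWithinAt) (by simp)
    continuousOn_const
    (fun x hx => hasDerivWithinAt_const _ _ _)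
    (fun x hx => by
      have := hu.lower (x + h) x
      linarith) (right_mem_Icc.mpr hab)
  linarith

lemma tendsto_sq_quotient (hu : EnergyPath u W r C) {t : ℝ} (ht : 0 ≤ t) :
    Tendsto (fun h : ℝ => (h ^ 2)⁻¹ * ‖u (t + h) - u t‖ ^ 2) (𝓝[>] 0) (𝓝 (‖W t‖ ^ 2)) := by
  refine ((hu.deriv t ht).norm.pow 2).congr fun h => ?_
  rw [norm_smul, mul_pow, norm_inv, inv_pow, Real.norm_eq_abs, sq_abs, norm_sub_rev]

lemma sq_sum_diff_le (r : ℝ → K) (t d : ℝ) (n : ℕ) :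
    ‖r (t + n * d) - r t‖ ^ 2 ≤
      n * ∑ j ∈ Finset.range n, ‖r (t + j * d + d) - r (t + j * d)‖ ^ 2 := by
  have h1 : r (t + n * d) - r t =
      ∑ j ∈ Finset.range n, (r (t + j * d + d) - r (t + j * d)) := by
    have := Finset.sum_range_sub (fun j : ℕ => r (t + j * d)) n
    simp only [Nat.cast_zero, zero_mul, add_zero] at this
    rw [← this]
    refine Finset.sum_congr rfl fun j _ => ?_
    push_cast
    ring_nf
  have h2 : ‖r (t + n * d) - r t‖ ≤
      ∑ j ∈ Finset.range n, ‖r (t + j * d + d) - r (t + j * d)‖ := by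
    rw [h1]; exact norm_sum_le _ _
  refine (pow_le_pow_left₀ (norm_nonneg _) h2 2).trans ?_
  simpa using sq_sum_le_card_mul_sum_sq (s := Finset.range n)
    (f := fun j : ℕ => ‖r (t + j * d + d) - r (t + j * d)‖)

/-- The path `r` is of finite energy, with energy density bounded by the decrease of `‖W‖ ^ 2`:
the quotients of step `h` are averages of quotients of steps `h / n`. -/
lemma sq_diff_le (hu : EnergyPath u W r C) {t h : ℝ} (ht : 0 ≤ t) (hh : 0 < h) :
    2 * ‖r (t + h) - r t‖ ^ 2 ≤ C * h * (‖W t‖ ^ 2 - ‖W (t + h)‖ ^ 2) := by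
  set d : ℕ → ℝ := fun n => h / ((n : ℝ) + 1) with hd
  have hd0 : ∀ n, 0 < d n := fun n => by positivity
  have hdt : Tendsto d atTop (𝓝[>] 0) := by
    refine tendsto_nhdsWithin_iff.mpr ⟨?_, Eventually.of_forall hd0⟩
    have := (tendsto_one_div_add_atTop_nhds_zero_nat (𝕜 := ℝ)).const_mul h
    simpa [hd, div_eq_mul_inv] using this
  have hc := hu.continuous_diff h
  have key : ∀ n, 2 * ((d n)⁻¹ * ∫ τ in t..t + d n, ‖r (τ + h) - r τ‖ ^ 2) ≤
      C * h * ((d n ^ 2)⁻¹ * ‖u (t + d n) - u t‖ ^ 2 -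
        (d n ^ 2)⁻¹ * ‖u (t + h + d n) - u (t + h)‖ ^ 2) := by
    intro n
    have hnd : ((n + 1 : ℕ) : ℝ) * d n = h := by
      simp only [hd]; push_cast; field_simp
    have hcd := hu.continuous_diff (d n)
    have h1 : ∫ τ in t..t + d n, ‖r (τ + h) - r τ‖ ^ 2 ≤
        ∫ τ in t..t + d n, ((n + 1 : ℕ) : ℝ) * ∑ j ∈ Finset.range (n + 1),
          ‖r (τ + j * d n + d n) - r (τ + j * d n)‖ ^ 2 := by
      refine intervalIntegral.integral_mono_on (by linarith [hd0 n]) (hc.intervalIntegrable _ _)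
        ?_ (fun τ _ => ?_)
      · refine Continuous.intervalIntegrable ?_ _ _
        refine continuous_const.mul (continuous_finsetSum _ fun j _ => ?_)
        exact hcd.comp (continuous_id.add continuous_const)
      · have := sq_sum_diff_le r τ (d n) (n + 1)
        rwa [hnd] at this
    have h2 : (∫ τ in t..t + d n, ((n + 1 : ℕ) : ℝ) * ∑ j ∈ Finset.range (n + 1),
          ‖r (τ + j * d n + d n) - r (τ + j * d n)‖ ^ 2) =
        ((n + 1 : ℕ) : ℝ) * ∫ τ in t..t + h, ‖r (τ + d n) - r τ‖ ^ 2 := by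
      rw [intervalIntegral.integral_const_mul, intervalIntegral.integral_finsetSum]
      · congr 1
        have h3 := intervalIntegral.sum_integral_adjacent_intervals (μ := volume)
          (f := fun τ => ‖r (τ + d n) - r τ‖ ^ 2) (a := fun j : ℕ => t + j * d n) (n := n + 1)
          (fun j _ => hcd.intervalIntegrable _ _)
        rw [hnd, Nat.cast_zero, zero_mul, add_zero] at h3
        rw [← h3]
        refine Finset.sum_congr rfl fun j _ => ?_
        rw [intervalIntegral.integral_comp_add_right (fun τ => ‖r (τ + d n) - r τ‖ ^ 2)]
        congr 1
        push_cast
        ring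
      · intro j _
        exact (hcd.comp (continuous_id.add continuous_const)).intervalIntegrable _ _
    have h3 := hu.integral_le_sq_sub ht (by linarith : t ≤ t + h) (hd0 n)
    rw [h2] at h1
    have h4 : 2 * ∫ τ in t..t + d n, ‖r (τ + h) - r τ‖ ^ 2 ≤ ((n + 1 : ℕ) : ℝ) *
        (C * (‖u (t + d n) - u t‖ ^ 2 - ‖u (t + h + d n) - u (t + h)‖ ^ 2)) := by
      calc _ ≤ ((n + 1 : ℕ) : ℝ) * (2 * ∫ τ in t..t + h, ‖r (τ + d n) - r τ‖ ^ 2) := by linarith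
        _ ≤ _ := by gcongr
    have h5 := mul_le_mul_of_nonneg_left h4 (inv_nonneg.mpr (hd0 n).le)
    refine le_trans (le_of_eq (by ring)) (h5.trans (le_of_eq ?_))
    have hne := (hd0 n).ne'
    rw [← hnd]
    field_simp
  have hI : HasDerivAt (fun x => ∫ τ in t..x, ‖r (τ + h) - r τ‖ ^ 2) (‖r (t + h) - r t‖ ^ 2) t :=
    intervalIntegral.integral_hasDerivAt_right (hc.intervalIntegrable _ _)
      (hc.stronglyMeasurableAtFilter _ _) hc.continuousAt
  have l1 := (hI.tendsto_slope_zero_right.comp hdt).const_mul 2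
  have l2 := (((hu.tendsto_sq_quotient ht).comp hdt).sub
    ((hu.tendsto_sq_quotient (by positivity : 0 ≤ t + h)).comp hdt)).const_mul (C * h)
  refine le_of_tendsto_of_tendsto l1 l2 (Eventually.of_forall fun n => ?_)
  simpa using key n

lemma sq_le_of_forall_gt (hu : EnergyPath u W r C) {t : ℝ} (ht : 0 ≤ t) {m : ℝ}
    (hm : ∀ s, t < s → ‖W s‖ ≤ m) : ‖W t‖ ≤ m := by
  have h1 : ∀ h : ℝ, 0 < h → ‖h⁻¹ • (u t - u (t + h))‖ ≤ m := by
    intro h hh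
    have h2 : ‖u (t + h) - u t‖ ≤ h * m := by
      have l1 : Tendsto (fun e => ‖u (t + h) - u (t + e)‖) (𝓝[>] 0) (𝓝 ‖u (t + h) - u (t + 0)‖) :=
        (Continuous.tendsto (continuous_const.sub
          (hu.cont.comp (continuous_const.add continuous_id))).norm 0).mono_left
            nhdsWithin_le_nhds
      have l2 : Tendsto (fun e : ℝ => (h - e) * m) (𝓝[>] 0) (𝓝 ((h - 0) * m)) :=
        (Continuous.tendsto ((continuous_const.sub continuous_id).mul_const m) 0).mono_left
            nhdsWithin_le_nhds
      rw [add_zero] at l1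
      rw [sub_zero] at l2
      refine le_of_tendsto_of_tendsto l1 l2 ?_
      filter_upwards [Ioo_mem_nhdsGT hh] with e he
      have := hu.lip (t + e) (t + h) (by linarith [he.2])
      refine this.trans (le_of_eq_of_le (by ring) (mul_le_mul_of_nonneg_left
        (hm (t + e) (by linarith [he.1])) (by linarith [he.2] : 0 ≤ h - e)))
    rw [norm_smul, norm_inv, Real.norm_of_nonneg hh.le, inv_mul_le_iff₀ hh, norm_sub_rev]
    exact h2
  refine le_of_tendsto (hu.deriv t ht).norm ?_
  filter_upwards [self_mem_nhdsWithin] with h hh using h1 h hh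

lemma add_sq_le_of_sq_le {x y a b α β : ℝ} (ha : 0 ≤ a) (hb : 0 ≤ b)
    (hα : 0 ≤ α) (hβ : 0 ≤ β) (hx : x ^ 2 ≤ a * α) (hy : y ^ 2 ≤ b * β) :
    (x + y) ^ 2 ≤ (a + b) * (α + β) := by
  have h1 : (x * y) ^ 2 ≤ ((a * β + b * α) / 2) ^ 2 := by
    have : x ^ 2 * y ^ 2 ≤ (a * α) * (b * β) := by gcongr
    nlinarith [sq_nonneg (a * β - b * α)]
  have h2 := abs_le_of_sq_le_sq' h1 (by positivity)
  nlinarith [h2.2]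

/-- The norm of the speed has no jump. The path `r` is continuous, so that a jump of `‖W‖ ^ 2` at
`t₀` does not contribute to its energy, which in turn controls the decrease of `‖W‖ ^ 2`. -/
lemma eventually_norm_lt (hu : EnergyPath u W r C) {t₀ : ℝ} (ht₀ : 0 < t₀) {ε : ℝ} (hε : 0 < ε) :
    ∀ᶠ t in 𝓝[<] t₀, ‖W t‖ < ‖W t₀‖ + ε := by
  set g : ℝ → ℝ := fun t => ‖W t‖ ^ 2 with hg
  have hga : Antitone g := hu.anti_sq
  set L := sInf (g '' Iio t₀) with hL
  have hLt : Tendsto g (𝓝[<] t₀) (𝓝 L) := hga.tendsto_nhdsLT t₀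
  have hLle : ∀ t, t < t₀ → L ≤ g t := fun t ht =>
    csInf_le ⟨0, by rintro _ ⟨s, -, rfl⟩; positivity⟩ ⟨t, ht, rfl⟩
  have hgL : g t₀ ≤ L := le_csInf ⟨g (t₀ - 1), t₀ - 1, by simp, rfl⟩
    (by rintro _ ⟨s, hs, rfl⟩; exact hga (le_of_lt hs))
  suffices hLg : L ≤ g t₀ by
    have h1 : g t₀ < (‖W t₀‖ + ε) ^ 2 := by
      have := norm_nonneg (W t₀)
      simp only [hg]
      gcongr
      linarith
    filter_upwards [hLt.eventually (gt_mem_nhds (hLg.trans_lt h1))] with t ht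
    exact lt_of_pow_lt_pow_left₀ 2 (by positivity) ht
  have hC := hu.pos
  -- the energy of `r` on the left of `t₀` does not see the jump
  have left : ∀ t, 0 ≤ t → t < t₀ → 2 * ‖r t₀ - r t‖ ^ 2 ≤ C * (t₀ - t) * (g t - L) := by
    intro t ht htt
    have l1 : Tendsto (fun s => 2 * ‖r s - r t‖ ^ 2) (𝓝[<] t₀) (𝓝 (2 * ‖r t₀ - r t‖ ^ 2)) :=
      (Continuous.tendsto (((hu.cont_r.sub continuous_const).norm.pow 2).const_mul 2) t₀).mono_left
        nhdsWithin_le_nhds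
    have l2 : Tendsto (fun s => C * (s - t) * (g t - L)) (𝓝[<] t₀)
        (𝓝 (C * (t₀ - t) * (g t - L))) :=
      (Continuous.tendsto (((continuous_id.sub continuous_const).const_mul C).mul_const _)
        t₀).mono_left nhdsWithin_le_nhds
    refine le_of_tendsto_of_tendsto l1 l2 ?_
    filter_upwards [Ioo_mem_nhdsLT htt] with s hs
    have := hu.sq_diff_le ht (sub_pos.mpr hs.1)
    rw [add_sub_cancel] at this
    refine this.trans ?_
    have h1 := hLle s hs.2
    have : 0 ≤ C * (s - t) := mul_nonneg hC.le (sub_nonneg.mpr hs.1.le)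
    gcongr
  -- `gc` is `‖W‖ ^ 2` with the jump at `t₀` removed
  set gc : ℝ → ℝ := fun t => if t < t₀ then g t - (L - g t₀) else g t with hgc
  have hgca : Antitone gc := by
    intro s t hst
    simp only [hgc]
    split_ifs with h1 h2 h2
    · linarith [hga hst]
    · linarith
    · linarith [hLle s h2, hga (not_lt.mp h1)]
    · exact hga hst
  have energy : ∀ t d, 0 ≤ t → 0 < d →
      2 * ‖r (t + d) - r t‖ ^ 2 ≤ C * d * (gc t - gc (t + d)) := by
    intro t d ht hd
    have h0 := hu.sq_diff_le ht hd
    simp only [hgc]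
    split_ifs with h1 h2 h2
    · simpa only [sub_sub_sub_cancel_right] using h0
    · rcases (not_lt.mp h2).eq_or_lt with h3 | h3
      · have := left t ht h1
        have e : d = t₀ - t := by linarith
        rw [e, add_sub_cancel]
        refine this.trans (le_of_eq (by ring))
      · have e1 := left t ht h1
        have e2 := hu.sq_diff_le ht₀.le (sub_pos.mpr h3)
        rw [add_sub_cancel] at e2
        have e3 := add_sq_le_of_sq_le (x := ‖r t₀ - r t‖) (y := ‖r (t + d) - r t₀‖)
          (a := C * (t₀ - t) / 2) (α := g t - L) (b := C * (t + d - t₀) / 2)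
          (β := g t₀ - g (t + d)) (by have := sub_pos.mpr h1; positivity)
          (by have := sub_pos.mpr h3; positivity)
          (sub_nonneg.mpr (hLle t h1)) (sub_nonneg.mpr (hga h3.le)) (by linarith)
          (by simp only [hg]; linarith)
        have e4 : ‖r (t + d) - r t‖ ≤ ‖r t₀ - r t‖ + ‖r (t + d) - r t₀‖ := by
          linarith [norm_sub_le_norm_sub_add_norm_sub (r (t + d)) (r t₀) (r t)]
        have e5 := pow_le_pow_left₀ (norm_nonneg _) e4 2
        linarith
    · linarith
    · exact h0
  -- the energy controls the decrease of the quotients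
  have quot : ∀ t η d, 0 ≤ t → t < t₀ → 0 < d → d < η →
      (d ^ 2)⁻¹ * ‖u (t + d) - u t‖ ^ 2 - (d ^ 2)⁻¹ * ‖u (t₀ + d) - u t₀‖ ^ 2 ≤
        C ^ 2 * (gc t - gc (t₀ + η)) := by
    intro t η d ht htt hd hdη
    have hi : ∀ a b, IntervalIntegrable gc volume a b := fun a b => hgca.intervalIntegrable
    have hi' : ∀ a b, IntervalIntegrable (fun s => gc (s + d)) volume a b := fun a b =>
      (show Antitone fun s => gc (s + d) from
        fun x y hxy => hgca (add_le_add_left hxy d)).intervalIntegrable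
    have h1 := hu.sq_sub_le_integral ht htt.le hd
    have h2 : 2 * ∫ s in t..t₀, ‖r (s + d) - r s‖ ^ 2 ≤
        ∫ s in t..t₀, C * d * (gc s - gc (s + d)) := by
      rw [← intervalIntegral.integral_const_mul]
      refine intervalIntegral.integral_mono_on htt.le
        (((hu.continuous_diff d).const_mul 2).intervalIntegrable _ _)
        (((hi _ _).sub (hi' _ _)).const_mul _) (fun s hs => energy s d (ht.trans hs.1) hd)
    rw [intervalIntegral.integral_const_mul, intervalIntegral.integral_sub (hi _ _) (hi' _ _),
      intervalIntegral.integral_comp_add_right,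
      intervalIntegral.integral_interval_sub_interval_comm (hi _ _) (hi _ _) (hi _ _)] at h2
    have h3 : ∫ s in t..t + d, gc s ≤ d * gc t := by
      have := intervalIntegral.integral_mono_on (by linarith : t ≤ t + d) (hi _ _)
        (intervalIntegrable_const (c := gc t)) (fun s hs => hgca hs.1)
      simpa using this
    have h4 : d * gc (t₀ + η) ≤ ∫ s in t₀..t₀ + d, gc s := by
      have := intervalIntegral.integral_mono_on (by linarith : t₀ ≤ t₀ + d)
        (intervalIntegrable_const (c := gc (t₀ + η))) (hi _ _)
        (fun s hs => hgca (by linarith [hs.2] : s ≤ t₀ + η))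
      simpa using this
    have h5 : ‖u (t + d) - u t‖ ^ 2 - ‖u (t₀ + d) - u t₀‖ ^ 2 ≤
        d ^ 2 * (C ^ 2 * (gc t - gc (t₀ + η))) := by
      have h6 := mul_le_mul_of_nonneg_left h2 hC.le
      have h7 : C * (C * d * ((∫ s in t..t + d, gc s) - ∫ s in t₀..t₀ + d, gc s)) ≤
          C * (C * d * (d * gc t - d * gc (t₀ + η))) := by gcongr
      calc _ ≤ _ := h1
        _ = C * (2 * ∫ s in t..t₀, ‖r (s + d) - r s‖ ^ 2) := by ring
        _ ≤ _ := h6.trans h7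
        _ = _ := by ring
    rw [← mul_sub, inv_mul_le_iff₀ (by positivity)]
    exact h5
  have lim1 : ∀ t η, 0 ≤ t → t < t₀ → 0 < η → g t - g t₀ ≤ C ^ 2 * (gc t - gc (t₀ + η)) := by
    intro t η ht htt hη
    refine le_of_tendsto ((hu.tendsto_sq_quotient ht).sub (hu.tendsto_sq_quotient ht₀.le)) ?_
    filter_upwards [Ioo_mem_nhdsGT hη] with d hd using quot t η d ht htt hd.1 hd.2
  have lim2 : ∀ s, t₀ < s → L - g t₀ ≤ C ^ 2 * (g t₀ - g s) := by
    intro s hs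
    have l2 : Tendsto (fun t => C ^ 2 * (g t - (L - g t₀) - g s)) (𝓝[<] t₀)
        (𝓝 (C ^ 2 * (L - (L - g t₀) - g s))) := ((hLt.sub_const _).sub_const _).const_mul _
    rw [sub_sub_cancel] at l2
    refine le_of_tendsto_of_tendsto (hLt.sub_const (g t₀)) l2 ?_
    filter_upwards [Ioo_mem_nhdsLT ht₀] with t ht
    have := lim1 t (s - t₀) ht.1.le ht.2 (sub_pos.mpr hs)
    rw [add_sub_cancel] at this
    simpa [hgc, ht.2, hs.not_gt] using this
  -- a jump at `t₀` entails a decrease by a fixed amount immediately after `t₀`, against the right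
  -- continuity of `‖W‖`
  by_contra! hlt
  have h1 : ∀ s, t₀ < s → g s ≤ g t₀ - (L - g t₀) / C ^ 2 := by
    intro s hs
    have := lim2 s hs
    rw [← div_le_iff₀' (by positivity)] at this
    linarith
  have h2 : 0 < (L - g t₀) / C ^ 2 := by
    have := sub_pos.mpr hlt
    positivity
  have h3 := hu.sq_le_of_forall_gt ht₀.le (m := √(g t₀ - (L - g t₀) / C ^ 2))
    (fun s hs => Real.le_sqrt_of_sq_le (h1 s hs))
  have h4 : 0 ≤ g t₀ - (L - g t₀) / C ^ 2 := (sq_nonneg ‖W (t₀ + 1)‖).trans (h1 _ (by simp))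
  have h5 := pow_le_pow_left₀ (norm_nonneg _) h3 2
  rw [Real.sq_sqrt h4] at h5
  simp only [hg] at h5 h2
  linarith

end EnergyPath

/-! ### Differentiability of the semigroup at positive times -/

namespace MaxMonotone

lemma resolv_smul {H : Type*} [NormedAddCommGroup H] [InnerProductSpace ℝ H]
    {A : H → H → Prop} {p : ℝ} (hA : MaxMonotone A)
    (hom : ∀ {κ : ℝ}, 0 < κ → ∀ {x w}, A x w → A (κ • x) (κ ^ (p - 1) • w)) {κ lam : ℝ}
    (hκ : 0 < κ) (hl : 0 < lam) (x : H) :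
    resolv A lam (κ • x) = κ • resolv A (κ ^ (p - 2) * lam) x := by
  have hm : 0 < κ ^ (p - 2) * lam := by positivity
  have h1 := hA.resolv_eq hl (hom hκ (hA.apply_resolv hm x))
  rw [← h1]
  congr 1
  conv_lhs => rw [← resolv_add_smul_yosida (A := A) hm x]
  have e : κ ^ (p - 1) = κ * κ ^ (p - 2) := by
    rw [show p - 1 = 1 + (p - 2) by ring, Real.rpow_add hκ, Real.rpow_one]
  rw [smul_add, smul_smul, smul_smul, e]
  congr 2
  ring

variable {H K : Type*} [NormedAddCommGroup H] [InnerProductSpace ℝ H] [CompleteSpace H]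
  [NormedAddCommGroup K] {A : H → H → Prop}

lemma tendsto_right_quotient (hA : MaxMonotone A) (hd : Dense {x | ∃ w, A x w}) {x w : H}
    (hx : A x w) : Tendsto (fun h : ℝ => h⁻¹ • (x - semi A h x)) (𝓝[>] 0) (𝓝 w) := by
  refine hA.tendsto_of_inner_ge hx (fun ε hε => ?_) (fun y z hy ε hε => ?_)
  · filter_upwards [self_mem_nhdsWithin] with h (hh : 0 < h)
    have := hA.norm_semi_sub_self_le hd hh.le hx
    rw [norm_smul, norm_inv, Real.norm_of_nonneg hh.le, norm_sub_rev, inv_mul_le_iff₀ hh]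
    exact this.trans (by gcongr; linarith)
  · have h1 : Tendsto (fun h : ℝ => h * (‖z‖ * ‖w‖)) (𝓝[>] 0) (𝓝 0) := by
      have : Continuous (fun h : ℝ => h * (‖z‖ * ‖w‖)) := by fun_prop
      simpa using (this.tendsto 0).mono_left nhdsWithin_le_nhds
    filter_upwards [self_mem_nhdsWithin, h1.eventually (gt_mem_nhds hε)] with h (hh : 0 < h) hε'
    have h2 := hA.semi_benilan hd hh.le hx hy
    set q := h⁻¹ • (x - semi A h x) with hq
    have e : semi A h x - y = (x - y) - h • q := by
      rw [hq, smul_inv_smul₀ hh.ne']; abel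
    rw [e, norm_sub_sq_real, real_inner_smul_right] at h2
    rw [real_inner_comm q] at h2
    have h3 : h * (inner ℝ z (x - y) - ε) ≤ h * inner ℝ q (x - y) := by
      nlinarith [sq_nonneg ‖h • q‖]
    exact le_of_mul_le_mul_left h3 hh

/-- The left difference quotients converge at `t` as soon as the norm of the speed is
continuous from the left at `t`. -/
lemma tendsto_left_quotient (hA : MaxMonotone A) (hd : Dense {x | ∃ w, A x w}) {u W : ℝ → H}
    {M t : ℝ} (ht : 0 < t) (hW : ∀ s, 0 ≤ s → A (u s) (W s)) (hM : ∀ s, ‖W s‖ ≤ M)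
    (hu : ∀ s h, 0 ≤ s → 0 ≤ h → u (s + h) = semi A h (u s))
    (hleft : ∀ ε, 0 < ε → ∀ᶠ s in 𝓝[<] t, ‖W s‖ < ‖W t‖ + ε) :
    Tendsto (fun h : ℝ => h⁻¹ • (u (t - h) - u t)) (𝓝[>] 0) (𝓝 (W t)) := by
  have hsub : Tendsto (fun h : ℝ => t - h) (𝓝[>] 0) (𝓝[<] t) := by
    refine tendsto_nhdsWithin_iff.mpr ⟨?_, ?_⟩
    · have : Tendsto (fun h : ℝ => t - h) (𝓝 0) (𝓝 (t - 0)) :=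
        (continuous_const.sub continuous_id).tendsto 0
      rw [sub_zero] at this
      exact this.mono_left nhdsWithin_le_nhds
    · filter_upwards [self_mem_nhdsWithin] with s (hs : 0 < s)
      simpa using hs
  have hq : ∀ h, 0 < h → h < t → ‖h⁻¹ • (u (t - h) - u t)‖ ≤ ‖W (t - h)‖ := by
    intro h hh hht
    have h1 := hA.norm_semi_sub_self_le hd hh.le (hW (t - h) (by linarith))
    rw [← hu _ _ (by linarith) hh.le, sub_add_cancel] at h1
    rwa [norm_smul, norm_inv, Real.norm_of_nonneg hh.le, norm_sub_rev, inv_mul_le_iff₀ hh]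
  refine hA.tendsto_of_inner_ge (hW t ht.le) (fun ε hε => ?_) (fun y z hy ε hε => ?_)
  · filter_upwards [Ioo_mem_nhdsGT ht, hsub.eventually (hleft ε hε)] with h hh hh2
    exact (hq h hh.1 hh.2).trans hh2.le
  · have h1 : Tendsto (fun h : ℝ => h * (2 * (‖z‖ * M) + M ^ 2 / 2)) (𝓝[>] 0) (𝓝 0) := by
      have : Continuous (fun h : ℝ => h * (2 * (‖z‖ * M) + M ^ 2 / 2)) := by fun_prop
      simpa using (this.tendsto 0).mono_left nhdsWithin_le_nhds
    filter_upwards [Ioo_mem_nhdsGT ht, h1.eventually (gt_mem_nhds hε)] with h hh hε'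
    have h2 := hA.semi_benilan hd hh.1.le (hW (t - h) (by linarith [hh.2])) hy
    rw [← hu _ _ (by linarith [hh.2]) hh.1.le, sub_add_cancel] at h2
    have hqM := (hq h hh.1 hh.2).trans (hM _)
    set q := h⁻¹ • (u (t - h) - u t) with hqdef
    have e : u (t - h) - y = (u t - y) + h • q := by
      rw [hqdef, smul_inv_smul₀ hh.1.ne']; abel
    clear_value q
    rw [e, norm_add_sq_real, real_inner_smul_right, inner_add_right, real_inner_smul_right,
      norm_smul, Real.norm_of_nonneg hh.1.le, real_inner_comm q] at h2
    have h3 : -(‖z‖ * M) ≤ inner ℝ z q := by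
      have := neg_le_of_abs_le (abs_real_inner_le_norm z q)
      have : ‖z‖ * ‖q‖ ≤ ‖z‖ * M := by gcongr
      linarith
    have h4 : ‖z‖ * ‖W (t - h)‖ ≤ ‖z‖ * M := by gcongr; exact hM _
    have h5 : ‖q‖ ^ 2 ≤ M ^ 2 := pow_le_pow_left₀ (norm_nonneg _) hqM 2
    have h6 : h ^ 2 * -(‖z‖ * M) ≤ h ^ 2 * inner ℝ z q := by gcongr
    have h7 : h ^ 2 * (‖z‖ * ‖W (t - h)‖) ≤ h ^ 2 * (‖z‖ * M) := by gcongr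
    have h8 : h ^ 2 * ‖q‖ ^ 2 ≤ h ^ 2 * M ^ 2 := by gcongr
    have h9 : h * (inner ℝ z (u t - y) - ε) ≤ h * inner ℝ q (u t - y) := by
      have h10 := mul_lt_mul_of_pos_left hε' hh.1
      nlinarith
    exact le_of_mul_le_mul_left h9 hh.1

/-- From an initial value in the domain, the semigroup is differentiable at each `t > 0`. -/
lemma hasDerivAt_semi_of_apply (hA : MaxMonotone A) (hd : Dense {x | ∃ w, A x w}) {U : H → K}
    {C : ℝ} (hC : 0 < C)
    (hlow : ∀ {x w y z}, A x w → A y z → ‖U x - U y‖ ^ 2 ≤ C * inner ℝ (w - z) (x - y))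
    (hup : ∀ {x w y z}, A x w → A y z → inner ℝ (w - z) (x - y) ≤ C * ‖U x - U y‖ ^ 2)
    {x w₀ : H} (hx : A x w₀) {t : ℝ} (ht : 0 < t) :
    ∃ w, A (semi A t x) w ∧ HasDerivAt (fun t => semi A t x) (-w) t := by
  have hdom : ∀ s : ℝ, ∃ w, A (semi A (max s 0) x) w ∧ ‖w‖ ≤ ‖w₀‖ := fun s =>
    hA.exists_apply_semi hd (le_max_right _ _) hx
  choose W hW hWM using hdom
  set u : ℝ → H := fun s => semi A (max s 0) x with hu
  have hu0 : ∀ s, 0 ≤ s → u s = semi A s x := fun s hs => by simp [hu, hs]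
  have hstep : ∀ s t, s ≤ t → u t = semi A (max t 0 - max s 0) (u s) := fun s t hst => by
    rw [hu, ← hA.semi_add hd (le_max_right _ _) (sub_nonneg.mpr (max_le_max_right 0 hst)),
      add_sub_cancel]
  have hadd : ∀ s h, 0 ≤ s → 0 ≤ h → u (s + h) = semi A h (u s) := fun s h hs hh => by
    rw [hstep s (s + h) (by linarith), max_eq_left hs, max_eq_left (add_nonneg hs hh),
      add_sub_cancel_left]
  have hlip : ∀ s t, s ≤ t → ‖u t - u s‖ ≤ (t - s) * ‖W s‖ := fun s t hst => by
    have h1 := hA.norm_semi_sub_self_le hd (sub_nonneg.mpr (max_le_max_right 0 hst)) (hW s)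
    rw [← hstep s t hst] at h1
    refine h1.trans ?_
    refine mul_le_mul_of_nonneg_right ?_ (norm_nonneg _)
    rcases le_total t 0 with h2 | h2
    · rw [max_eq_right h2, max_eq_right (hst.trans h2)]; linarith
    · rw [max_eq_left h2]; linarith [le_max_left s 0]
  have hlip' : ∀ s t, ‖u t - u s‖ ≤ ‖w₀‖ * |t - s| := fun s t => by
    rcases le_total s t with h | h
    · rw [abs_of_nonneg (sub_nonneg.mpr h), mul_comm]
      exact (hlip s t h).trans (mul_le_mul_of_nonneg_left (hWM s) (sub_nonneg.mpr h))
    · rw [abs_sub_comm, abs_of_nonneg (sub_nonneg.mpr h), norm_sub_rev, mul_comm]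
      exact (hlip t s h).trans (mul_le_mul_of_nonneg_left (hWM t) (sub_nonneg.mpr h))
  have hcont : Continuous u := by
    refine (LipschitzWith.of_dist_le_mul (K := ⟨‖w₀‖, norm_nonneg _⟩) fun s t => ?_).continuous
    rw [dist_eq_norm, Real.dist_eq]
    exact hlip' t s
  have hcr : Continuous fun s => U (u s) := by
    rw [continuous_iff_continuousAt]
    intro s
    rw [ContinuousAt, tendsto_iff_norm_sub_tendsto_zero]
    have h1 : ∀ t, ‖U (u t) - U (u s)‖ ≤ √(C * ((‖w₀‖ + ‖w₀‖) * ‖u t - u s‖)) := fun t => by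
      refine Real.le_sqrt_of_sq_le ((hlow (hW t) (hW s)).trans ?_)
      gcongr
      refine (real_inner_le_norm _ _).trans ?_
      gcongr
      exact (norm_sub_le _ _).trans (add_le_add (hWM t) (hWM s))
    refine squeeze_zero (fun _ => norm_nonneg _) h1 ?_
    have : Continuous fun t => √(C * ((‖w₀‖ + ‖w₀‖) * ‖u t - u s‖)) := by fun_prop
    simpa using this.tendsto s
  have hE : EnergyPath u W (fun s => U (u s)) C :=
    { pos := hC
      cont := hcont
      cont_r := hcr
      anti := fun s t hst => by
        obtain ⟨z, hz, hzw⟩ := hA.exists_apply_semi hd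
          (sub_nonneg.mpr (max_le_max_right 0 hst)) (hW s)
        rw [← hstep s t hst] at hz
        simpa only [hA.single (hW t) hz] using hzw
      lip := hlip
      deriv := fun s hs => by
        have h1 := hA.tendsto_right_quotient hd (hW s)
        refine h1.congr' ?_
        filter_upwards [self_mem_nhdsWithin] with h (hh : 0 < h)
        rw [hadd s h hs hh.le]
      lower := fun s t => hlow (hW s) (hW t)
      upper := fun s t => hup (hW s) (hW t) }
  refine ⟨W t, by simpa only [hu, max_eq_left ht.le] using hW t, ?_⟩
  have h1 := hasDerivWithinAt_Ici_of_tendsto (hE.deriv t ht.le)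
  have h2 := hasDerivWithinAt_Iic_of_tendsto (hA.tendsto_left_quotient hd ht (fun s _ => hW s) hWM
    hadd (fun ε hε => hE.eventually_norm_lt ht hε))
  have h3 := h2.union h1
  rw [Iic_union_Ici, hasDerivWithinAt_univ] at h3
  refine h3.congr_of_eventuallyEq ?_
  filter_upwards [lt_mem_nhds ht] with s hs
  exact (hu0 s hs.le).symm

section Homogeneous

variable {p : ℝ}

lemma semi_smul (hA : MaxMonotone A) (hd : Dense {x | ∃ w, A x w})
    (hom : ∀ {κ : ℝ}, 0 < κ → ∀ {x w}, A x w → A (κ • x) (κ ^ (p - 1) • w)) {κ t : ℝ}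
    (hκ : 0 < κ) (ht : 0 ≤ t) (x : H) :
    semi A t (κ • x) = κ • semi A (κ ^ (p - 2) * t) x := by
  obtain ⟨lam, k, hl, hl0, hk, h⟩ := hA.exists_tendsto_semi hd ht
  have h1 := hA.tendsto_semi hd x (t := κ ^ (p - 2) * t) (by positivity)
    (lam := fun n => κ ^ (p - 2) * lam n) (k := k) (fun n => by have := hl n; positivity)
    (by simpa using hl0.const_mul (κ ^ (p - 2)))
    ((hk.const_mul (κ ^ (p - 2))).congr fun n => by ring)
  refine tendsto_nhds_unique (h (κ • x)) ((h1.const_smul κ).congr fun n => ?_)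
  generalize k n = j
  induction j with
  | zero => simp
  | succ j ih =>
    rw [Function.iterate_succ_apply', Function.iterate_succ_apply', ← ih,
      hA.resolv_smul hom hκ (hl n)]

lemma norm_semi_le (hA : MaxMonotone A) (hd : Dense {x | ∃ w, A x w}) (h0 : A 0 0) {t : ℝ}
    (ht : 0 ≤ t) (x : H) : ‖semi A t x‖ ≤ ‖x‖ := by
  have h1 := hA.norm_semi_sub_self_le hd ht h0
  rw [norm_zero, mul_zero, norm_le_zero_iff, sub_zero] at h1
  have h2 := hA.norm_semi_sub_le hd ht x 0
  rwa [h1, sub_zero, sub_zero] at h2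

/-- The regularizing effect of homogeneity (Bénilan and Crandall): since
`κ • semi A (κ ^ (p - 2) * t) x` is again an orbit, the contraction property compares the values of
one orbit at different times. -/
lemma norm_semi_sub_le_of_homogeneous (hA : MaxMonotone A) (hd : Dense {x | ∃ w, A x w})
    (h0 : A 0 0) (hp : 2 < p)
    (hom : ∀ {κ : ℝ}, 0 < κ → ∀ {x w}, A x w → A (κ • x) (κ ^ (p - 1) • w)) {t h : ℝ}
    (ht : 0 < t) (hh : 0 < h) (x : H) :
    ‖semi A (t + h) x - semi A t x‖ ≤ h * (2 / ((p - 2) * t) * ‖x‖) := by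
  have hp2 : 0 < p - 2 := by linarith
  set ρ : ℝ := 1 + h / t with hρ
  have hρ0 : 0 < ρ := by positivity
  have hρ1 : 1 ≤ ρ := by
    have : 0 ≤ h / t := by positivity
    linarith
  set κ : ℝ := ρ ^ (1 / (p - 2)) with hκdef
  have hκ : 0 < κ := Real.rpow_pos_of_pos hρ0 _
  have hκ1 : 1 ≤ κ := Real.one_le_rpow hρ1 (by positivity)
  have e : κ ^ (p - 2) * t = t + h := by
    rw [hκdef, ← Real.rpow_mul hρ0.le, one_div_mul_cancel hp2.ne', Real.rpow_one, hρ]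
    field_simp
  have h1 : semi A (t + h) x = κ⁻¹ • semi A t (κ • x) := by
    rw [hA.semi_smul hd hom hκ ht.le, inv_smul_smul₀ hκ.ne', e]
  have h2 := hA.norm_semi_sub_le hd ht.le (κ • x) x
  have h3 := hA.norm_semi_le hd h0 ht.le x
  have h4 : ‖κ • x - x‖ = (κ - 1) * ‖x‖ := by
    rw [show κ • x - x = (κ - 1) • x by module, norm_smul,
      Real.norm_of_nonneg (by linarith)]
  have hκi : κ⁻¹ ≤ 1 := inv_le_one_of_one_le₀ hκ1
  have h5 : ‖semi A (t + h) x - semi A t x‖ ≤ 2 * (1 - κ⁻¹) * ‖x‖ := by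
    have : semi A (t + h) x - semi A t x =
        κ⁻¹ • (semi A t (κ • x) - semi A t x) - (1 - κ⁻¹) • semi A t x := by
      rw [h1]; module
    rw [this]
    refine (norm_sub_le _ _).trans ?_
    rw [norm_smul, norm_smul, Real.norm_of_nonneg (by positivity),
      Real.norm_of_nonneg (by linarith)]
    have h6 : κ⁻¹ * ‖semi A t (κ • x) - semi A t x‖ ≤ κ⁻¹ * ((κ - 1) * ‖x‖) := by
      gcongr; exact h2.trans h4.le
    have h7 : (1 - κ⁻¹) * ‖semi A t x‖ ≤ (1 - κ⁻¹) * ‖x‖ :=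
      mul_le_mul_of_nonneg_left h3 (by linarith)
    have h8 : κ⁻¹ * (κ - 1) = 1 - κ⁻¹ := by field_simp
    rw [← mul_assoc, h8] at h6
    linarith
  have h6 : 1 - κ⁻¹ ≤ 1 / (p - 2) * (h / t) := by
    have e1 : κ⁻¹ = Real.exp (-(1 / (p - 2) * Real.log ρ)) := by
      rw [Real.exp_neg, hκdef, Real.rpow_def_of_pos hρ0, mul_comm]
    have h7 := Real.add_one_le_exp (-(1 / (p - 2) * Real.log ρ))
    have h8 : Real.log ρ ≤ h / t := by
      have := Real.log_le_sub_one_of_pos hρ0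
      linarith
    have h9 : 1 / (p - 2) * Real.log ρ ≤ 1 / (p - 2) * (h / t) := by gcongr
    rw [e1]; linarith
  calc _ ≤ 2 * (1 - κ⁻¹) * ‖x‖ := h5
    _ ≤ 2 * (1 / (p - 2) * (h / t)) * ‖x‖ := by gcongr
    _ = _ := by field_simp

lemma exists_apply_semi_of_homogeneous (hA : MaxMonotone A) (hd : Dense {x | ∃ w, A x w})
    (h0 : A 0 0) (hp : 2 < p)
    (hom : ∀ {κ : ℝ}, 0 < κ → ∀ {x w}, A x w → A (κ • x) (κ ^ (p - 1) • w)) {t : ℝ}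
    (ht : 0 < t) (x : H) : ∃ w, A (semi A t x) w := by
  have hp2 : 0 < p - 2 := by linarith
  -- the bound of the speed for initial values in the domain
  have hD : ∀ y w, A y w → ∃ z, A (semi A t y) z ∧ ‖z‖ ≤ 2 / ((p - 2) * t) * ‖y‖ := by
    intro y w hy
    obtain ⟨z, hz, -⟩ := hA.exists_apply_semi hd ht.le hy
    refine ⟨z, hz, le_of_tendsto (hA.tendsto_right_quotient hd hz).norm ?_⟩
    filter_upwards [self_mem_nhdsWithin] with h (hh : 0 < h)
    rw [← hA.semi_add hd ht.le hh.le, norm_smul, norm_inv, Real.norm_of_nonneg hh.le,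
      inv_mul_le_iff₀ hh, norm_sub_rev]
    exact hA.norm_semi_sub_le_of_homogeneous hd h0 hp hom ht hh y
  suffices hM : ∀ mu, 0 < mu → ‖yosida A mu (semi A t x)‖ ≤ 2 / ((p - 2) * t) * ‖x‖ by
    obtain ⟨z, hz, -⟩ := hA.exists_apply_of_yosida_le hM
    exact ⟨z, hz⟩
  intro mu hm
  obtain ⟨y, hy, hyx⟩ := mem_closure_iff_seq_limit.mp (hd x)
  have hlim : Tendsto (fun n => semi A t (y n)) atTop (𝓝 (semi A t x)) := by
    rw [tendsto_iff_norm_sub_tendsto_zero] at hyx ⊢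
    exact squeeze_zero (fun _ => norm_nonneg _) (fun n => hA.norm_semi_sub_le hd ht.le _ _) hyx
  have hlim2 : Tendsto (fun n => yosida A mu (semi A t (y n))) atTop
      (𝓝 (yosida A mu (semi A t x))) := by
    refine (hlim.sub ?_).const_smul _
    rw [tendsto_iff_norm_sub_tendsto_zero] at hlim ⊢
    exact squeeze_zero (fun _ => norm_nonneg _) (fun n => hA.norm_resolv_sub_le hm _ _) hlim
  refine le_of_tendsto_of_tendsto hlim2.norm (hyx.norm.const_mul _)
    (Eventually.of_forall fun n => ?_)
  obtain ⟨w, hw⟩ := hy n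
  obtain ⟨z, hz, hzy⟩ := hD _ _ hw
  exact (hA.norm_yosida_le hm hz).trans hzy

/-- Orbits of the semigroup of a homogeneous operator are differentiable at each `t > 0`, if the
monotonicity of the operator is comparable to the distance of a Hilbert space or, more generally,
of a normed group. -/
theorem hasDerivAt_semi (hA : MaxMonotone A) (hd : Dense {x | ∃ w, A x w})
    (h0 : A 0 0) (hp : 2 < p)
    (hom : ∀ {κ : ℝ}, 0 < κ → ∀ {x w}, A x w → A (κ • x) (κ ^ (p - 1) • w)) {U : H → K}
    {C : ℝ} (hC : 0 < C)
    (hlow : ∀ {x w y z}, A x w → A y z → ‖U x - U y‖ ^ 2 ≤ C * inner ℝ (w - z) (x - y))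
    (hup : ∀ {x w y z}, A x w → A y z → inner ℝ (w - z) (x - y) ≤ C * ‖U x - U y‖ ^ 2)
    (x : H) {t : ℝ} (ht : 0 < t) :
    ∃ w, A (semi A t x) w ∧ HasDerivAt (fun t => semi A t x) (-w) t := by
  obtain ⟨z, hz⟩ := hA.exists_apply_semi_of_homogeneous hd h0 hp hom (half_pos ht) x
  obtain ⟨w, hw, hder⟩ := hA.hasDerivAt_semi_of_apply hd hC hlow hup hz (half_pos ht)
  rw [← hA.semi_add hd (half_pos ht).le (half_pos ht).le, add_halves] at hw
  refine ⟨w, hw, ?_⟩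
  have h1 : HasDerivAt (fun s => semi A (s - t / 2) (semi A (t / 2) x)) (-w) t := by
    have e : t / 2 = t - t / 2 := by ring
    rw [e] at hder
    have := HasDerivAt.scomp (h := fun s => s - t / 2) (h' := (1 : ℝ)) t hder
      ((hasDerivAt_id t).sub_const (t / 2))
    rw [one_smul, ← e] at this
    exact this
  refine h1.congr_of_eventuallyEq ?_
  filter_upwards [lt_mem_nhds (half_lt_self ht)] with s hs
  rw [← hA.semi_add hd (half_pos ht).le (sub_nonneg.mpr hs.le), add_sub_cancel]

end Homogeneous

end MaxMonotone

/-! ### The powers `|a|^r a` in `Lᵖ` spaces, and the minimum problem -/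

/-- The odd power function `|a|^r a`. -/
noncomputable def powMul (r a : ℝ) : ℝ := |a| ^ r * a

lemma powMul_neg (r a : ℝ) : powMul r (-a) = -powMul r a := by simp [powMul]

lemma powMul_mul {r κ : ℝ} (hκ : 0 < κ) (a : ℝ) :
    powMul r (κ * a) = κ ^ (r + 1) * powMul r a := by
  rw [powMul, powMul, abs_mul, abs_of_pos hκ, Real.mul_rpow hκ.le (abs_nonneg _),
    Real.rpow_add_one hκ.ne']
  ring

lemma powMul_one (r : ℝ) : powMul r 1 = 1 := by simp [powMul]

lemma powMul_of_nonneg {r a : ℝ} (hr : 0 < r) (ha : 0 ≤ a) : powMul r a = a ^ (r + 1) := by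
  rw [powMul, abs_of_nonneg ha, Real.rpow_add_one' ha (by linarith)]

lemma abs_powMul {r : ℝ} (hr : 0 < r) (a : ℝ) : |powMul r a| = |a| ^ (r + 1) := by
  rw [powMul, abs_mul, abs_of_nonneg (Real.rpow_nonneg (abs_nonneg a) r),
    Real.rpow_add_one' (abs_nonneg a) (by linarith)]

lemma continuous_powMul {r : ℝ} (hr : 0 ≤ r) : Continuous (powMul r) :=
  (continuous_abs.rpow_const fun _ => Or.inr hr).mul continuous_id

lemma powMul_ineq_unit {p ρ : ℝ} (hp : 2 < p) (hρ : |ρ| ≤ 1) :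
    (1 - powMul ((p - 2) / 2) ρ) ^ 2 ≤ p ^ 2 / 4 * ((1 - powMul (p - 2) ρ) * (1 - ρ)) ∧
      (1 - powMul (p - 2) ρ) * (1 - ρ) ≤ 2 * (1 - powMul ((p - 2) / 2) ρ) ^ 2 := by
  have key : ∀ r : ℝ, 0 ≤ r → r ≤ 1 → r ^ (p - 1) ≤ r ∧ 1 - r ^ (p / 2) ≤ p / 2 * (1 - r) ∧
      2 * r ^ (p / 2) ≤ r + r ^ (p - 1) ∧ (r ^ (p / 2)) ^ 2 = r * r ^ (p - 1) ∧
      0 ≤ r ^ (p / 2) ∧ r ^ (p / 2) ≤ 1 ∧ 0 ≤ r ^ (p - 1) ∧ r ^ (p - 1) ≤ 1 := by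
    intro r h0 h1
    have e2 : (r ^ (p / 2)) ^ 2 = r * r ^ (p - 1) := by
      rw [← Real.rpow_natCast, ← Real.rpow_mul h0]
      nth_rw 2 [← Real.rpow_one r]
      rw [← Real.rpow_add_of_nonneg h0 zero_le_one (by linarith)]
      congr 1; push_cast; ring
    have i1 : 0 ≤ r ^ (p / 2) := Real.rpow_nonneg h0 _
    have i3 : 0 ≤ r ^ (p - 1) := Real.rpow_nonneg h0 _
    refine ⟨?_, ?_, ?_, e2, i1, Real.rpow_le_one h0 h1 (by linarith), i3,
      Real.rpow_le_one h0 h1 (by linarith)⟩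
    · calc r ^ (p - 1) ≤ r ^ (1 : ℝ) := Real.rpow_le_rpow_of_exponent_ge' h0 h1 zero_le_one
            (by linarith)
        _ = r := Real.rpow_one r
    · have := one_add_mul_self_le_rpow_one_add (by linarith : -1 ≤ r - 1) (by linarith : 1 ≤ p / 2)
      rw [add_sub_cancel] at this
      linarith
    · refine abs_le_of_sq_le_sq' ?_ (by positivity) |>.2
      nlinarith [sq_nonneg (r - r ^ (p - 1))]
  have e1 : (p - 2) / 2 + 1 = p / 2 := by ring
  have e2 : p - 2 + 1 = p - 1 := by ring
  have hpp : 1 ≤ p ^ 2 / 4 := by nlinarith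
  rcases le_total 0 ρ with h | h
  · rw [abs_of_nonneg h] at hρ
    rw [powMul_of_nonneg (by linarith) h, powMul_of_nonneg (by linarith) h, e1, e2]
    obtain ⟨k1, k2, k3, k4, k5, k6, k7, k8⟩ := key ρ h hρ
    set x := ρ ^ (p / 2)
    set y := ρ ^ (p - 1)
    constructor
    · have h1 : (1 - x) ^ 2 ≤ (p / 2 * (1 - ρ)) ^ 2 := pow_le_pow_left₀ (by linarith) k2 2
      have h2 : (1 - ρ) * (1 - ρ) ≤ (1 - y) * (1 - ρ) :=
        mul_le_mul_of_nonneg_right (by linarith) (by linarith)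
      nlinarith [mul_le_mul_of_nonneg_left h2 (by positivity : 0 ≤ p ^ 2 / 4)]
    · nlinarith [sq_nonneg (1 - x)]
  · rw [abs_of_nonpos h] at hρ
    obtain ⟨r, rfl⟩ : ∃ r, ρ = -r := ⟨-ρ, by simp⟩
    rw [neg_neg] at hρ
    have h' : 0 ≤ r := by linarith
    rw [powMul_neg, powMul_neg, powMul_of_nonneg (by linarith) h',
      powMul_of_nonneg (by linarith) h', e1, e2]
    obtain ⟨k1, k2, k3, k4, k5, k6, k7, k8⟩ := key r h' hρ
    set x := r ^ (p / 2)
    set y := r ^ (p - 1)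
    have h1 : 0 ≤ (1 - -y) * (1 - -r) := by
      rw [sub_neg_eq_add, sub_neg_eq_add]; positivity
    constructor
    · have h2 := mul_le_mul_of_nonneg_right hpp h1
      nlinarith
    · nlinarith [mul_nonneg (sub_nonneg.mpr hρ) (sub_nonneg.mpr k8)]

/-- The monotonicity of `|a|^(p-2) a` is comparable, from both sides, to the square of the
differences of `|a|^((p-2)/2) a`. -/
lemma powMul_ineq {p : ℝ} (hp : 2 < p) (a b : ℝ) :
    (powMul ((p - 2) / 2) a - powMul ((p - 2) / 2) b) ^ 2 ≤
        p ^ 2 / 4 * ((powMul (p - 2) a - powMul (p - 2) b) * (a - b)) ∧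
      (powMul (p - 2) a - powMul (p - 2) b) * (a - b) ≤
        2 * (powMul ((p - 2) / 2) a - powMul ((p - 2) / 2) b) ^ 2 := by
  wlog hab : |b| ≤ |a| generalizing a b
  · have := this b a (le_of_not_ge hab)
    rw [← neg_sub a b, ← neg_sub (powMul _ a), ← neg_sub (powMul (p - 2) a), neg_mul_neg,
      neg_sq] at this
    exact this
  wlog ha : 0 ≤ a generalizing a b
  · have := this (-a) (-b) (by rwa [abs_neg, abs_neg]) (by linarith)
    simp only [powMul_neg, neg_sub_neg] at this
    rw [← neg_sub a b, ← neg_sub (powMul _ a), ← neg_sub (powMul (p - 2) a), neg_mul_neg,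
      neg_sq] at this
    exact this
  rcases ha.eq_or_lt with rfl | ha0
  · have : b = 0 := by simpa using hab
    subst this
    simp
  obtain ⟨ρ, rfl⟩ : ∃ ρ, b = a * ρ := ⟨b / a, by field_simp⟩
  have hρ : |ρ| ≤ 1 := by
    rw [abs_mul, abs_of_pos ha0] at hab
    exact le_of_mul_le_mul_left (by linarith) ha0
  have ea : ∀ r, powMul r a = a ^ (r + 1) := fun r => by
    have := powMul_mul (r := r) ha0 1
    rwa [mul_one, powMul_one, mul_one] at this
  obtain ⟨h1, h2⟩ := powMul_ineq_unit hp hρ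
  rw [powMul_mul ha0, powMul_mul ha0, ea, ea]
  have e1 : (p - 2) / 2 + 1 = p / 2 := by ring
  have e2 : p - 2 + 1 = p - 1 := by ring
  rw [e1, e2]
  have e3 : (a ^ (p / 2)) ^ 2 = a ^ (p - 1) * a := by
    rw [← Real.rpow_natCast, ← Real.rpow_mul ha, ← Real.rpow_add_one ha0.ne']
    congr 1; push_cast; ring
  have e4 : (a ^ (p / 2) - a ^ (p / 2) * powMul ((p - 2) / 2) ρ) ^ 2 =
      a ^ (p - 1) * a * (1 - powMul ((p - 2) / 2) ρ) ^ 2 := by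
    rw [← e3]; ring
  have e5 : (a ^ (p - 1) - a ^ (p - 1) * powMul (p - 2) ρ) * (a - a * ρ) =
      a ^ (p - 1) * a * ((1 - powMul (p - 2) ρ) * (1 - ρ)) := by ring
  rw [e4, e5]
  have h0 : 0 ≤ a ^ (p - 1) * a := by positivity
  constructor
  · linarith [mul_le_mul_of_nonneg_left h1 h0]
  · linarith [mul_le_mul_of_nonneg_left h2 h0]

lemma powMul_mono {p : ℝ} (hp : 2 < p) : Monotone (powMul (p - 2)) := by
  intro a b hab
  have h := (sq_nonneg _).trans (powMul_ineq hp b a).1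
  by_contra! hlt
  rcases hab.eq_or_lt with rfl | h1
  · exact lt_irrefl _ hlt
  · have : 0 ≤ (powMul (p - 2) b - powMul (p - 2) a) * (b - a) :=
      nonneg_of_mul_nonneg_right h (by positivity)
    nlinarith [mul_pos (sub_pos.mpr hlt) (sub_pos.mpr h1)]

/-- Clarkson's inequality. -/
lemma abs_half_rpow_add_le {p : ℝ} (hp : 2 < p) (a b : ℝ) :
    |(a + b) / 2| ^ p + |(a - b) / 2| ^ p ≤ (|a| ^ p + |b| ^ p) / 2 := by
  have h2 : ∀ x : ℝ, |x| ^ p = (x ^ 2) ^ (p / 2) := fun x => by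
    rw [← sq_abs, ← Real.rpow_natCast, ← Real.rpow_mul (abs_nonneg _)]
    congr 1; push_cast; ring
  rw [h2, h2, h2 a, h2 b]
  refine (Real.add_rpow_le_rpow_add (sq_nonneg _) (sq_nonneg _) (by linarith)).trans ?_
  have h3 := (convexOn_rpow (by linarith : 1 ≤ p / 2)).2 (sq_nonneg a : a ^ 2 ∈ Ici (0 : ℝ))
    (sq_nonneg b : b ^ 2 ∈ Ici (0 : ℝ)) (by norm_num : (0 : ℝ) ≤ 1 / 2)
    (by norm_num : (0 : ℝ) ≤ 1 / 2) (by norm_num)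
  simp only [smul_eq_mul] at h3
  refine le_trans (le_of_eq ?_) (h3.trans (le_of_eq (by ring)))
  congr 1; ring

/-- Young's inequality in its crudest form. -/
lemma rpow_mul_le_add {p x y : ℝ} (hp : 2 < p) (hx : 0 ≤ x) (hy : 0 ≤ y) :
    x ^ (p - 1) * y ≤ x ^ p + y ^ p := by
  have e : ∀ z : ℝ, 0 ≤ z → z ^ (p - 1) * z = z ^ p := fun z hz => by
    rw [← Real.rpow_add_one' hz (by linarith), sub_add_cancel]
  rcases le_total x y with h | h
  · calc x ^ (p - 1) * y ≤ y ^ (p - 1) * y := by gcongr; linarith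
      _ = y ^ p := e y hy
      _ ≤ _ := by linarith [Real.rpow_nonneg hx p]
  · calc x ^ (p - 1) * y ≤ x ^ (p - 1) * x := by gcongr
      _ = x ^ p := e x hx
      _ ≤ _ := by linarith [Real.rpow_nonneg hy p]

section Lp

variable {Z : Type*} [MeasurableSpace Z] {μ : Measure Z} {p : ℝ}

lemma integrable_abs_rpow (hp : 2 < p) {f : Z → ℝ} (hf : MemLp f (ENNReal.ofReal p) μ) :
    Integrable (fun z => |f z| ^ p) μ := by
  have := hf.integrable_norm_rpow (ENNReal.ofReal_pos.mpr (by linarith)).ne' ENNReal.ofReal_ne_top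
  rwa [ENNReal.toReal_ofReal (by linarith)] at this

lemma integrable_Lp_abs_rpow (hp : 2 < p) (g : Lp ℝ (ENNReal.ofReal p) μ) :
    Integrable (fun z => |g z| ^ p) μ := integrable_abs_rpow hp (Lp.memLp g)

lemma integral_abs_rpow (hp : 2 < p) (g : Lp ℝ (ENNReal.ofReal p) μ) :
    ∫ z, |g z| ^ p ∂μ = ‖g‖ ^ p := by
  rw [Lp.norm_def, (Lp.memLp g).eLpNorm_eq_integral_rpow_norm
    (ENNReal.ofReal_pos.mpr (by linarith)).ne' ENNReal.ofReal_ne_top,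
    ENNReal.toReal_ofReal (by linarith : 0 ≤ p)]
  have h0 : 0 ≤ ∫ z, ‖g z‖ ^ p ∂μ := integral_nonneg fun z => by positivity
  rw [ENNReal.toReal_ofReal (Real.rpow_nonneg h0 _), ← Real.rpow_mul h0,
    inv_mul_cancel₀ (by linarith), Real.rpow_one]
  rfl

lemma aestronglyMeasurable_powMul {r : ℝ} (hr : 0 ≤ r) {f : Z → ℝ}
    (hf : AEStronglyMeasurable f μ) : AEStronglyMeasurable (fun z => powMul r (f z)) μ :=
  (continuous_powMul hr).comp_aestronglyMeasurable hf

lemma integrable_powMul_mul (hp : 2 < p) {f h : Z → ℝ} (hf : MemLp f (ENNReal.ofReal p) μ)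
    (hh : MemLp h (ENNReal.ofReal p) μ) : Integrable (fun z => powMul (p - 2) (f z) * h z) μ := by
  refine ((integrable_abs_rpow hp hf).add (integrable_abs_rpow hp hh)).mono'
    ((aestronglyMeasurable_powMul (by linarith) hf.1).mul hh.1) (ae_of_all _ fun z => ?_)
  rw [Real.norm_eq_abs, abs_mul, abs_powMul (by linarith), show p - 2 + 1 = p - 1 by ring]
  exact rpow_mul_le_add hp (abs_nonneg _) (abs_nonneg _)

lemma abs_integral_powMul_mul_le (hp : 2 < p) (g k : Lp ℝ (ENNReal.ofReal p) μ) :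
    |∫ z, powMul (p - 2) (g z) * k z ∂μ| ≤ ‖g‖ ^ p + ‖k‖ ^ p := by
  rw [← integral_abs_rpow hp, ← integral_abs_rpow hp, ← integral_add
    (integrable_Lp_abs_rpow hp g) (integrable_Lp_abs_rpow hp k)]
  refine abs_integral_le_integral_abs.trans (integral_mono
    (integrable_powMul_mul hp (Lp.memLp g) (Lp.memLp k)).abs
    ((integrable_Lp_abs_rpow hp g).add (integrable_Lp_abs_rpow hp k)) fun z => ?_)
  simp only [abs_mul, abs_powMul (by linarith : 0 < p - 2), show p - 2 + 1 = p - 1 by ring]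
  exact rpow_mul_le_add hp (abs_nonneg _) (abs_nonneg _)

lemma exists_bound_of_abs_le {E : Type*} [NormedAddCommGroup E] [NormedSpace ℝ E] (l : E →ₗ[ℝ] ℝ)
    {C : ℝ} (h : ∀ k, |l k| ≤ C + ‖k‖ ^ p) : ∃ M, ∀ k, ‖l k‖ ≤ M * ‖k‖ := by
  refine ⟨C + 1, fun k => ?_⟩
  by_cases hk : ‖k‖ = 0
  · rw [norm_eq_zero.mp hk, map_zero, norm_zero, norm_zero, mul_zero]
  · have h1 := h (‖k‖⁻¹ • k)
    rw [norm_smul, norm_inv, norm_norm, inv_mul_cancel₀ hk, Real.one_rpow, map_smul,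
      ← Real.norm_eq_abs, norm_smul, norm_inv, norm_norm,
      inv_mul_le_iff₀ (lt_of_le_of_ne (norm_nonneg k) (Ne.symm hk))] at h1
    linarith

lemma memLp_two_powMul (hp : 2 < p) (g : Lp ℝ (ENNReal.ofReal p) μ) :
    MemLp (fun z => powMul ((p - 2) / 2) (g z)) 2 μ := by
  rw [memLp_two_iff_integrable_sq
    (aestronglyMeasurable_powMul (by linarith) (Lp.aestronglyMeasurable g))]
  refine (integrable_Lp_abs_rpow hp g).congr (ae_of_all _ fun z => ?_)
  simp only
  rw [← sq_abs, abs_powMul (by linarith), ← Real.rpow_natCast, ← Real.rpow_mul (abs_nonneg _)]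
  congr 1; push_cast; ring

lemma norm_half_rpow_add_le (hp : 2 < p) (g k : Lp ℝ (ENNReal.ofReal p) μ) :
    ‖(1 / 2 : ℝ) • (g + k)‖ ^ p + ‖(1 / 2 : ℝ) • (g - k)‖ ^ p ≤ (‖g‖ ^ p + ‖k‖ ^ p) / 2 := by
  simp only [← integral_abs_rpow hp]
  rw [← integral_add (integrable_Lp_abs_rpow hp _) (integrable_Lp_abs_rpow hp _),
    ← integral_add (integrable_Lp_abs_rpow hp _) (integrable_Lp_abs_rpow hp _),
    ← integral_div]
  refine integral_mono_ae ((integrable_Lp_abs_rpow hp _).add (integrable_Lp_abs_rpow hp _))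
    (((integrable_Lp_abs_rpow hp _).add (integrable_Lp_abs_rpow hp _)).div_const 2) ?_
  filter_upwards [Lp.coeFn_smul (1 / 2 : ℝ) (g + k), Lp.coeFn_smul (1 / 2 : ℝ) (g - k),
    Lp.coeFn_add g k, Lp.coeFn_sub g k] with z h1 h2 h3 h4
  rw [h1, h2, Pi.smul_apply, Pi.smul_apply, h3, h4, Pi.add_apply, Pi.sub_apply, smul_eq_mul,
    smul_eq_mul, one_div_mul_eq_div, one_div_mul_eq_div]
  exact abs_half_rpow_add_le hp _ _

/-- The nonlinear map `g ↦ |g|^((p-2)/2) g` from `Lᵖ` to `L²`. -/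
noncomputable def halfPow (hp : 2 < p) (g : Lp ℝ (ENNReal.ofReal p) μ) : Lp ℝ 2 μ :=
  (memLp_two_powMul hp g).toLp

lemma sq_norm_halfPow_sub (hp : 2 < p) (g k : Lp ℝ (ENNReal.ofReal p) μ) :
    ‖halfPow hp g - halfPow hp k‖ ^ 2 =
      ∫ z, (powMul ((p - 2) / 2) (g z) - powMul ((p - 2) / 2) (k z)) ^ 2 ∂μ := by
  rw [← real_inner_self_eq_norm_sq, L2.inner_def]
  refine integral_congr_ae ?_
  filter_upwards [Lp.coeFn_sub (halfPow hp g) (halfPow hp k), (memLp_two_powMul hp g).coeFn_toLp,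
    (memLp_two_powMul hp k).coeFn_toLp] with z h1 h2 h3
  have h2' : halfPow hp g z = powMul ((p - 2) / 2) (g z) := h2
  have h3' : halfPow hp k z = powMul ((p - 2) / 2) (k z) := h3
  rw [h1, Pi.sub_apply, h2', h3', real_inner_self_eq_norm_sq, Real.norm_eq_abs, sq_abs]

variable [Fact (1 ≤ ENNReal.ofReal p)]

/-- The duality map of `Lᵖ`: the continuous linear form `k ↦ ∫ |g|^(p-2) g k`. -/
noncomputable def dualPow (hp : 2 < p) (g : Lp ℝ (ENNReal.ofReal p) μ) :
    Lp ℝ (ENNReal.ofReal p) μ →L[ℝ] ℝ :=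
  LinearMap.mkContinuousOfExistsBound
    { toFun := fun k => ∫ z, powMul (p - 2) (g z) * k z ∂μ
      map_add' := fun k l => by
        rw [← integral_add (integrable_powMul_mul hp (Lp.memLp g) (Lp.memLp k))
          (integrable_powMul_mul hp (Lp.memLp g) (Lp.memLp l))]
        refine integral_congr_ae ?_
        filter_upwards [Lp.coeFn_add k l] with z hz
        rw [hz, Pi.add_apply, mul_add]
      map_smul' := fun c k => by
        rw [RingHom.id_apply, smul_eq_mul, ← integral_const_mul]
        refine integral_congr_ae ?_
        filter_upwards [Lp.coeFn_smul c k] with z hz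
        rw [hz, Pi.smul_apply, smul_eq_mul]
        ring }
    (exists_bound_of_abs_le _ fun k => abs_integral_powMul_mul_le hp g k)

lemma dualPow_apply (hp : 2 < p) (g k : Lp ℝ (ENNReal.ofReal p) μ) :
    dualPow hp g k = ∫ z, powMul (p - 2) (g z) * k z ∂μ := rfl

lemma dualPow_self (hp : 2 < p) (g : Lp ℝ (ENNReal.ofReal p) μ) : dualPow hp g g = ‖g‖ ^ p := by
  rw [dualPow_apply, ← integral_abs_rpow hp]
  congr 1 with z
  rw [powMul, mul_assoc, ← abs_mul_abs_self, ← mul_assoc,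
    ← Real.rpow_add_one' (abs_nonneg _) (by linarith),
    ← Real.rpow_add_one' (abs_nonneg _) (by linarith)]
  congr 1; ring

lemma dualPow_smul (hp : 2 < p) {κ : ℝ} (hκ : 0 < κ) (g k : Lp ℝ (ENNReal.ofReal p) μ) :
    dualPow hp (κ • g) k = κ ^ (p - 1) * dualPow hp g k := by
  rw [dualPow_apply, dualPow_apply, ← integral_const_mul]
  refine integral_congr_ae ?_
  filter_upwards [Lp.coeFn_smul κ g] with z hz
  rw [hz, Pi.smul_apply, smul_eq_mul, powMul_mul hκ, show p - 2 + 1 = p - 1 by ring, mul_assoc]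

lemma dualPow_sub_apply (hp : 2 < p) (g k l : Lp ℝ (ENNReal.ofReal p) μ) :
    dualPow hp g l - dualPow hp k l =
      ∫ z, (powMul (p - 2) (g z) - powMul (p - 2) (k z)) * l z ∂μ := by
  rw [dualPow_apply, dualPow_apply, ← integral_sub
    (integrable_powMul_mul hp (Lp.memLp g) (Lp.memLp l))
    (integrable_powMul_mul hp (Lp.memLp k) (Lp.memLp l))]
  simp only [sub_mul]

lemma dualPow_sub (hp : 2 < p) (g k : Lp ℝ (ENNReal.ofReal p) μ) :
    ‖halfPow hp g - halfPow hp k‖ ^ 2 ≤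
        p ^ 2 / 4 * (dualPow hp g (g - k) - dualPow hp k (g - k)) ∧
      dualPow hp g (g - k) - dualPow hp k (g - k) ≤ 2 * ‖halfPow hp g - halfPow hp k‖ ^ 2 := by
  have e : dualPow hp g (g - k) - dualPow hp k (g - k) =
      ∫ z, (powMul (p - 2) (g z) - powMul (p - 2) (k z)) * (g z - k z) ∂μ := by
    rw [dualPow_sub_apply]
    refine integral_congr_ae ?_
    filter_upwards [Lp.coeFn_sub g k] with z hz
    rw [hz, Pi.sub_apply]
  have i1 : Integrable (fun z => (powMul (p - 2) (g z) - powMul (p - 2) (k z)) * (g z - k z)) μ := by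
    have hgk : MemLp (fun z => g z - k z) (ENNReal.ofReal p) μ := (Lp.memLp g).sub (Lp.memLp k)
    have := (integrable_powMul_mul hp (Lp.memLp g) hgk).sub
      (integrable_powMul_mul hp (Lp.memLp k) hgk)
    exact this.congr (ae_of_all _ fun z => (sub_mul _ _ _).symm)
  have i2 : Integrable (fun z => (powMul ((p - 2) / 2) (g z) - powMul ((p - 2) / 2) (k z)) ^ 2) μ :=
    ((memLp_two_powMul hp g).sub (memLp_two_powMul hp k)).integrable_sq
  rw [e, sq_norm_halfPow_sub, ← integral_const_mul, ← integral_const_mul]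
  exact ⟨integral_mono i2 (i1.const_mul _) fun z => (powMul_ineq hp _ _).1,
    integral_mono i1 (i2.const_mul _) fun z => (powMul_ineq hp _ _).2⟩

lemma hasDerivAt_Lp_norm_rpow (hp : 2 < p) (g k : Lp ℝ (ENNReal.ofReal p) μ) :
    HasDerivAt (fun t : ℝ => ‖g + t • k‖ ^ p) (p * dualPow hp g k) 0 := by
  have e : (fun t : ℝ => ‖g + t • k‖ ^ p) = fun t : ℝ => ∫ z, |g z + t * k z| ^ p ∂μ := by
    funext t
    rw [← integral_abs_rpow hp]
    refine integral_congr_ae ?_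
    filter_upwards [Lp.coeFn_add g (t • k), Lp.coeFn_smul t k] with z h1 h2
    rw [h1, Pi.add_apply, h2, Pi.smul_apply, smul_eq_mul]
  have hd : ∀ x y t : ℝ, HasDerivAt (fun t : ℝ => |x + t * y| ^ p)
      (p * (powMul (p - 2) (x + t * y) * y)) t := by
    intro x y t
    have h1 : HasDerivAt (fun t : ℝ => x + t * y) y t := by
      simpa using ((hasDerivAt_id t).mul_const y).const_add x
    have := (hasDerivAt_abs_rpow (x + t * y) (by linarith : 1 < p)).comp t h1
    simpa only [Function.comp_def, powMul, mul_assoc] using this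
  have hgm := Lp.aestronglyMeasurable g
  have hkm := Lp.aestronglyMeasurable k
  have hs : ∀ z, ∀ t ∈ Ioo (-1 : ℝ) 1,
      ‖p * (powMul (p - 2) (g z + t * k z) * k z)‖ ≤ p * |(|g z| + |k z|)| ^ p := by
    intro z t ht
    have hle : |g z + t * k z| ≤ |g z| + |k z| := by
      refine (abs_add_le _ _).trans ?_
      rw [abs_mul]
      have := mul_le_mul_of_nonneg_right (abs_lt.mpr ht).le (abs_nonneg (k z))
      linarith
    rw [Real.norm_eq_abs, abs_mul, abs_mul, abs_of_pos (by linarith : 0 < p),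
      abs_powMul (by linarith), show p - 2 + 1 = p - 1 by ring,
      abs_of_nonneg (by positivity : 0 ≤ |g z| + |k z|)]
    have hp1 : 0 ≤ p - 1 := by linarith
    have hp0 : 0 ≤ p := by linarith
    refine mul_le_mul_of_nonneg_left ?_ hp0
    calc |g z + t * k z| ^ (p - 1) * |k z| ≤ (|g z| + |k z|) ^ (p - 1) * (|g z| + |k z|) := by
          gcongr
          linarith [abs_nonneg (g z)]
      _ = _ := by rw [← Real.rpow_add_one' (by positivity) (by linarith), sub_add_cancel]
  rw [e]
  have h0 : MemLp (fun z => g z + 0 * k z) (ENNReal.ofReal p) μ := by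
    simpa using Lp.memLp g
  have := (hasDerivAt_integral_of_dominated_loc_of_deriv_le (μ := μ) (x₀ := (0 : ℝ))
    (s := Ioo (-1) 1) (F := fun t z => |g z + t * k z| ^ p)
    (F' := fun t z => p * (powMul (p - 2) (g z + t * k z) * k z))
    (bound := fun z => p * |(|g z| + |k z|)| ^ p) (Ioo_mem_nhds (by norm_num) (by norm_num))
    (Eventually.of_forall fun t => ?_) (integrable_abs_rpow hp h0) ?_
    (ae_of_all _ hs) ?_ (ae_of_all _ fun z t _ => hd _ _ _)).2
  · rw [integral_const_mul] at this
    rw [dualPow_apply]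
    simpa only [zero_mul, add_zero] using this
  · exact (continuous_abs.rpow_const fun _ => Or.inr (by linarith)).comp_aestronglyMeasurable
      (hgm.add (hkm.const_mul t))
  · exact ((aestronglyMeasurable_powMul (by linarith) h0.1).mul hkm).const_mul p
  · exact (integrable_abs_rpow hp ((Lp.memLp g).abs.add (Lp.memLp k).abs)).const_mul p

/-- The Euler equation of the minimum problem for `‖x - f‖ ^ 2 / 2 + κ / p * ‖g‖ ^ p`, for `(x, g)`
in a closed subspace of `H × Lᵖ`. By the inequality of Clarkson, minimizing sequences are Cauchy
sequences. -/
lemma exists_minimizer {H : Type*} [NormedAddCommGroup H] [InnerProductSpace ℝ H] [CompleteSpace H]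
    (hp : 2 < p) (S : Submodule ℝ (H × Lp ℝ (ENNReal.ofReal p) μ))
    (hS : IsClosed (S : Set (H × Lp ℝ (ENNReal.ofReal p) μ))) (f : H) {κ : ℝ} (hκ : 0 < κ) :
    ∃ x ∈ S, ∀ y ∈ S, inner ℝ (x.1 - f) y.1 + κ * dualPow hp x.2 y.2 = 0 := by
  have hp0 : 0 < p := by linarith
  set I : H × Lp ℝ (ENNReal.ofReal p) μ → ℝ :=
    fun x => ‖x.1 - f‖ ^ 2 / 2 + κ / p * ‖x.2‖ ^ p with hI
  have hI0 : ∀ x, 0 ≤ I x := fun x => by positivity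
  have hIc : Continuous I := by
    refine Continuous.add (by fun_prop) (continuous_const.mul ?_)
    exact continuous_snd.norm.rpow_const fun _ => Or.inr hp0.le
  obtain ⟨v, -, hvt, hvm⟩ := exists_seq_tendsto_sInf (S := I '' S) ⟨I 0, 0, S.zero_mem, rfl⟩
    ⟨0, by rintro _ ⟨x, -, rfl⟩; exact hI0 x⟩
  set m := sInf (I '' S) with hm
  have hmle : ∀ x ∈ S, m ≤ I x := fun x hx =>
    csInf_le ⟨0, by rintro _ ⟨x, -, rfl⟩; exact hI0 x⟩ ⟨x, hx, rfl⟩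
  choose x hxS hxv using hvm
  have hconv : ∀ x ∈ S, ∀ y ∈ S, ‖x.1 - y.1‖ ^ 2 / 8 + κ / p * ((1 / 2) ^ p * ‖x.2 - y.2‖ ^ p) ≤
      (I x + I y) / 2 - m := by
    intro x hx y hy
    have h1 := hmle _ (S.smul_mem (1 / 2 : ℝ) (S.add_mem hx hy))
    have h2 := norm_half_rpow_add_le hp x.2 y.2
    have h3 := parallelogram_law_with_norm ℝ (x.1 - f) (y.1 - f)
    have e1 : ((1 / 2 : ℝ) • (x + y)).1 - f = (1 / 2 : ℝ) • ((x.1 - f) + (y.1 - f)) := by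
      simp only [Prod.smul_fst, Prod.fst_add]; module
    have e2 : x.1 - f - (y.1 - f) = x.1 - y.1 := by abel
    rw [e2] at h3
    have e3 : ‖(1 / 2 : ℝ) • (x.2 - y.2)‖ ^ p = (1 / 2) ^ p * ‖x.2 - y.2‖ ^ p := by
      rw [norm_smul, Real.norm_of_nonneg (by norm_num : (0 : ℝ) ≤ 1 / 2),
        Real.mul_rpow (by norm_num) (norm_nonneg _)]
    rw [e3] at h2
    simp only [hI] at h1 ⊢
    rw [e1, norm_smul, Real.norm_of_nonneg (by norm_num : (0 : ℝ) ≤ 1 / 2)] at h1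
    simp only [Prod.smul_snd, Prod.snd_add] at h1
    have h4 := mul_le_mul_of_nonneg_left h2 (by positivity : 0 ≤ κ / p)
    nlinarith
  have hcau : CauchySeq x := by
    have hb : ∀ δ, 0 < δ → ∃ n0, ∀ n ≥ n0, I (x n) < m + δ := fun δ hδ => by
      have := hvt.eventually (gt_mem_nhds (by linarith : m < m + δ))
      obtain ⟨n0, hn0⟩ := eventually_atTop.mp this
      exact ⟨n0, fun n hn => by rw [hxv]; exact hn0 n hn⟩
    rw [Metric.cauchySeq_iff]
    intro ε hε
    set δ := min (ε ^ 2 / 8) (κ / p * ((1 / 2) ^ p * ε ^ p)) with hδ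
    have hδ0 : 0 < δ := lt_min (by positivity) (by positivity)
    obtain ⟨n0, hn0⟩ := hb δ hδ0
    refine ⟨n0, fun i hi j hj => ?_⟩
    have h1 := hconv _ (hxS i) _ (hxS j)
    have h2 : (I (x i) + I (x j)) / 2 - m < δ := by linarith [hn0 i hi, hn0 j hj]
    have h3 : 0 ≤ κ / p * ((1 / 2) ^ p * ‖(x i).2 - (x j).2‖ ^ p) := by positivity
    have h4 : 0 ≤ ‖(x i).1 - (x j).1‖ ^ 2 / 8 := by positivity
    rw [Prod.dist_eq, dist_eq_norm, dist_eq_norm]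
    refine max_lt ?_ ?_
    · have := (h1.trans_lt h2).trans_le (min_le_left _ _)
      exact lt_of_pow_lt_pow_left₀ 2 hε.le (by linarith)
    · have h5 := (h1.trans_lt h2).trans_le (min_le_right _ _)
      have h6 : κ / p * ((1 / 2) ^ p * ‖(x i).2 - (x j).2‖ ^ p) <
          κ / p * ((1 / 2) ^ p * ε ^ p) := by linarith
      have h7 := lt_of_mul_lt_mul_left (lt_of_mul_lt_mul_left h6 (by positivity)) (by positivity)
      exact (Real.rpow_lt_rpow_iff (norm_nonneg _) hε.le hp0).mp h7
  obtain ⟨x₀, hx₀⟩ := cauchySeq_tendsto_of_complete hcau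
  have hx₀S : x₀ ∈ S := hS.mem_of_tendsto hx₀ (Eventually.of_forall hxS)
  have hIx₀ : I x₀ = m := by
    refine tendsto_nhds_unique ((hIc.tendsto x₀).comp hx₀) ?_
    simpa only [Function.comp_def, hxv] using hvt
  refine ⟨x₀, hx₀S, fun y hy => ?_⟩
  have hmin : IsLocalMin (fun t : ℝ => I (x₀ + t • y)) 0 := by
    refine Eventually.of_forall fun t => ?_
    simp only [zero_smul, add_zero, hIx₀]
    exact hmle _ (S.add_mem hx₀S (S.smul_mem t hy))
  have hder : HasDerivAt (fun t : ℝ => I (x₀ + t • y))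
      (inner ℝ (x₀.1 - f) y.1 + κ * dualPow hp x₀.2 y.2) 0 := by
    have h1 := (hasDerivAt_Lp_norm_rpow hp x₀.2 y.2).const_mul (κ / p)
    have h2 : HasDerivAt (fun t : ℝ => x₀.1 + t • y.1 - f) y.1 0 := by
      have := (((hasDerivAt_id (0 : ℝ)).smul_const y.1).const_add x₀.1).sub_const f
      simpa using this
    have h3 := (h2.norm_sq).div_const 2
    simp only [zero_smul, add_zero] at h3
    refine (h3.add h1).congr_deriv ?_
    field_simp
  exact hmin.hasDerivAt_eq_zero hder

end Lp

/-! ### Difference quotients and the fractional Poincaré inequality -/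

/-- The Euclidean space `ℝᴺ`. -/
abbrev Space (N : ℕ) : Type := EuclideanSpace ℝ (Fin N)

/-- The difference quotient `(v x - v y) / |x - y|^((N + s p) / p)`, a function on `ℝᴺ × ℝᴺ`. The
Gagliardo functional is a multiple of the `p`-th power of its `Lᵖ` norm. -/
noncomputable def diffQuot {N : ℕ} (s p : ℝ) (v : Space N → ℝ) (z : Space N × Space N) : ℝ :=
  (v z.1 - v z.2) / ‖z.1 - z.2‖ ^ (((N : ℝ) + s * p) / p)

section DiffQuot

variable {N : ℕ} {s p : ℝ}

lemma diffQuot_sub (v w : Space N → ℝ) :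
    diffQuot s p (fun x => v x - w x) = fun z => diffQuot s p v z - diffQuot s p w z := by
  funext z; simp only [diffQuot]; ring

lemma measurable_diffQuot {v : Space N → ℝ} (hv : Measurable v) :
    Measurable (diffQuot s p v) := by
  unfold diffQuot; fun_prop

lemma eLpNorm_ofReal_rpow {Z : Type*} [MeasurableSpace Z] {μ : Measure Z} (hp : 2 < p)
    (f : Z → ℝ) : eLpNorm f (ENNReal.ofReal p) μ ^ p = ∫⁻ z, ENNReal.ofReal (|f z| ^ p) ∂μ := by
  rw [eLpNorm_eq_lintegral_rpow_enorm_toReal (ENNReal.ofReal_pos.mpr (by linarith)).ne'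
    ENNReal.ofReal_ne_top, ENNReal.toReal_ofReal (by linarith), ← ENNReal.rpow_mul,
    one_div_mul_cancel (by linarith), ENNReal.rpow_one]
  refine lintegral_congr fun z => ?_
  rw [Real.enorm_eq_ofReal_abs, ENNReal.ofReal_rpow_of_nonneg (abs_nonneg _) (by linarith)]

lemma abs_diffQuot_rpow (hp : 2 < p) (v : Space N → ℝ) (z : Space N × Space N) :
    |diffQuot s p v z| ^ p = |v z.1 - v z.2| ^ p / ‖z.1 - z.2‖ ^ ((N : ℝ) + s * p) := by
  rw [diffQuot, abs_div, Real.div_rpow (abs_nonneg _) (abs_nonneg _),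
    abs_of_nonneg (Real.rpow_nonneg (norm_nonneg _) _), ← Real.rpow_mul (norm_nonneg _),
    div_mul_cancel₀ _ (by linarith)]

lemma sobolevNormPow_eq (hp : 2 < p) (v : Space N → ℝ) :
    sobolevNormPow s p v = ENNReal.ofReal (1 / p) *
      eLpNorm (diffQuot s p v) (ENNReal.ofReal p) volume ^ p +
      eLpNorm v (ENNReal.ofReal p) volume ^ p := by
  rw [sobolevNormPow, gagliardo, eLpNorm_ofReal_rpow hp, eLpNorm_ofReal_rpow hp]
  simp only [abs_diffQuot_rpow hp]

lemma weakForm_eq (hs0 : 0 < s) (hp : 2 < p) (c : ℝ) (v φ : Space N → ℝ) :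
    weakForm c s p v φ =
      c / 2 * ∫ z, powMul (p - 2) (diffQuot s p v z) * diffQuot s p φ z := by
  rw [weakForm]
  congr 2
  funext z
  set d := ‖z.1 - z.2‖ with hd
  have hd0 : 0 ≤ d := norm_nonneg _
  have hp0 : 0 < p := by linarith
  have hm : 0 < ((N : ℝ) + s * p) / p := by positivity
  rw [powMul, diffQuot, diffQuot, ← hd, abs_div, Real.div_rpow (abs_nonneg _) (abs_nonneg _),
    abs_of_nonneg (Real.rpow_nonneg hd0 _)]
  have e : d ^ ((N : ℝ) + s * p) = (d ^ (((N : ℝ) + s * p) / p)) ^ (p - 2) *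
      d ^ (((N : ℝ) + s * p) / p) * d ^ (((N : ℝ) + s * p) / p) := by
    set y := d ^ (((N : ℝ) + s * p) / p) with hy
    have hy0 : 0 ≤ y := Real.rpow_nonneg hd0 _
    rw [← Real.rpow_add_one' hy0 (by linarith), ← Real.rpow_add_one' hy0 (by linarith), hy,
      ← Real.rpow_mul hd0]
    congr 1
    field_simp
    ring
  rw [e]
  simp only [div_eq_mul_inv, mul_inv]
  ring

lemma memLp_of_lintegral_lt_top {Z : Type*} [MeasurableSpace Z] {μ : Measure Z} (hp : 2 < p)
    {f : Z → ℝ} (hf : AEStronglyMeasurable f μ)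
    (h : ∫⁻ z, ENNReal.ofReal (|f z| ^ p) ∂μ < ⊤) : MemLp f (ENNReal.ofReal p) μ := by
  refine ⟨hf, ?_⟩
  rw [← eLpNorm_ofReal_rpow hp] at h
  exact (ENNReal.rpow_lt_top_iff_of_pos (by linarith)).mp h

/-- The kernel that dominates the difference quotients of a bounded Lipschitz function. -/
lemma lintegral_kernel_lt_top (hN : 1 ≤ N) (hs0 : 0 < s) (hs1 : s < 1) (hp : 2 < p) (L M : ℝ) :
    ∫⁻ h : Space N, ENNReal.ofReal
      (if ‖h‖ ≤ 1 then L * ‖h‖ ^ (p - ((N : ℝ) + s * p)) else M * ‖h‖ ^ (-((N : ℝ) + s * p))) < ⊤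
    := by
  have : Nontrivial (Space N) := by
    have : Nonempty (Fin N) := ⟨⟨0, hN⟩⟩
    infer_instance
  have hint : Integrable (fun h : Space N =>
      (if ‖h‖ ≤ 1 then L * ‖h‖ ^ (p - ((N : ℝ) + s * p)) else M * ‖h‖ ^ (-((N : ℝ) + s * p))))
      volume := by
    rw [integrable_fun_norm_addHaar (μ := (volume : Measure (Space N)))
      (f := fun r : ℝ => if r ≤ 1 then L * r ^ (p - ((N : ℝ) + s * p))
        else M * r ^ (-((N : ℝ) + s * p)))]
    rw [finrank_euclideanSpace_fin, ← Ioc_union_Ioi_eq_Ioi (zero_le_one (α := ℝ))]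
    have hpow : ∀ r : ℝ, 0 < r → ∀ e : ℝ, r ^ (N - 1) * r ^ e = r ^ ((N : ℝ) - 1 + e) := by
      intro r hr e
      rw [Real.rpow_add hr, ← Real.rpow_natCast, Nat.cast_sub hN, Nat.cast_one]
    have hps : 0 < p * (1 - s) := mul_pos (by linarith) (by linarith)
    refine IntegrableOn.union ?_ ?_
    · have h1 : IntegrableOn (fun r : ℝ => L * r ^ (p * (1 - s) - 1)) (Ioc 0 1) volume := by
        have := intervalIntegral.intervalIntegrable_rpow' (a := 0) (b := 1)
          (by linarith : -1 < p * (1 - s) - 1)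
        rw [intervalIntegrable_iff_integrableOn_Ioc_of_le zero_le_one] at this
        exact this.const_mul L
      refine h1.congr_fun (fun r hr => ?_) measurableSet_Ioc
      simp only [hr.2, if_true, smul_eq_mul]
      rw [mul_left_comm, hpow r hr.1]
      congr 2; ring
    · have h1 : IntegrableOn (fun r : ℝ => M * r ^ (-1 - s * p)) (Ioi 1) volume := by
        have : 0 < s * p := mul_pos hs0 (by linarith)
        exact (integrableOn_Ioi_rpow_of_lt (by linarith) one_pos).const_mul M
      refine h1.congr_fun (fun r hr => ?_) measurableSet_Ioi
      have hr1 : 1 < r := hr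
      simp only [not_le.mpr hr1, if_false, smul_eq_mul]
      rw [mul_left_comm, hpow r (by linarith)]
      congr 2; ring
  exact hint.lintegral_lt_top

/-- Test functions have finite energy. -/
lemma IsTestFunction.memLp_diffQuot {Ω : Set (Space N)} {φ : Space N → ℝ} (hN : 1 ≤ N)
    (hs0 : 0 < s) (hs1 : s < 1) (hp : 2 < p) (hφ : IsTestFunction Ω φ) :
    MemLp (diffQuot s p φ) (ENNReal.ofReal p) volume := by
  obtain ⟨hsm, hcs, -⟩ := hφ
  have hcont := hsm.continuous
  refine memLp_of_lintegral_lt_top hp (measurable_diffQuot hcont.measurable).aestronglyMeasurable ?_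
  obtain ⟨L, hL⟩ := ContDiff.lipschitzWith_of_hasCompactSupport hcs hsm (by simp)
  obtain ⟨M, hM⟩ := hcs.exists_bound_of_continuous hcont
  have hp0 : 0 < p := by linarith
  have hM0 : 0 ≤ M := (norm_nonneg _).trans (hM 0)
  set k : Space N → ℝ≥0∞ := fun h => ENNReal.ofReal
    (if ‖h‖ ≤ 1 then (L : ℝ) ^ p * ‖h‖ ^ (p - ((N : ℝ) + s * p))
      else (2 * M) ^ p * ‖h‖ ^ (-((N : ℝ) + s * p))) with hk
  have hkm : Measurable k := by
    refine ENNReal.measurable_ofReal.comp (Measurable.ite (by measurability) ?_ ?_) <;> fun_prop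
  set K := tsupport φ with hK
  have hKm : MeasurableSet K := (isClosed_tsupport φ).measurableSet
  have hKfin : volume K < ⊤ := hcs.isCompact.measure_lt_top
  have hφK : ∀ x, x ∉ K → φ x = 0 := fun x hx => image_eq_zero_of_notMem_tsupport hx
  have bound : ∀ x y, ENNReal.ofReal (|diffQuot s p φ (x, y)| ^ p) ≤ k (x - y) := by
    intro x y
    rw [abs_diffQuot_rpow hp]
    refine ENNReal.ofReal_le_ofReal ?_
    simp only
    rcases eq_or_ne x y with rfl | hxy
    · simp only [sub_self, abs_zero, Real.zero_rpow hp0.ne', zero_div, norm_zero, zero_le_one,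
        if_true]
      positivity
    have hd : 0 < ‖x - y‖ := norm_pos_iff.mpr (sub_ne_zero.mpr hxy)
    split_ifs with h1
    · rw [Real.rpow_sub hd, ← mul_div_assoc, ← Real.mul_rpow (NNReal.coe_nonneg L) hd.le]
      gcongr
      have := hL.dist_le_mul x y
      rwa [Real.dist_eq, dist_eq_norm] at this
    · rw [Real.rpow_neg hd.le, ← div_eq_mul_inv]
      gcongr
      have h2 := hM x
      have h3 := hM y
      rw [Real.norm_eq_abs] at h2 h3
      linarith [abs_sub (φ x) (φ y)]
  have bound2 : ∀ z : Space N × Space N, ENNReal.ofReal (|diffQuot s p φ z| ^ p) ≤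
      K.indicator 1 z.1 * k (z.1 - z.2) + K.indicator 1 z.2 * k (z.1 - z.2) := by
    rintro ⟨x, y⟩
    by_cases hx : x ∈ K
    · simp only [indicator_of_mem hx, Pi.one_apply, one_mul]
      exact (bound x y).trans le_self_add
    · by_cases hy : y ∈ K
      · simp only [indicator_of_mem hy, Pi.one_apply, one_mul]
        exact (bound x y).trans le_add_self
      · simp [diffQuot, hφK x hx, hφK y hy, Real.zero_rpow hp0.ne']
  have hind : Measurable (K.indicator (1 : Space N → ℝ≥0∞)) := measurable_one.indicator hKm
  have hker : ∫⁻ h, k h < ⊤ := lintegral_kernel_lt_top hN hs0 hs1 hp _ _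
  have i1 : ∫⁻ z : Space N × Space N, K.indicator 1 z.1 * k (z.1 - z.2) =
      volume K * ∫⁻ h, k h := by
    rw [Measure.volume_eq_prod, lintegral_prod _ (by fun_prop)]
    simp only
    have : ∀ x : Space N, ∫⁻ y, K.indicator 1 x * k (x - y) = K.indicator 1 x * ∫⁻ h, k h := by
      intro x
      rw [lintegral_const_mul _ (by fun_prop), lintegral_sub_left_eq_self k x]
    simp only [this]
    rw [lintegral_mul_const _ hind, lintegral_indicator_one hKm]
  have i2 : ∫⁻ z : Space N × Space N, K.indicator 1 z.2 * k (z.1 - z.2) =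
      volume K * ∫⁻ h, k h := by
    rw [Measure.volume_eq_prod, lintegral_prod_symm _ (by fun_prop)]
    simp only
    have : ∀ y : Space N, ∫⁻ x, K.indicator 1 y * k (x - y) = K.indicator 1 y * ∫⁻ h, k h := by
      intro y
      rw [lintegral_const_mul _ (by fun_prop), lintegral_sub_right_eq_self k y]
    simp only [this]
    rw [lintegral_mul_const _ hind, lintegral_indicator_one hKm]
  refine (lintegral_mono bound2).trans_lt ?_
  rw [lintegral_add_left (by fun_prop), i1, i2]
  exact ENNReal.add_lt_top.mpr ⟨ENNReal.mul_lt_top hKfin hker, ENNReal.mul_lt_top hKfin hker⟩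

/-- The fractional Poincaré inequality: the points of `Ω` are compared with those of a ball
outside `Ω`, where the function vanishes. -/
lemma exists_poincare {Ω : Set (Space N)} (hN : 1 ≤ N) (hs0 : 0 < s) (hp : 2 < p)
    (hΩb : Bornology.IsBounded Ω) : ∃ C : ℝ≥0∞, C ≠ ⊤ ∧ ∀ v : Space N → ℝ, Measurable v →
      (∀ x, x ∉ Ω → v x = 0) → eLpNorm v (ENNReal.ofReal p) volume ^ p ≤
        C * eLpNorm (diffQuot s p v) (ENNReal.ofReal p) volume ^ p := by
  have : Nontrivial (Space N) := by
    have : Nonempty (Fin N) := ⟨⟨0, hN⟩⟩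
    infer_instance
  obtain ⟨R, hR0, hR⟩ := hΩb.subset_ball_lt 0 0
  obtain ⟨e, he⟩ := exists_norm_eq (Space N) (by linarith : 0 ≤ R + 1)
  set B := Metric.ball e 1 with hB
  have hBpos : volume B ≠ 0 := (Metric.measure_ball_pos _ _ one_pos).ne'
  have hBfin : volume B ≠ ⊤ := measure_ball_lt_top.ne
  have hp0 : 0 < p := by linarith
  have hBn : ∀ y ∈ B, R < ‖y‖ ∧ ‖y‖ ≤ R + 2 := by
    intro y hy
    rw [hB, Metric.mem_ball, dist_eq_norm] at hy
    have h1 := norm_sub_norm_le e y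
    have h2 := norm_sub_norm_le y e
    rw [norm_sub_rev] at h1
    constructor <;> linarith
  set D : ℝ := (2 * R + 2) ^ ((N : ℝ) + s * p) with hD
  refine ⟨(volume B)⁻¹ * ENNReal.ofReal D,
    ENNReal.mul_ne_top (ENNReal.inv_ne_top.mpr hBpos) ENNReal.ofReal_ne_top, fun v hv hv0 => ?_⟩
  rw [eLpNorm_ofReal_rpow hp, eLpNorm_ofReal_rpow hp]
  have hmeas : Measurable fun z : Space N × Space N => ENNReal.ofReal (|diffQuot s p v z| ^ p) := by
    have := measurable_diffQuot (s := s) (p := p) hv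
    fun_prop
  have hpt : ∀ x, ∀ y ∈ B, ENNReal.ofReal (|v x| ^ p) ≤
      ENNReal.ofReal D * ENNReal.ofReal (|diffQuot s p v (x, y)| ^ p) := by
    intro x y hy
    have hyΩ : y ∉ Ω := fun h => by
      have := hR h
      rw [Metric.mem_ball, dist_zero_right] at this
      linarith [(hBn y hy).1]
    by_cases hx : x ∈ Ω
    · have hxR : ‖x‖ < R := by
        have := hR hx
        rwa [Metric.mem_ball, dist_zero_right] at this
      have hd0 : 0 < ‖x - y‖ := by
        have := norm_sub_norm_le y x
        rw [norm_sub_rev] at this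
        linarith [(hBn y hy).1]
      have hd1 : ‖x - y‖ ≤ 2 * R + 2 := by
        linarith [norm_sub_le x y, (hBn y hy).2]
      rw [← ENNReal.ofReal_mul (by positivity), abs_diffQuot_rpow hp, hv0 y hyΩ, sub_zero]
      refine ENNReal.ofReal_le_ofReal ?_
      rw [← mul_div_assoc, le_div_iff₀ (by positivity), mul_comm]
      have : ‖x - y‖ ^ ((N : ℝ) + s * p) ≤ D := by
        rw [hD]; gcongr
      gcongr
    · rw [hv0 x hx, abs_zero, Real.zero_rpow hp0.ne', ENNReal.ofReal_zero]
      exact zero_le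
  have hmx : ∀ x, Measurable fun y => ENNReal.ofReal (|diffQuot s p v (x, y)| ^ p) := fun x =>
    hmeas.comp measurable_prodMk_left
  have hx : ∀ x, volume B * ENNReal.ofReal (|v x| ^ p) ≤
      ENNReal.ofReal D * ∫⁻ y, ENNReal.ofReal (|diffQuot s p v (x, y)| ^ p) := by
    intro x
    rw [mul_comm, ← setLIntegral_const, ← lintegral_const_mul _ (hmx x)]
    exact (setLIntegral_mono ((hmx x).const_mul _) (hpt x)).trans (setLIntegral_le_lintegral _ _)
  have h1 := lintegral_mono (μ := volume) hx
  rw [lintegral_const_mul _ (by fun_prop),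
    lintegral_const_mul _ hmeas.lintegral_prod_right',
    ← lintegral_prod _ hmeas.aemeasurable, ← Measure.volume_eq_prod] at h1
  rw [mul_assoc, ← ENNReal.div_eq_inv_mul, ENNReal.le_div_iff_mul_le (Or.inl hBpos) (Or.inl hBfin),
    mul_comm]
  exact h1

end DiffQuot

/-! ### The space `W_0^{s,p}(Ω)` as a closed graph -/

section Graph

variable {N : ℕ} {s p c : ℝ} {Ω : Set (Space N)}

lemma IsTestFunction.zero : IsTestFunction Ω (0 : Space N → ℝ) :=
  ⟨contDiff_const, HasCompactSupport.zero, by simp⟩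

lemma IsTestFunction.add {φ ψ : Space N → ℝ} (hφ : IsTestFunction Ω φ)
    (hψ : IsTestFunction Ω ψ) : IsTestFunction Ω (φ + ψ) :=
  ⟨hφ.1.add hψ.1, hφ.2.1.add hψ.2.1,
    (tsupport_add φ ψ).trans (union_subset hφ.2.2 hψ.2.2)⟩

lemma IsTestFunction.smul {φ : Space N → ℝ} (hφ : IsTestFunction Ω φ) (a : ℝ) :
    IsTestFunction Ω (a • φ) :=
  ⟨hφ.1.const_smul a, hφ.2.1.smul_left (f := fun _ => a),
    (tsupport_smul_subset_right (fun _ => a) φ).trans hφ.2.2⟩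

lemma IsTestFunction.memLp {φ : Space N → ℝ} (hφ : IsTestFunction Ω φ) (q : ℝ≥0∞)
    (μ : Measure (Space N)) [IsFiniteMeasureOnCompacts μ] : MemLp φ q μ :=
  hφ.1.continuous.memLp_of_hasCompactSupport hφ.2.1

lemma IsTestFunction.eq_zero {φ : Space N → ℝ} (hφ : IsTestFunction Ω φ) {x : Space N}
    (hx : x ∉ Ω) : φ x = 0 :=
  image_eq_zero_of_notMem_tsupport fun h => hx (hφ.2.2 h)

lemma measurable_zeroExt (hΩ : MeasurableSet Ω) (u : L2 Ω) : Measurable (zeroExt Ω u) :=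
  (Lp.stronglyMeasurable u).measurable.indicator hΩ

lemma zeroExt_of_notMem {u : L2 Ω} {x : Space N} (hx : x ∉ Ω) : zeroExt Ω u x = 0 :=
  indicator_of_notMem hx _

lemma zeroExt_of_mem {u : L2 Ω} {x : Space N} (hx : x ∈ Ω) : zeroExt Ω u x = u x :=
  indicator_of_mem hx _

variable [Fact (1 ≤ ENNReal.ofReal p)]

/-- The pairs formed by a test function and its difference quotient, in `L²(Ω) × Lᵖ(ℝᴺ × ℝᴺ)`. -/
noncomputable def testGraph (s p : ℝ) (Ω : Set (Space N)) [Fact (1 ≤ ENNReal.ofReal p)] :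
    Submodule ℝ (L2 Ω × Lp ℝ (ENNReal.ofReal p) (volume : Measure (Space N × Space N))) where
  carrier := {x | ∃ φ, IsTestFunction Ω φ ∧ x.1 =ᵐ[volume.restrict Ω] φ ∧
    x.2 =ᵐ[volume] diffQuot s p φ}
  zero_mem' := by
    refine ⟨0, IsTestFunction.zero, Lp.coeFn_zero _ _ _, ?_⟩
    refine (Lp.coeFn_zero _ _ _).trans (ae_of_all _ fun z => ?_)
    simp [diffQuot]
  add_mem' := by
    rintro x y ⟨φ, hφ, h1, h2⟩ ⟨ψ, hψ, h3, h4⟩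
    refine ⟨φ + ψ, hφ.add hψ, ?_, ?_⟩
    · exact (Lp.coeFn_add _ _).trans (h1.add h3)
    · refine (Lp.coeFn_add _ _).trans ?_
      filter_upwards [h2, h4] with z e1 e2
      simp only [Pi.add_apply, e1, e2, diffQuot]
      ring
  smul_mem' := by
    rintro a x ⟨φ, hφ, h1, h2⟩
    refine ⟨a • φ, hφ.smul a, ?_, ?_⟩
    · refine (Lp.coeFn_smul _ _).trans ?_
      filter_upwards [h1] with z e1
      simp only [Pi.smul_apply, e1]
    · refine (Lp.coeFn_smul _ _).trans ?_
      filter_upwards [h2] with z e1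
      simp only [Pi.smul_apply, e1, diffQuot, smul_eq_mul]
      ring

/-- The closure of `testGraph`. Its first projection is `W_0^{s,p}(Ω)`, and its elements are the
pairs formed by a function of this space and its difference quotient. -/
noncomputable def energyGraph (s p : ℝ) (Ω : Set (Space N)) [Fact (1 ≤ ENNReal.ofReal p)] :
    Submodule ℝ (L2 Ω × Lp ℝ (ENNReal.ofReal p) (volume : Measure (Space N × Space N))) :=
  (testGraph s p Ω).topologicalClosure

lemma isClosed_energyGraph : IsClosed (energyGraph s p Ω :
    Set (L2 Ω × Lp ℝ (ENNReal.ofReal p) (volume : Measure (Space N × Space N)))) :=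
  Submodule.isClosed_topologicalClosure _

lemma exists_seq_of_mem_energyGraph
    {x : L2 Ω × Lp ℝ (ENNReal.ofReal p) (volume : Measure (Space N × Space N))}
    (hx : x ∈ energyGraph s p Ω) : ∃ y : ℕ → L2 Ω × Lp ℝ (ENNReal.ofReal p) volume,
      (∀ n, y n ∈ testGraph s p Ω) ∧ Tendsto y atTop (𝓝 x) := by
  have : x ∈ closure (testGraph s p Ω :
    Set (L2 Ω × Lp ℝ (ENNReal.ofReal p) (volume : Measure (Space N × Space N)))) := hx
  exact mem_closure_iff_seq_limit.mp this

lemma ae_prod_of_ae {P : Space N → Prop} (h : ∀ᵐ x, P x) :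
    ∀ᵐ z : Space N × Space N, P z.1 ∧ P z.2 := by
  rw [Measure.volume_eq_prod]
  exact (Measure.quasiMeasurePreserving_fst.ae h).and (Measure.quasiMeasurePreserving_snd.ae h)

/-- Along a subsequence, the test functions that approximate an element of `energyGraph` converge
almost everywhere, with their difference quotients. -/
lemma exists_seq_ae_of_mem_energyGraph (hΩ : MeasurableSet Ω)
    {x : L2 Ω × Lp ℝ (ENNReal.ofReal p) (volume : Measure (Space N × Space N))}
    (hx : x ∈ energyGraph s p Ω) : ∃ (y : ℕ → L2 Ω × Lp ℝ (ENNReal.ofReal p) volume)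
      (φ : ℕ → Space N → ℝ), Tendsto y atTop (𝓝 x) ∧ (∀ n, IsTestFunction Ω (φ n)) ∧
      (∀ n, (y n).1 =ᵐ[volume.restrict Ω] φ n) ∧ (∀ n, (y n).2 =ᵐ[volume] diffQuot s p (φ n)) ∧
      (∀ᵐ a, Tendsto (fun n => φ n a) atTop (𝓝 (zeroExt Ω x.1 a))) ∧
      x.2 =ᵐ[volume] diffQuot s p (zeroExt Ω x.1) := by
  obtain ⟨y, hyT, hyx⟩ := exists_seq_of_mem_energyGraph hx
  have h1 : Tendsto (fun n => (y n).1) atTop (𝓝 x.1) := (continuous_fst.tendsto x).comp hyx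
  obtain ⟨ns, hns, hae1⟩ := (tendstoInMeasure_of_tendsto_Lp h1).exists_seq_tendsto_ae
  have hyx' := hyx.comp hns.tendsto_atTop
  have h2 : Tendsto (fun n => (y (ns n)).2) atTop (𝓝 x.2) := (continuous_snd.tendsto x).comp hyx'
  obtain ⟨ms, hms, hae2⟩ := (tendstoInMeasure_of_tendsto_Lp h2).exists_seq_tendsto_ae
  choose φ hφ hφ1 hφ2 using hyT
  have hconv : ∀ᵐ a, Tendsto (fun n => φ (ns n) a) atTop (𝓝 (zeroExt Ω x.1 a)) := by
    have h3 : ∀ᵐ a ∂(volume.restrict Ω), ∀ n, (y n).1 a = φ n a := ae_all_iff.mpr hφ1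
    have h4 := (ae_restrict_iff' hΩ).mp (h3.and hae1)
    filter_upwards [h4] with a ha
    by_cases hm : a ∈ Ω
    · rw [zeroExt_of_mem hm]
      exact (ha hm).2.congr fun n => (ha hm).1 _
    · rw [zeroExt_of_notMem hm]
      exact tendsto_const_nhds.congr fun n => ((hφ _).eq_zero hm).symm
  refine ⟨fun n => y (ns (ms n)), fun n => φ (ns (ms n)), hyx'.comp hms.tendsto_atTop,
    fun n => hφ _, fun n => hφ1 _, fun n => hφ2 _, ?_, ?_⟩
  · filter_upwards [hconv] with a ha using ha.comp hms.tendsto_atTop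
  · have h5 : ∀ᵐ z, ∀ n, (y n).2 z = diffQuot s p (φ n) z := ae_all_iff.mpr hφ2
    filter_upwards [h5, hae2, ae_prod_of_ae hconv] with z e1 e2 e3
    refine tendsto_nhds_unique e2 ?_
    have e4 := ((e3.1.sub e3.2).div_const
      (‖z.1 - z.2‖ ^ (((N : ℝ) + s * p) / p))).comp hms.tendsto_atTop
    exact e4.congr fun n => (e1 _).symm

lemma snd_ae_eq_of_mem_energyGraph (hΩ : MeasurableSet Ω)
    {x : L2 Ω × Lp ℝ (ENNReal.ofReal p) (volume : Measure (Space N × Space N))}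
    (hx : x ∈ energyGraph s p Ω) : x.2 =ᵐ[volume] diffQuot s p (zeroExt Ω x.1) := by
  obtain ⟨-, -, -, -, -, -, -, h⟩ := exists_seq_ae_of_mem_energyGraph hΩ hx
  exact h

lemma energyGraph_snd_unique (hΩ : MeasurableSet Ω) {u : L2 Ω}
    {g k : Lp ℝ (ENNReal.ofReal p) (volume : Measure (Space N × Space N))}
    (hg : (u, g) ∈ energyGraph s p Ω) (hk : (u, k) ∈ energyGraph s p Ω) : g = k :=
  Lp.ext ((snd_ae_eq_of_mem_energyGraph hΩ hg).trans (snd_ae_eq_of_mem_energyGraph hΩ hk).symm)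

lemma IsTestFunction.exists_mem_testGraph (hN : 1 ≤ N) (hs0 : 0 < s) (hs1 : s < 1) (hp : 2 < p)
    {φ : Space N → ℝ} (hφ : IsTestFunction Ω φ) :
    ((hφ.memLp 2 (volume.restrict Ω)).toLp φ, (hφ.memLp_diffQuot hN hs0 hs1 hp).toLp (diffQuot s p φ)) ∈
      testGraph s p Ω :=
  ⟨φ, hφ, (hφ.memLp 2 _).coeFn_toLp, (hφ.memLp_diffQuot hN hs0 hs1 hp).coeFn_toLp⟩

lemma memW0_of_mem_energyGraph (hN : 1 ≤ N) (hs0 : 0 < s) (hp : 2 < p)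
    (hΩ : MeasurableSet Ω) (hΩb : Bornology.IsBounded Ω) {u : L2 Ω}
    {g : Lp ℝ (ENNReal.ofReal p) (volume : Measure (Space N × Space N))}
    (h : (u, g) ∈ energyGraph s p Ω) : MemW0 s p Ω (zeroExt Ω u) := by
  intro ε hε
  obtain ⟨C, hC, hpoin⟩ := exists_poincare (s := s) hN hs0 hp hΩb
  obtain ⟨y, hyT, hyx⟩ := exists_seq_of_mem_energyGraph h
  have h1 : Tendsto (fun n => (y n).2) atTop (𝓝 g) := (continuous_snd.tendsto _).comp hyx
  have h2 : Tendsto (fun n => eLpNorm (g - (y n).2) (ENNReal.ofReal p) volume) atTop (𝓝 0) := by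
    have := tendsto_iff_norm_sub_tendsto_zero.mp h1
    have h3 := (ENNReal.continuous_ofReal.tendsto 0).comp this
    rw [ENNReal.ofReal_zero] at h3
    refine h3.congr fun n => ?_
    simp only [Function.comp]
    rw [norm_sub_rev, Lp.norm_def, ENNReal.ofReal_toReal (Lp.eLpNorm_ne_top _)]
  have hp0 : 0 < p := by linarith
  have h3 : Tendsto (fun n => (ENNReal.ofReal (1 / p) + C) *
      eLpNorm (g - (y n).2) (ENNReal.ofReal p) volume ^ p) atTop (𝓝 0) := by
    have h4 := (ENNReal.continuous_rpow_const (y := p)).tendsto 0 |>.comp h2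
    have h5 := ENNReal.Tendsto.const_mul (a := ENNReal.ofReal (1 / p) + C) h4
      (Or.inr (ENNReal.add_ne_top.mpr ⟨ENNReal.ofReal_ne_top, hC⟩))
    simpa [ENNReal.zero_rpow_of_pos hp0] using h5
  obtain ⟨n, hn⟩ := (h3.eventually (gt_mem_nhds hε)).exists
  obtain ⟨φ, hφ, -, hφ2⟩ := hyT n
  refine ⟨φ, hφ, lt_of_le_of_lt ?_ hn⟩
  have e : eLpNorm (diffQuot s p fun x => zeroExt Ω u x - φ x) (ENNReal.ofReal p) volume =
      eLpNorm (g - (y n).2) (ENNReal.ofReal p) volume := by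
    refine eLpNorm_congr_ae ?_
    rw [diffQuot_sub]
    filter_upwards [snd_ae_eq_of_mem_energyGraph hΩ h, hφ2, Lp.coeFn_sub g (y n).2]
      with z e1 e2 e3
    rw [e3, Pi.sub_apply, e1, e2]
  have h6 := hpoin (fun x => zeroExt Ω u x - φ x)
    ((measurable_zeroExt hΩ u).sub hφ.1.continuous.measurable)
    (fun x hx => by rw [zeroExt_of_notMem hx, hφ.eq_zero hx, sub_zero])
  rw [e] at h6
  rw [sobolevNormPow_eq hp, e, add_mul]
  gcongr

lemma exists_mem_energyGraph_of_memW0 (hN : 1 ≤ N) (hs0 : 0 < s) (hs1 : s < 1) (hp : 2 < p)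
    (hΩ : MeasurableSet Ω) (hΩb : Bornology.IsBounded Ω) {u : L2 Ω}
    (h : MemW0 s p Ω (zeroExt Ω u)) : ∃ g, (u, g) ∈ energyGraph s p Ω := by
  have hp0 : 0 < p := by linarith
  have hpi : 0 < ENNReal.ofReal (1 / p) := ENNReal.ofReal_pos.mpr (by positivity)
  -- smallness of both norms of the difference to a test function
  have key : ∀ δ : ℝ, 0 < δ → ∃ φ, IsTestFunction Ω φ ∧
      eLpNorm (diffQuot s p fun x => zeroExt Ω u x - φ x) (ENNReal.ofReal p) volume <
        ENNReal.ofReal δ ∧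
      eLpNorm (fun x => zeroExt Ω u x - φ x) (ENNReal.ofReal p) volume < ENNReal.ofReal δ := by
    intro δ hδ
    have hδ' : 0 < ENNReal.ofReal δ ^ p :=
      ENNReal.rpow_pos (ENNReal.ofReal_pos.mpr hδ) ENNReal.ofReal_ne_top
    obtain ⟨φ, hφ, hlt⟩ := h (min (ENNReal.ofReal (1 / p) * ENNReal.ofReal δ ^ p)
      (ENNReal.ofReal δ ^ p)) (lt_min (ENNReal.mul_pos hpi.ne' hδ'.ne') hδ')
    rw [sobolevNormPow_eq hp, lt_min_iff] at hlt
    refine ⟨φ, hφ, ?_, ?_⟩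
    · have h1 := le_self_add.trans_lt hlt.1
      rw [ENNReal.mul_lt_mul_iff_right hpi.ne' ENNReal.ofReal_ne_top,
        ENNReal.rpow_lt_rpow_iff hp0] at h1
      exact h1
    · have h1 := le_add_self.trans_lt hlt.2
      rwa [ENNReal.rpow_lt_rpow_iff hp0] at h1
  have hum := measurable_zeroExt hΩ u
  have hmem : MemLp (diffQuot s p (zeroExt Ω u)) (ENNReal.ofReal p) volume := by
    obtain ⟨φ, hφ, h1, -⟩ := key 1 one_pos
    have h2 : MemLp (diffQuot s p fun x => zeroExt Ω u x - φ x) (ENNReal.ofReal p) volume :=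
      ⟨(measurable_diffQuot (hum.sub hφ.1.continuous.measurable)).aestronglyMeasurable,
        h1.trans ENNReal.ofReal_lt_top⟩
    have h3 := h2.add (hφ.memLp_diffQuot hN hs0 hs1 hp)
    rw [diffQuot_sub] at h3
    convert h3 using 1
    funext z
    simp
  refine ⟨hmem.toLp, ?_⟩
  change _ ∈ closure (testGraph s p Ω :
    Set (L2 Ω × Lp ℝ (ENNReal.ofReal p) (volume : Measure (Space N × Space N))))
  rw [Metric.mem_closure_iff]
  intro ε hε
  have hvol : volume Ω ≠ ⊤ := hΩb.measure_lt_top.ne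
  set V : ℝ≥0∞ := volume Ω ^ (1 / (2 : ℝ≥0∞).toReal - 1 / (ENNReal.ofReal p).toReal) with hV
  have hVtop : V ≠ ⊤ := by
    refine ENNReal.rpow_ne_top_of_nonneg ?_ hvol
    rw [ENNReal.toReal_ofReal hp0.le, ENNReal.toReal_ofNat, sub_nonneg]
    exact one_div_le_one_div_of_le two_pos hp.le
  obtain ⟨φ, hφ, h1, h2⟩ := key (ε / (V.toReal + 1)) (by positivity)
  have hle : ε / (V.toReal + 1) ≤ ε := div_le_self hε.le (by simp)
  refine ⟨_, hφ.exists_mem_testGraph hN hs0 hs1 hp, ?_⟩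
  rw [Prod.dist_eq, max_lt_iff]
  constructor
  · rw [dist_eq_norm, Lp.norm_def, ← ENNReal.toReal_ofReal hε.le,
      ENNReal.toReal_lt_toReal (Lp.eLpNorm_ne_top _) ENNReal.ofReal_ne_top]
    have e : eLpNorm (u - (hφ.memLp 2 (volume.restrict Ω)).toLp : L2 Ω) 2 (volume.restrict Ω) =
        eLpNorm (fun x => zeroExt Ω u x - φ x) 2 (volume.restrict Ω) := by
      refine eLpNorm_congr_ae ?_
      filter_upwards [Lp.coeFn_sub u (hφ.memLp 2 (volume.restrict Ω)).toLp,
        (hφ.memLp 2 (volume.restrict Ω)).coeFn_toLp, ae_restrict_mem hΩ] with x e1 e2 e3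
      rw [e1, Pi.sub_apply, e2, zeroExt_of_mem e3]
    rw [e]
    have h3 := eLpNorm_le_eLpNorm_mul_rpow_measure_univ (p := 2) (q := ENNReal.ofReal p)
      (μ := volume.restrict Ω) (f := fun x => zeroExt Ω u x - φ x)
      (by rw [← ENNReal.ofReal_ofNat]; exact ENNReal.ofReal_le_ofReal hp.le)
      (hum.sub hφ.1.continuous.measurable).aestronglyMeasurable
    rw [Measure.restrict_apply_univ, ← hV] at h3
    have h4 : eLpNorm (fun x => zeroExt Ω u x - φ x) (ENNReal.ofReal p) (volume.restrict Ω) ≤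
        ENNReal.ofReal (ε / (V.toReal + 1)) :=
      (eLpNorm_mono_measure _ Measure.restrict_le_self).trans h2.le
    calc _ ≤ ENNReal.ofReal (ε / (V.toReal + 1)) * V := h3.trans (by gcongr)
      _ = ENNReal.ofReal (ε / (V.toReal + 1) * V.toReal) := by
        rw [ENNReal.ofReal_mul (by positivity), ENNReal.ofReal_toReal hVtop]
      _ < ENNReal.ofReal ε := by
        refine (ENNReal.ofReal_lt_ofReal_iff hε).mpr ?_
        rw [div_mul_eq_mul_div, div_lt_iff₀ (by positivity)]
        nlinarith
  · rw [dist_eq_norm, ← MemLp.toLp_sub, Lp.norm_toLp, ← ENNReal.toReal_ofReal hε.le]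
    refine (ENNReal.toReal_lt_toReal ?_ ENNReal.ofReal_ne_top).mpr ?_
    · exact (hmem.sub (hφ.memLp_diffQuot hN hs0 hs1 hp)).2.ne
    · have e : diffQuot s p (zeroExt Ω u) - diffQuot s p φ =
          diffQuot s p fun x => zeroExt Ω u x - φ x := by rw [diffQuot_sub]; rfl
      rw [e]
      exact h1.trans_le (ENNReal.ofReal_le_ofReal hle)

lemma inner_L2_eq {u : L2 Ω} {f : L2 Ω} {φ : Space N → ℝ} (h : u =ᵐ[volume.restrict Ω] φ) :
    inner ℝ f u = ∫ x in Ω, f x * φ x := by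
  rw [L2.inner_def]
  refine integral_congr_ae ?_
  filter_upwards [h] with x hx
  rw [hx]; simp [mul_comm]

/-- The equation `L_{p,s} u = f` in terms of `energyGraph`, with all of `W_0^{s,p}(Ω)` as test
functions. -/
lemma isFracPLaplacian_iff (hN : 1 ≤ N) (hs0 : 0 < s) (hs1 : s < 1) (hp : 2 < p)
    (hΩ : MeasurableSet Ω) (hΩb : Bornology.IsBounded Ω) {u f : L2 Ω} :
    IsFracPLaplacian c s p Ω u f ↔ ∃ g, (u, g) ∈ energyGraph s p Ω ∧
      ∀ y ∈ energyGraph s p Ω, c / 2 * dualPow hp g y.2 = inner ℝ f y.1 := by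
  have hweak : ∀ (g : Lp ℝ (ENNReal.ofReal p) (volume : Measure (Space N × Space N))),
      (u, g) ∈ energyGraph s p Ω → ∀ (y : L2 Ω × Lp ℝ (ENNReal.ofReal p) volume)
      (φ : Space N → ℝ), y.2 =ᵐ[volume] diffQuot s p φ →
      weakForm c s p (zeroExt Ω u) φ = c / 2 * dualPow hp g y.2 := by
    intro g hg y φ hy
    rw [weakForm_eq hs0 hp, dualPow_apply]
    congr 1
    refine integral_congr_ae ?_
    filter_upwards [snd_ae_eq_of_mem_energyGraph hΩ hg, hy] with z e1 e2
    rw [e1, e2]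
  constructor
  · rintro ⟨h1, h2⟩
    obtain ⟨g, hg⟩ := exists_mem_energyGraph_of_memW0 hN hs0 hs1 hp hΩ hΩb h1
    refine ⟨g, hg, fun y hy => ?_⟩
    obtain ⟨z, hzT, hzy⟩ := exists_seq_of_mem_energyGraph hy
    have c1 : Continuous fun y : L2 Ω × Lp ℝ (ENNReal.ofReal p)
        (volume : Measure (Space N × Space N)) => c / 2 * dualPow hp g y.2 :=
      continuous_const.mul ((dualPow hp g).continuous.comp continuous_snd)
    have c2 : Continuous fun y : L2 Ω × Lp ℝ (ENNReal.ofReal p)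
        (volume : Measure (Space N × Space N)) => inner ℝ f y.1 :=
      continuous_const.inner continuous_fst
    refine tendsto_nhds_unique ((c1.tendsto y).comp hzy)
      (((c2.tendsto y).comp hzy).congr fun n => ?_)
    obtain ⟨φ, hφ, e1, e2⟩ := hzT n
    simp only [Function.comp]
    rw [← hweak g hg _ φ e2, h2 φ hφ, inner_L2_eq e1]
  · rintro ⟨g, hg, h⟩
    refine ⟨memW0_of_mem_energyGraph hN hs0 hp hΩ hΩb hg, fun φ hφ => ?_⟩
    have hT := hφ.exists_mem_testGraph hN hs0 hs1 hp
    have := h _ (Submodule.le_topologicalClosure _ hT)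
    rw [← hweak g hg _ φ (hφ.memLp_diffQuot hN hs0 hs1 hp).coeFn_toLp,
      inner_L2_eq (hφ.memLp 2 _).coeFn_toLp] at this
    exact this

/-- Test functions are dense in `L²(Ω)`, for open `Ω`. -/
lemma dense_fst_testGraph (hN : 1 ≤ N) (hs0 : 0 < s) (hs1 : s < 1) (hp : 2 < p)
    (hΩ : IsOpen Ω) (hΩb : Bornology.IsBounded Ω) :
    ((testGraph s p Ω).map (LinearMap.fst ℝ _ _)).topologicalClosure = ⊤ := by
  rw [Submodule.topologicalClosure_eq_top_iff, Submodule.eq_bot_iff]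
  intro f hf
  rw [Submodule.mem_orthogonal'] at hf
  have hint : LocallyIntegrableOn (zeroExt Ω f) Ω volume := by
    have : IsFiniteMeasure (volume.restrict Ω) := ⟨by
      rw [Measure.restrict_apply_univ]; exact hΩb.measure_lt_top⟩
    have h1 : Integrable f (volume.restrict Ω) := (Lp.memLp f).integrable (by norm_num)
    exact ((integrable_indicator_iff hΩ.measurableSet).mpr h1).locallyIntegrable.locallyIntegrableOn _
  have h0 := hΩ.ae_eq_zero_of_integral_contDiff_smul_eq_zero hint (fun φ h1 h2 h3 => ?_)
  · rw [← (ae_restrict_iff' hΩ.measurableSet)] at h0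
    refine Lp.ext ?_
    filter_upwards [h0, Lp.coeFn_zero ℝ 2 (volume.restrict Ω), ae_restrict_mem hΩ.measurableSet]
      with x e1 e2 e3
    rw [e2, ← zeroExt_of_mem e3, e1, Pi.zero_apply]
  · have hφ : IsTestFunction Ω φ := ⟨h1, h2, h3⟩
    have := hf _ ⟨_, hφ.exists_mem_testGraph hN hs0 hs1 hp, rfl⟩
    rw [LinearMap.fst_apply, inner_L2_eq (hφ.memLp 2 _).coeFn_toLp] at this
    rw [← this, ← integral_indicator hΩ.measurableSet]
    congr 1 with x
    by_cases hx : x ∈ Ω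
    · rw [zeroExt_of_mem hx, indicator_of_mem hx, smul_eq_mul, mul_comm]
    · rw [zeroExt_of_notMem hx, indicator_of_notMem hx, smul_zero]

end Graph

/-! ### The fractional `p`-Laplacian as a maximal monotone operator -/

/-- Here `b` and `b'` stand for the difference quotients of `u` and `v`. Where those of `η ∘ φ` and of
`u - v` have opposite signs, the difference quotient of `φ` is at most its distance to `b - b'`, in
absolute value. -/
lemma neg_le_powMul_sub_mul_diffQuot_comp {N : ℕ} {s p : ℝ} (hp : 2 < p) {η : ℝ → ℝ} (hmono : Monotone η)
    {L : NNReal} (hL : LipschitzWith L η) {φ : Space N → ℝ} {a : Space N × Space N} (b b' : ℝ) :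
    -((L : ℝ) * ((|powMul (p - 2) b| + |powMul (p - 2) b'|) *
        |diffQuot s p φ a - (b - b')|)) ≤
      (powMul (p - 2) b - powMul (p - 2) b') * diffQuot s p (η ∘ φ) a := by
  set F := powMul (p - 2) b - powMul (p - 2) b' with hF
  set d := diffQuot s p (η ∘ φ) a with hd
  set e := diffQuot s p φ a with he
  set δ := b - b' with hδ
  have hFle : |F| ≤ |powMul (p - 2) b| + |powMul (p - 2) b'| := abs_sub _ _
  have hsign1 : 0 < F → 0 ≤ δ := fun h => by
    by_contra! hlt
    have := powMul_mono hp (by linarith : b ≤ b')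
    linarith
  have hsign2 : F < 0 → δ ≤ 0 := fun h => by
    by_contra! hlt
    have := powMul_mono hp (by linarith : b' ≤ b)
    linarith
  set r := ‖a.1 - a.2‖ ^ (((N : ℝ) + s * p) / p) with hr
  have hr0 : 0 ≤ r := Real.rpow_nonneg (norm_nonneg _) _
  have hd' : d = (η (φ a.1) - η (φ a.2)) / r := rfl
  have he' : e = (φ a.1 - φ a.2) / r := rfl
  clear_value d e F δ r
  have hde : |d| ≤ L * |e| := by
    rw [hd', he', abs_div, abs_div, ← mul_div_assoc]
    refine div_le_div_of_nonneg_right ?_ (abs_nonneg _)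
    have := hL.dist_le_mul (φ a.1) (φ a.2)
    rwa [Real.dist_eq, Real.dist_eq] at this
  have hd1 : 0 < d → 0 ≤ e := fun h => by
    rcases le_total (φ a.1) (φ a.2) with h1 | h1
    · have h3 : d ≤ 0 := hd' ▸ div_nonpos_of_nonpos_of_nonneg (sub_nonpos.mpr (hmono h1)) hr0
      linarith
    · exact he' ▸ div_nonneg (sub_nonneg.mpr h1) hr0
  have hd2 : d < 0 → e ≤ 0 := fun h => by
    rcases le_total (φ a.1) (φ a.2) with h1 | h1
    · exact he' ▸ div_nonpos_of_nonpos_of_nonneg (sub_nonpos.mpr h1) hr0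
    · have h3 : 0 ≤ d := hd' ▸ div_nonneg (sub_nonneg.mpr (hmono h1)) hr0
      linarith
  have hmain : -((L : ℝ) * (|F| * |e - δ|)) ≤ F * d := by
    by_cases hFd : 0 ≤ F * d
    · have : 0 ≤ (L : ℝ) * (|F| * |e - δ|) := by positivity
      linarith
    · have hee : |e| ≤ |e - δ| := by
        rcases lt_trichotomy F 0 with hF0 | hF0 | hF0
        · have h6 : 0 < d := by by_contra! h'; exact hFd (mul_nonneg_of_nonpos_of_nonpos hF0.le h')
          have h7 := hd1 h6
          have h8 := hsign2 hF0
          rw [abs_of_nonneg h7, abs_of_nonneg (by linarith)]; linarith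
        · exact absurd (by rw [hF0, zero_mul]) hFd
        · have h6 : d < 0 := by by_contra! h'; exact hFd (mul_nonneg hF0.le h')
          have h7 := hd2 h6
          have h8 := hsign1 hF0
          rw [abs_of_nonpos h7, abs_of_nonpos (by linarith)]; linarith
      have h9 : |F * d| ≤ |F| * (L * |e - δ|) := by
        rw [abs_mul]
        gcongr
        exact hde.trans (by gcongr)
      have := neg_le_of_abs_le h9
      linarith
  refine le_trans ?_ hmain
  have : (L : ℝ) * (|F| * |e - δ|) ≤
      L * ((|powMul (p - 2) b| + |powMul (p - 2) b'|) * |e - δ|) := by gcongr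
  linarith

section Operator

variable {N : ℕ} {s p c : ℝ} {Ω : Set (Space N)} [Fact (1 ≤ ENNReal.ofReal p)]

/-- The operator `L_{p,s}` is maximal monotone in `L²(Ω)`: its resolvents solve minimum problems. -/
lemma maxMonotone_isFracPLaplacian (hN : 1 ≤ N) (hs0 : 0 < s) (hs1 : s < 1) (hp : 2 < p)
    (hc : 0 < c) (hΩ : IsOpen Ω) (hΩb : Bornology.IsBounded Ω) :
    MaxMonotone (IsFracPLaplacian c s p Ω) where
  mono := by
    intro x w y z hx hy
    rw [isFracPLaplacian_iff hN hs0 hs1 hp hΩ.measurableSet hΩb] at hx hy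
    obtain ⟨g, hg, hgw⟩ := hx
    obtain ⟨k, hk, hkz⟩ := hy
    have hgk := (energyGraph s p Ω).sub_mem hg hk
    have e1 := hgw _ hgk
    have e2 := hkz _ hgk
    simp only [Prod.mk_sub_mk] at e1 e2
    rw [inner_sub_left, ← e1, ← e2, ← mul_sub]
    have := (sq_nonneg _).trans (dualPow_sub hp g k).1
    have h3 : 0 ≤ dualPow hp g (g - k) - dualPow hp k (g - k) :=
      nonneg_of_mul_nonneg_right this (by positivity)
    positivity
  range := by
    intro lam hl f
    obtain ⟨⟨x, g⟩, hx, h⟩ := exists_minimizer hp (energyGraph s p Ω) isClosed_energyGraph f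
      (by positivity : 0 < lam * (c / 2))
    refine ⟨x, lam⁻¹ • (f - x), ?_, by rw [smul_inv_smul₀ hl.ne', add_sub_cancel]⟩
    rw [isFracPLaplacian_iff hN hs0 hs1 hp hΩ.measurableSet hΩb]
    refine ⟨g, hx, fun y hy => ?_⟩
    have h1 := h y hy
    simp only at h1
    rw [real_inner_smul_left, eq_inv_mul_iff_mul_eq₀ hl.ne', ← neg_sub x f, inner_neg_left]
    linarith
  single := by
    intro x w z hw hz
    rw [isFracPLaplacian_iff hN hs0 hs1 hp hΩ.measurableSet hΩb] at hw hz
    obtain ⟨g, hg, hgw⟩ := hw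
    obtain ⟨k, hk, hkz⟩ := hz
    obtain rfl := energyGraph_snd_unique hΩ.measurableSet hg hk
    have hbot := (Submodule.topologicalClosure_eq_top_iff).mp
      (dense_fst_testGraph (s := s) (p := p) hN hs0 hs1 hp hΩ hΩb)
    have : w - z ∈ ((testGraph s p Ω).map (LinearMap.fst ℝ _ _))ᗮ := by
      rw [Submodule.mem_orthogonal']
      rintro _ ⟨y, hy, rfl⟩
      have hy' := Submodule.le_topologicalClosure _ hy
      rw [LinearMap.fst_apply, inner_sub_left, ← hgw y hy', ← hkz y hy', sub_self]
    rw [hbot, Submodule.mem_bot] at this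
    exact sub_eq_zero.mp this

lemma isFracPLaplacian_zero (hN : 1 ≤ N) (hs0 : 0 < s) (hs1 : s < 1) (hp : 2 < p)
    (hΩ : IsOpen Ω) (hΩb : Bornology.IsBounded Ω) :
    IsFracPLaplacian c s p Ω 0 0 := by
  rw [isFracPLaplacian_iff hN hs0 hs1 hp hΩ.measurableSet hΩb]
  refine ⟨0, Submodule.zero_mem _, fun y _ => ?_⟩
  have h : dualPow hp (0 : Lp ℝ (ENNReal.ofReal p) (volume : Measure (Space N × Space N))) y.2 =
      0 := by
    rw [dualPow_apply, ← integral_zero (Space N × Space N) ℝ (μ := volume)]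
    refine integral_congr_ae ?_
    filter_upwards [Lp.coeFn_zero ℝ (ENNReal.ofReal p) (volume : Measure (Space N × Space N))]
      with z hz
    rw [hz]; simp [powMul]
  rw [h, mul_zero, inner_zero_left]

lemma IsFracPLaplacian.smul (hN : 1 ≤ N) (hs0 : 0 < s) (hs1 : s < 1) (hp : 2 < p)
    (hΩ : IsOpen Ω) (hΩb : Bornology.IsBounded Ω) {κ : ℝ} (hκ : 0 < κ) {u w : L2 Ω}
    (h : IsFracPLaplacian c s p Ω u w) :
    IsFracPLaplacian c s p Ω (κ • u) (κ ^ (p - 1) • w) := by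
  rw [isFracPLaplacian_iff hN hs0 hs1 hp hΩ.measurableSet hΩb] at h ⊢
  obtain ⟨g, hg, hgw⟩ := h
  refine ⟨κ • g, (energyGraph s p Ω).smul_mem κ hg, fun y hy => ?_⟩
  rw [dualPow_smul hp hκ, real_inner_smul_left, ← hgw y hy]
  ring

/-- The domain of `L_{p,s}` is dense: if `(v, k)` is in `energyGraph` and `u` is the image of `v`
under the resolvent, then `‖u - v‖ ^ 2` is at most `lam * c / 2 * ‖k‖ ^ p`. -/
lemma dense_domain (hN : 1 ≤ N) (hs0 : 0 < s) (hs1 : s < 1) (hp : 2 < p)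
    (hc : 0 < c) (hΩ : IsOpen Ω) (hΩb : Bornology.IsBounded Ω) :
    Dense {u : L2 Ω | ∃ w, IsFracPLaplacian c s p Ω u w} := by
  have h1 : Dense (((testGraph s p Ω).map (LinearMap.fst ℝ _ _) : Submodule ℝ (L2 Ω)) :
      Set (L2 Ω)) := by
    rw [dense_iff_closure_eq, ← Submodule.topologicalClosure_coe,
      dense_fst_testGraph (s := s) (p := p) hN hs0 hs1 hp hΩ hΩb, Submodule.top_coe]
  rw [← dense_closure]
  refine h1.mono ?_
  rintro _ ⟨⟨v, k⟩, hv, rfl⟩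
  have hv' := Submodule.le_topologicalClosure _ hv
  rw [LinearMap.fst_apply, Metric.mem_closure_iff]
  intro ε hε
  obtain ⟨lam, hl, hlε⟩ : ∃ lam : ℝ, 0 < lam ∧ lam * (c / 2) * (‖k‖ ^ p + 1) < ε ^ 2 := by
    refine ⟨ε ^ 2 / (c * (‖k‖ ^ p + 1)), by positivity, ?_⟩
    have : ε ^ 2 / (c * (‖k‖ ^ p + 1)) * (c / 2) * (‖k‖ ^ p + 1) = ε ^ 2 / 2 := by
      have h0 : ‖k‖ ^ p + 1 ≠ 0 := by positivity
      field_simp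
    rw [this]
    linarith [pow_pos hε 2]
  obtain ⟨u, w, huw, hf⟩ :=
    (maxMonotone_isFracPLaplacian hN hs0 hs1 hp hc hΩ hΩb).range hl v
  refine ⟨u, ⟨w, huw⟩, ?_⟩
  rw [isFracPLaplacian_iff hN hs0 hs1 hp hΩ.measurableSet hΩb] at huw
  obtain ⟨g, hg, hgw⟩ := huw
  have e := hgw _ ((energyGraph s p Ω).sub_mem hv' hg)
  have hvu : v - u = lam • w := by rw [← hf]; abel
  have e1 : ‖v - u‖ ^ 2 = lam * (c / 2 * dualPow hp g (k - g)) := by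
    rw [← real_inner_self_eq_norm_sq]
    nth_rw 1 [hvu]
    rw [real_inner_smul_left]
    congr 1
    exact e.symm
  have e2 : dualPow hp g (k - g) ≤ ‖k‖ ^ p := by
    rw [map_sub, dualPow_self]
    have := (le_abs_self _).trans (abs_integral_powMul_mul_le hp g k)
    rw [← dualPow_apply hp] at this
    linarith
  rw [dist_eq_norm]
  refine lt_of_pow_lt_pow_left₀ 2 hε.le ?_
  calc ‖v - u‖ ^ 2 ≤ lam * (c / 2 * (‖k‖ ^ p + 1)) := by
        rw [e1]; gcongr; linarith
    _ = lam * (c / 2) * (‖k‖ ^ p + 1) := by ring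
    _ < _ := hlε

open Classical in
/-- The function `|D u|^((p-2)/2) D u` of `L²(ℝᴺ × ℝᴺ)`, where `D u` is the difference quotient of
the zero extension of `u ∈ W_0^{s,p}(Ω)`; it is `0` outside this space. -/
noncomputable def energyPow (s : ℝ) (Ω : Set (Space N)) (hp : 2 < p) (u : L2 Ω) :
    Lp ℝ 2 (volume : Measure (Space N × Space N)) :=
  if h : ∃ g, (u, g) ∈ energyGraph s p Ω then halfPow hp h.choose else 0

lemma energyPow_eq (hp : 2 < p) (hΩ : MeasurableSet Ω) {u : L2 Ω}
    {g : Lp ℝ (ENNReal.ofReal p) (volume : Measure (Space N × Space N))}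
    (hg : (u, g) ∈ energyGraph s p Ω) : energyPow s Ω hp u = halfPow hp g := by
  have h : ∃ g, (u, g) ∈ energyGraph s p Ω := ⟨g, hg⟩
  rw [energyPow, dif_pos h, energyGraph_snd_unique hΩ h.choose_spec hg]

/-- The monotonicity of `L_{p,s}` is comparable to a Hilbertian distance. -/
lemma energyPow_sub (hN : 1 ≤ N) (hs0 : 0 < s) (hs1 : s < 1) (hp : 2 < p)
    (hc : 0 < c) (hΩ : IsOpen Ω) (hΩb : Bornology.IsBounded Ω) {u v w z : L2 Ω}
    (hu : IsFracPLaplacian c s p Ω u w) (hv : IsFracPLaplacian c s p Ω v z) :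
    ‖energyPow s Ω hp u - energyPow s Ω hp v‖ ^ 2 ≤
        (p ^ 2 / (2 * c) + c) * inner ℝ (w - z) (u - v) ∧
      inner ℝ (w - z) (u - v) ≤
        (p ^ 2 / (2 * c) + c) * ‖energyPow s Ω hp u - energyPow s Ω hp v‖ ^ 2 := by
  have hmono := (maxMonotone_isFracPLaplacian hN hs0 hs1 hp hc hΩ hΩb).mono hu hv
  rw [isFracPLaplacian_iff hN hs0 hs1 hp hΩ.measurableSet hΩb] at hu hv
  obtain ⟨g, hg, hgw⟩ := hu
  obtain ⟨k, hk, hkz⟩ := hv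
  have hgk := (energyGraph s p Ω).sub_mem hg hk
  have e1 := hgw _ hgk
  have e2 := hkz _ hgk
  simp only [Prod.mk_sub_mk] at e1 e2
  rw [energyPow_eq hp hΩ.measurableSet hg, energyPow_eq hp hΩ.measurableSet hk]
  obtain ⟨h1, h2⟩ := dualPow_sub hp g k
  have e3 : inner ℝ (w - z) (u - v) =
      c / 2 * (dualPow hp g (g - k) - dualPow hp k (g - k)) := by
    rw [inner_sub_left, ← e1, ← e2, mul_sub]
  set d := dualPow hp g (g - k) - dualPow hp k (g - k)
  set n := ‖halfPow hp g - halfPow hp k‖ ^ 2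
  have hn : 0 ≤ n := sq_nonneg _
  constructor
  · have e4 : p ^ 2 / (2 * c) * (c / 2 * d) = p ^ 2 / 4 * d := by field_simp; ring
    have := mul_nonneg hc.le hmono
    rw [e3] at this ⊢
    linarith
  · have h3 := mul_le_mul_of_nonneg_left h2 (by positivity : 0 ≤ c / 2)
    have h4 : 0 ≤ p ^ 2 / (2 * c) * n := by positivity
    rw [e3]
    linarith

/-- `L_{p,s}` is accretive with respect to increasing functions of the difference. Where the
difference quotients of a test function `φ` and of `u - v` have opposite signs, the absolute value of
the former is at most the error made by approximating the latter by the former, so that no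
convergence of the difference quotients of `η ∘ φ` is needed. -/
lemma inner_sub_compLp_nonneg (hN : 1 ≤ N) (hs0 : 0 < s) (hs1 : s < 1) (hp : 2 < p)
    (hc : 0 < c) (hΩ : IsOpen Ω) (hΩb : Bornology.IsBounded Ω) {u v w z : L2 Ω}
    (hu : IsFracPLaplacian c s p Ω u w) (hv : IsFracPLaplacian c s p Ω v z) {η : ℝ → ℝ}
    (hη : ContDiff ℝ ∞ η) (hmono : Monotone η) {L : NNReal} (hL : LipschitzWith L η)
    (h0 : η 0 = 0) : 0 ≤ inner ℝ (w - z) (hL.compLp h0 (u - v)) := by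
  rw [isFracPLaplacian_iff hN hs0 hs1 hp hΩ.measurableSet hΩb] at hu hv
  obtain ⟨g, hg, hgw⟩ := hu
  obtain ⟨k, hk, hkz⟩ := hv
  have hgk := (energyGraph s p Ω).sub_mem hg hk
  rw [Prod.mk_sub_mk] at hgk
  obtain ⟨y, hyT, hyx⟩ := exists_seq_of_mem_energyGraph hgk
  have h1 : Tendsto (fun n => (y n).1) atTop (𝓝 (u - v)) := (continuous_fst.tendsto _).comp hyx
  have h2 : Tendsto (fun n => (y n).2) atTop (𝓝 (g - k)) := (continuous_snd.tendsto _).comp hyx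
  have l1 : Tendsto (fun n => inner ℝ (w - z) (hL.compLp h0 (y n).1)) atTop
      (𝓝 (inner ℝ (w - z) (hL.compLp h0 (u - v)))) :=
    tendsto_const_nhds.inner (((hL.continuous_compLp h0).tendsto _).comp h1)
  have l2 : Tendsto (fun n => -(c / 2 * (L * (dualPow hp |g| |(y n).2 - (g - k)| +
      dualPow hp |k| |(y n).2 - (g - k)|)))) atTop (𝓝 0) := by
    have h3 : Tendsto (fun n => |(y n).2 - (g - k)|) atTop (𝓝 0) := by
      rw [tendsto_zero_iff_norm_tendsto_zero]
      simp only [norm_abs_eq_norm]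
      exact tendsto_iff_norm_sub_tendsto_zero.mp h2
    have h4 := (((dualPow hp |g|).continuous.tendsto 0).comp h3).add
      (((dualPow hp |k|).continuous.tendsto 0).comp h3)
    have h5 := ((h4.const_mul (L : ℝ)).const_mul (c / 2)).neg
    simpa [Function.comp_def] using h5
  refine le_of_tendsto_of_tendsto' l2 l1 fun n => ?_
  obtain ⟨φ, hφ, hφ1, hφ2⟩ := hyT n
  have hηφ : IsTestFunction Ω (η ∘ φ) :=
    ⟨hη.comp hφ.1, hφ.2.1.comp_left h0,
      (closure_mono (Function.support_comp_subset h0 φ)).trans hφ.2.2⟩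
  have hT := hηφ.exists_mem_testGraph hN hs0 hs1 hp
  have hT' := Submodule.le_topologicalClosure _ hT
  have e1 := hgw _ hT'
  have e2 := hkz _ hT'
  have e3 : inner ℝ (w - z) (hL.compLp h0 (y n).1) =
      inner ℝ (w - z) ((hηφ.memLp 2 (volume.restrict Ω)).toLp (η ∘ φ)) := by
    congr 1
    refine Lp.ext ?_
    filter_upwards [hL.coeFn_compLp h0 (y n).1, hφ1,
      (hηφ.memLp 2 (volume.restrict Ω)).coeFn_toLp] with x i1 i2 i3
    rw [i1, i3, Function.comp, Function.comp, i2]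
  rw [e3, inner_sub_left, ← e1, ← e2, ← mul_sub, ← mul_neg]
  refine mul_le_mul_of_nonneg_left ?_ (by positivity)
  rw [dualPow_sub_apply, dualPow_apply, dualPow_apply, ← integral_add
    (integrable_powMul_mul hp (Lp.memLp _) (Lp.memLp _))
    (integrable_powMul_mul hp (Lp.memLp _) (Lp.memLp _)), ← integral_const_mul, ← integral_neg]
  refine integral_mono_ae ?_ ?_ ?_
  · exact (((integrable_powMul_mul hp (Lp.memLp _) (Lp.memLp _)).add
      (integrable_powMul_mul hp (Lp.memLp _) (Lp.memLp _))).const_mul _).neg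
  · simp only [sub_mul]
    exact (integrable_powMul_mul hp (Lp.memLp _) (Lp.memLp _)).sub
      (integrable_powMul_mul hp (Lp.memLp _) (Lp.memLp _))
  filter_upwards [Lp.coeFn_abs g, Lp.coeFn_abs k, Lp.coeFn_abs ((y n).2 - (g - k)),
    Lp.coeFn_sub (y n).2 (g - k), Lp.coeFn_sub g k, hφ2,
    (hηφ.memLp_diffQuot hN hs0 hs1 hp).coeFn_toLp] with a i1 i2 i3 i4 i5 i6 i7
  rw [i1, i2, i3, i4, Pi.sub_apply, i5, Pi.sub_apply, i6, i7]
  have habs : ∀ r : ℝ, powMul (p - 2) |r| = |powMul (p - 2) r| := fun r => by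
    rw [powMul, powMul, abs_abs, abs_mul, abs_of_nonneg (Real.rpow_nonneg (abs_nonneg r) _)]
  rw [habs, habs, ← add_mul]
  exact neg_le_powMul_sub_mul_diffQuot_comp hp hmono hL _ _

end Operator

/-! ### Truncations and `L^q` norms -/

section Truncation

lemma exists_lipschitzWith_smoothTransition : ∃ K, LipschitzWith K Real.smoothTransition := by
  -- A compactly supported smooth function that agrees with the transition function up to `1`.
  obtain ⟨K, hK⟩ : ∃ K, LipschitzWith K
      fun x => Real.smoothTransition x * Real.smoothTransition (3 - x) := by
    refine ContDiff.lipschitzWith_of_hasCompactSupport (𝕂 := ℝ) (n := 1) ?_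
      (Real.smoothTransition.contDiff.mul
        (Real.smoothTransition.contDiff.comp (contDiff_const.sub contDiff_id))) one_ne_zero
    refine HasCompactSupport.intro (isCompact_Icc : IsCompact (Icc (0 : ℝ) 3)) fun x hx => ?_
    rw [mem_Icc, not_and_or, not_le, not_le] at hx
    rcases hx with hx | hx
    · rw [Real.smoothTransition.zero_of_nonpos hx.le, zero_mul]
    · rw [Real.smoothTransition.zero_of_nonpos (by linarith : 3 - x ≤ 0), mul_zero]
  have e : Real.smoothTransition =
      (fun x => Real.smoothTransition x * Real.smoothTransition (3 - x)) ∘ fun x => min x 1 := by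
    ext x
    have h : (1 : ℝ) ≤ 3 - min x 1 := by linarith [min_le_right x 1]
    rw [Function.comp, Real.smoothTransition.one_of_one_le h, mul_one]
    rcases le_total x 1 with h1 | h1
    · rw [min_eq_left h1]
    · rw [min_eq_right h1, Real.smoothTransition.one_of_one_le h1, Real.smoothTransition.one]
  have h : LipschitzWith (K * 1) Real.smoothTransition := by
    rw [e]
    exact hK.comp (LipschitzWith.id.min_const 1)
  exact ⟨_, h⟩

variable {α : Type*} [MeasurableSpace α] {μ : Measure α}

lemma integrable_max_sub [IsFiniteMeasure μ] (k : ℝ) (x : Lp ℝ 2 μ) :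
    Integrable (fun a => max (x a - k) 0) μ :=
  (((Lp.memLp x).integrable one_le_two).sub (integrable_const k)).pos_part

/-- If `F - U` is nonnegative against the increasing functions of `U`, then the truncations of `U`
have smaller integrals than those of `F`. -/
lemma integral_max_sub_le [IsFiniteMeasure μ] {F U : Lp ℝ 2 μ}
    (h : ∀ {η : ℝ → ℝ} {L : NNReal} (_ : ContDiff ℝ ∞ η) (_ : Monotone η) (hL : LipschitzWith L η)
      (h0 : η 0 = 0), 0 ≤ inner ℝ (F - U) (hL.compLp h0 U)) {k : ℝ} (hk : 0 ≤ k) :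
    ∫ a, max (U a - k) 0 ∂μ ≤ ∫ a, max (F a - k) 0 ∂μ := by
  have key : ∀ ε : ℝ, 0 < ε →
      ∫ a, max (U a - k) 0 ∂μ ≤ ∫ a, max (F a - k) 0 ∂μ + ε * μ.real univ := by
    intro ε hε
    obtain ⟨K, hK⟩ := exists_lipschitzWith_smoothTransition
    set η : ℝ → ℝ := fun r => Real.smoothTransition (ε⁻¹ * (r - k)) with hη
    have hL : LipschitzWith (K * ‖ε⁻¹‖₊) η := by
      refine hK.comp (LipschitzWith.of_dist_le_mul fun x y => ?_)
      rw [Real.dist_eq, Real.dist_eq, ← mul_sub, abs_mul, coe_nnnorm, Real.norm_eq_abs,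
        sub_sub_sub_cancel_right]
    have h0 : η 0 = 0 := Real.smoothTransition.zero_of_nonpos
      (mul_nonpos_of_nonneg_of_nonpos (inv_nonneg.mpr hε.le) (by linarith))
    have hmono : Monotone η := fun x y hxy => Real.smoothTransition.monotone (by gcongr)
    have hsm : ContDiff ℝ ∞ η := Real.smoothTransition.contDiff.comp (by fun_prop)
    have h1 := h hsm hmono hL h0
    have h2 : inner ℝ (F - U) (hL.compLp h0 U) ≤
        ∫ a, (max (F a - k) 0 - max (U a - k) 0 + ε) ∂μ := by
      rw [L2.inner_def]
      refine integral_mono_ae (L2.integrable_inner _ _)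
        (((integrable_max_sub k F).sub (integrable_max_sub k U)).add (integrable_const ε)) ?_
      filter_upwards [Lp.coeFn_sub F U, hL.coeFn_compLp h0 U] with a i1 i2
      rw [i1, i2, Function.comp, Pi.sub_apply]
      have e0 : inner ℝ (F a - U a) (η (U a)) = (F a - U a) * η (U a) := by
        simp [mul_comm]
      rw [e0]
      have hη0 : 0 ≤ η (U a) := Real.smoothTransition.nonneg _
      have hη1 : η (U a) ≤ 1 := Real.smoothTransition.le_one _
      rcases le_total (U a) k with hU | hU
      · have : η (U a) = 0 := Real.smoothTransition.zero_of_nonpos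
          (mul_nonpos_of_nonneg_of_nonpos (inv_nonneg.mpr hε.le) (by linarith))
        rw [this, mul_zero, max_eq_right (by linarith : U a - k ≤ 0), sub_zero]
        positivity
      · rw [max_eq_left (by linarith : 0 ≤ U a - k)]
        have h3 : (F a - k) * η (U a) ≤ max (F a - k) 0 :=
          (mul_le_mul_of_nonneg_right (le_max_left _ 0) hη0).trans
            (mul_le_of_le_one_right (le_max_right _ _) hη1)
        have h4 : (U a - k) * (1 - η (U a)) ≤ ε := by
          rcases le_total (U a - k) ε with h5 | h5
          · exact (mul_le_of_le_one_right (by linarith) (by linarith)).trans h5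
          · have : η (U a) = 1 := Real.smoothTransition.one_of_one_le
              (by rw [inv_mul_eq_div]; exact (one_le_div hε).mpr h5)
            rw [this, sub_self, mul_zero]; exact hε.le
        linarith
    have h3 : Integrable (fun a => max (F a - k) 0 - max (U a - k) 0) μ :=
      (integrable_max_sub k F).sub (integrable_max_sub k U)
    rw [integral_add h3 (integrable_const ε), integral_sub (integrable_max_sub k F) (integrable_max_sub k U), integral_const,
      smul_eq_mul] at h2
    linarith
  have h5 : Tendsto (fun ε : ℝ => ∫ a, max (F a - k) 0 ∂μ + ε * μ.real univ) (𝓝[>] 0)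
      (𝓝 (∫ a, max (F a - k) 0 ∂μ)) := by
    have : Continuous (fun ε : ℝ => ∫ a, max (F a - k) 0 ∂μ + ε * μ.real univ) := by fun_prop
    simpa using (this.tendsto 0).mono_left nhdsWithin_le_nhds
  exact ge_of_tendsto h5 (by filter_upwards [self_mem_nhdsWithin] with ε hε using key ε hε)

lemma continuous_integral_max_sub [IsFiniteMeasure μ] {k : ℝ} (hk : 0 ≤ k) :
    Continuous fun x : Lp ℝ 2 μ => ∫ a, max (x a - k) 0 ∂μ := by
  have hL : LipschitzWith 1 fun r : ℝ => max (r - k) 0 :=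
    ((LipschitzWith.id.sub (LipschitzWith.const k)).max_const 0).weaken (by simp)
  have h0 : max ((0 : ℝ) - k) 0 = 0 := max_eq_right (by linarith)
  have e : (fun x : Lp ℝ 2 μ => ∫ a, max (x a - k) 0 ∂μ) =
      fun x => inner ℝ (Lp.const 2 μ (1 : ℝ)) (hL.compLp h0 x) := by
    ext x
    rw [L2.inner_def]
    refine integral_congr_ae ?_
    filter_upwards [Lp.coeFn_const (p := 2) (μ := μ) (1 : ℝ), hL.coeFn_compLp h0 x] with a i1 i2
    rw [i1, i2]
    simp
  rw [e]
  exact continuous_const.inner (hL.continuous_compLp h0)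

end Truncation

section Norms

variable {α : Type*} [MeasurableSpace α] {μ : Measure α}

/-- `r ^ q` is a superposition of the truncations `(r - k)₊`. -/
lemma lintegral_rpow_mul_sub {q : ℝ} (hq : 1 < q) {r : ℝ} (hr : 0 ≤ r) :
    ∫⁻ k in Ioi (0 : ℝ), ENNReal.ofReal (k ^ (q - 2)) * ENNReal.ofReal (r - k) =
      ENNReal.ofReal (1 / (q * (q - 1))) * ENNReal.ofReal (r ^ q) := by
  have hq1 : 0 < q - 1 := by linarith
  have e1 : ∫⁻ k in Ioi (0 : ℝ), ENNReal.ofReal (k ^ (q - 2)) * ENNReal.ofReal (r - k) =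
      ∫⁻ k in Ioc 0 r, ENNReal.ofReal (k ^ (q - 2) * (r - k)) := by
    rw [← Ioc_union_Ioi_eq_Ioi hr, lintegral_union measurableSet_Ioi
      (Ioc_disjoint_Ioi le_rfl)]
    have : ∫⁻ k in Ioi r, ENNReal.ofReal (k ^ (q - 2)) * ENNReal.ofReal (r - k) = 0 := by
      rw [setLIntegral_congr_fun (g := fun _ => 0) measurableSet_Ioi, lintegral_zero]
      intro k hk
      have : r - k ≤ 0 := by linarith [mem_Ioi.mp hk]
      simp [ENNReal.ofReal_of_nonpos this]
    rw [this, add_zero]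
    refine setLIntegral_congr_fun measurableSet_Ioc fun k hk => ?_
    exact (ENNReal.ofReal_mul (Real.rpow_nonneg hk.1.le _)).symm
  have i1 : IntervalIntegrable (fun k : ℝ => k ^ (q - 2)) volume 0 r :=
    intervalIntegral.intervalIntegrable_rpow' (by linarith)
  have i2 : IntervalIntegrable (fun k : ℝ => k ^ (q - 1)) volume 0 r :=
    intervalIntegral.intervalIntegrable_rpow' (by linarith)
  have e2 : EqOn (fun k : ℝ => k ^ (q - 2) * (r - k)) (fun k => r * k ^ (q - 2) - k ^ (q - 1))
      (Ioc 0 r) := fun k hk => by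
    have : k ^ (q - 1) = k ^ (q - 2) * k := by
      rw [← Real.rpow_add_one hk.1.ne']; congr 1; ring
    simp only [this]; ring
  have i3 : IntegrableOn (fun k : ℝ => k ^ (q - 2) * (r - k)) (Ioc 0 r) := by
    rw [integrableOn_congr_fun e2 measurableSet_Ioc,
      ← intervalIntegrable_iff_integrableOn_Ioc_of_le hr]
    exact (i1.const_mul r).sub i2
  rw [e1, ← ofReal_integral_eq_lintegral_ofReal i3, ← ENNReal.ofReal_mul (by positivity)]
  · congr 1
    rw [setIntegral_congr_fun measurableSet_Ioc e2, ← intervalIntegral.integral_of_le hr,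
      intervalIntegral.integral_sub (i1.const_mul r) i2, intervalIntegral.integral_const_mul,
      integral_rpow (Or.inl (by linarith)), integral_rpow (Or.inl (by linarith)),
      Real.zero_rpow (by linarith), Real.zero_rpow (by linarith), sub_zero, sub_zero,
      show q - 2 + 1 = q - 1 by ring, sub_add_cancel]
    have : r * r ^ (q - 1) = r ^ q := by
      rcases hr.eq_or_lt with rfl | h
      · rw [Real.zero_rpow (by linarith : q ≠ 0), zero_mul]
      · rw [mul_comm, ← Real.rpow_add_one h.ne', sub_add_cancel]
    rw [← mul_div_assoc, this]
    field_simp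
    ring
  · refine (ae_restrict_iff' measurableSet_Ioc).mpr (Eventually.of_forall fun k hk => ?_)
    exact mul_nonneg (Real.rpow_nonneg hk.1.le _) (by linarith [hk.2])

/-- If the truncations of `|f|` have smaller integrals than those of `|g|`, then the `L^q` norms of
`f` are smaller than those of `g`. -/
lemma eLpNorm_le_of_lintegral_sub_le [SFinite μ] {f g : α → ℝ} (hf : AEMeasurable f μ)
    (hg : AEMeasurable g μ)
    (h : ∀ k : ℝ, 0 ≤ k →
      ∫⁻ a, ENNReal.ofReal (|f a| - k) ∂μ ≤ ∫⁻ a, ENNReal.ofReal (|g a| - k) ∂μ)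
    {q : ℝ≥0∞} (hq : 1 ≤ q) : eLpNorm f q μ ≤ eLpNorm g q μ := by
  have habs : ∀ r : ℝ, ‖r‖ₑ = ENNReal.ofReal |r| := fun r => Real.enorm_eq_ofReal_abs r
  rcases eq_or_ne q ⊤ with rfl | hqt
  · rcases eq_or_ne (eLpNorm g ⊤ μ) ⊤ with hgt | hgt
    · rw [hgt]; exact le_top
    set K := (eLpNorm g ⊤ μ).toReal with hK
    have hgK : ∀ᵐ a ∂μ, |g a| ≤ K := by
      filter_upwards [enorm_ae_le_eLpNormEssSup g μ] with a ha
      rw [← eLpNorm_exponent_top, habs] at ha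
      exact (ENNReal.ofReal_le_iff_le_toReal hgt).mp ha
    have h1 : ∫⁻ a, ENNReal.ofReal (|g a| - K) ∂μ = 0 := by
      rw [lintegral_congr_ae (g := fun _ => 0), lintegral_zero]
      filter_upwards [hgK] with a ha
      exact ENNReal.ofReal_of_nonpos (by linarith)
    have h2 := le_antisymm ((h K ENNReal.toReal_nonneg).trans h1.le) (zero_le)
    rw [lintegral_eq_zero_iff' (by fun_prop)] at h2
    rw [eLpNorm_exponent_top]
    refine eLpNormEssSup_le_of_ae_enorm_bound ?_
    filter_upwards [h2] with a ha
    rw [habs, ENNReal.ofReal_le_iff_le_toReal hgt]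
    linarith [ENNReal.ofReal_eq_zero.mp ha]
  have hq0 : q ≠ 0 := (zero_lt_one.trans_le hq).ne'
  rcases hq.eq_or_lt with rfl | hq1
  · rw [eLpNorm_one_eq_lintegral_enorm, eLpNorm_one_eq_lintegral_enorm]
    simpa only [habs, sub_zero] using h 0 le_rfl
  set Q := q.toReal with hQ
  have hQ1 : 1 < Q := by
    rw [hQ, ← ENNReal.toReal_one]; exact (ENNReal.toReal_lt_toReal ENNReal.one_ne_top hqt).mpr hq1
  have hC : 0 < 1 / (Q * (Q - 1)) := by
    have : 0 < Q - 1 := by linarith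
    positivity
  have key : ∀ {f : α → ℝ}, AEMeasurable f μ →
      ENNReal.ofReal (1 / (Q * (Q - 1))) * ∫⁻ a, ‖f a‖ₑ ^ Q ∂μ =
      ∫⁻ k in Ioi (0 : ℝ), ENNReal.ofReal (k ^ (Q - 2)) *
        ∫⁻ a, ENNReal.ofReal (|f a| - k) ∂μ := by
    intro f hf
    rw [← lintegral_const_mul'' _ (by fun_prop)]
    have e : ∀ a, ENNReal.ofReal (1 / (Q * (Q - 1))) * ‖f a‖ₑ ^ Q =
        ∫⁻ k in Ioi (0 : ℝ), ENNReal.ofReal (k ^ (Q - 2)) * ENNReal.ofReal (|f a| - k) :=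
      fun a => by
        rw [lintegral_rpow_mul_sub hQ1 (abs_nonneg _), habs,
          ENNReal.ofReal_rpow_of_nonneg (abs_nonneg _) (by linarith)]
    simp only [e]
    rw [lintegral_lintegral_swap]
    · refine lintegral_congr fun k => ?_
      rw [lintegral_const_mul'' _ (by fun_prop)]
    · have h1 : AEMeasurable (fun z : α × ℝ => f z.1) (μ.prod (volume.restrict (Ioi 0))) :=
        hf.comp_quasiMeasurePreserving Measure.quasiMeasurePreserving_fst
      have h2 : Measurable (fun z : α × ℝ => z.2 ^ (Q - 2)) := by fun_prop
      have h3 : AEMeasurable (fun z : α × ℝ => |f z.1| - z.2)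
          (μ.prod (volume.restrict (Ioi 0))) :=
        (measurable_abs.comp_aemeasurable h1).sub measurable_snd.aemeasurable
      exact h2.ennreal_ofReal.aemeasurable.mul h3.ennreal_ofReal
  rw [eLpNorm_eq_lintegral_rpow_enorm_toReal hq0 hqt, eLpNorm_eq_lintegral_rpow_enorm_toReal hq0 hqt]
  refine ENNReal.rpow_le_rpow ?_ (by positivity)
  rw [← ENNReal.mul_le_mul_iff_right (ENNReal.ofReal_pos.mpr hC).ne' ENNReal.ofReal_ne_top,
    key hf, key hg]
  refine setLIntegral_mono' measurableSet_Ioi fun k hk => ?_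
  exact mul_le_mul_right (h k (le_of_lt hk)) _

/-- The `L^q` norms are controlled by the truncations of the positive and negative parts. -/
lemma eLpNorm_le_of_integral_max_sub_le [IsFiniteMeasure μ] {U F : Lp ℝ 2 μ}
    (h1 : ∀ k : ℝ, 0 ≤ k → ∫ a, max (U a - k) 0 ∂μ ≤ ∫ a, max (F a - k) 0 ∂μ)
    (h2 : ∀ k : ℝ, 0 ≤ k → ∫ a, max ((-U) a - k) 0 ∂μ ≤ ∫ a, max ((-F) a - k) 0 ∂μ)
    {q : ℝ≥0∞} (hq : 1 ≤ q) : eLpNorm U q μ ≤ eLpNorm F q μ := by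
  refine eLpNorm_le_of_lintegral_sub_le (Lp.aestronglyMeasurable U).aemeasurable
    (Lp.aestronglyMeasurable F).aemeasurable (fun k hk => ?_) hq
  have e : ∀ x : Lp ℝ 2 μ, ∫⁻ a, ENNReal.ofReal (|x a| - k) ∂μ =
      ENNReal.ofReal (∫ a, max (x a - k) 0 ∂μ + ∫ a, max ((-x) a - k) 0 ∂μ) := by
    intro x
    have hi : Integrable (fun a => max (x a - k) 0 + max ((-x) a - k) 0) μ :=
      (integrable_max_sub k x).add (integrable_max_sub k (-x))
    rw [← integral_add (integrable_max_sub k x) (integrable_max_sub k (-x)),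
      ofReal_integral_eq_lintegral_ofReal hi
        (Eventually.of_forall fun a => add_nonneg (le_max_right _ _) (le_max_right _ _))]
    refine lintegral_congr_ae ?_
    filter_upwards [Lp.coeFn_neg x] with a ha
    rw [ha, Pi.neg_apply]
    rcases le_total 0 (x a) with h | h
    · rw [abs_of_nonneg h, max_eq_right (by linarith : -x a - k ≤ 0), add_zero]
      rcases le_total 0 (x a - k) with h' | h'
      · rw [max_eq_left h']
      · rw [max_eq_right h', ENNReal.ofReal_of_nonpos h', ENNReal.ofReal_zero]
    · rw [abs_of_nonpos h, max_eq_right (by linarith : x a - k ≤ 0), zero_add]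
      rcases le_total 0 (-x a - k) with h' | h'
      · rw [max_eq_left h']
      · rw [max_eq_right h', ENNReal.ofReal_of_nonpos h', ENNReal.ofReal_zero]
  rw [e, e]
  exact ENNReal.ofReal_le_ofReal (add_le_add (h1 k hk) (h2 k hk))

lemma eLpNorm_max_le_of_integral_max_le [IsFiniteMeasure μ] {U F : Lp ℝ 2 μ}
    (h : ∫ a, max (U a - 0) 0 ∂μ ≤ ∫ a, max (F a - 0) 0 ∂μ) :
    eLpNorm (fun a => max (U a) 0) 1 μ ≤ eLpNorm (fun a => max (F a) 0) 1 μ := by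
  have e : ∀ x : Lp ℝ 2 μ, eLpNorm (fun a => max (x a) 0) 1 μ =
      ENNReal.ofReal (∫ a, max (x a - 0) 0 ∂μ) := by
    intro x
    rw [ofReal_integral_eq_lintegral_ofReal (integrable_max_sub 0 x)
      (Eventually.of_forall fun a => le_max_right _ _), eLpNorm_one_eq_lintegral_enorm]
    refine lintegral_congr fun a => ?_
    rw [sub_zero, Real.enorm_of_nonneg (le_max_right _ _)]
  rw [e, e]
  exact ENNReal.ofReal_le_ofReal h

end Norms

/-! ### Uniqueness for monotone evolution equations -/

lemma AbsolutelyContinuousOnInterval.norm_sq {E : Type*} [SeminormedAddCommGroup E]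
    {f : ℝ → E} {a b : ℝ}
    (hf : AbsolutelyContinuousOnInterval f a b) :
    AbsolutelyContinuousOnInterval (fun t => ‖f t‖ ^ 2) a b := by
  have h : AbsolutelyContinuousOnInterval (fun t => ‖f t‖) a b := by
    refine squeeze_zero (fun _ => Finset.sum_nonneg fun i _ => dist_nonneg) (fun I => ?_) hf
    refine Finset.sum_le_sum fun i _ => ?_
    rw [dist_eq_norm (f _)]
    exact dist_norm_norm_le _ _
  simpa only [pow_two] using h.fun_mul h

section Uniqueness

variable {H : Type*} [NormedAddCommGroup H] [InnerProductSpace ℝ H]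

/-- Two absolutely continuous solutions of an evolution equation with a monotone operator approach
each other. -/
lemma norm_sub_le_of_ae_hasDerivAt {A : H → H → Prop} (hA : MaxMonotone A) {u v : ℝ → H}
    (hu : ContinuousOn u (Ici 0)) (hv : ContinuousOn v (Ici 0))
    (hua : ∀ a b, 0 < a → a ≤ b → AbsolutelyContinuousOnInterval u a b)
    (hva : ∀ a b, 0 < a → a ≤ b → AbsolutelyContinuousOnInterval v a b)
    (hue : ∀ᵐ t : ℝ, 0 < t → ∃ f, A (u t) f ∧ HasDerivAt u (-f) t)
    (hve : ∀ᵐ t : ℝ, 0 < t → ∃ f, A (v t) f ∧ HasDerivAt v (-f) t) {t : ℝ} (ht : 0 ≤ t) :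
    ‖u t - v t‖ ≤ ‖u 0 - v 0‖ := by
  rcases ht.eq_or_lt with rfl | ht
  · rfl
  have key : ∀ a ∈ Ioc 0 t, ‖u t - v t‖ ≤ ‖u a - v a‖ := by
    intro a ha
    have hac := ((hua a t ha.1 ha.2).fun_sub (hva a t ha.1 ha.2)).norm_sq
    have hint := hac.integral_deriv_eq_sub
    have hle : ∫ x in a..t, deriv (fun t => ‖u t - v t‖ ^ 2) x ≤ ∫ x in a..t, (0 : ℝ) := by
      refine intervalIntegral.integral_mono_ae_restrict ha.2 hac.intervalIntegrable_deriv
        intervalIntegrable_const ?_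
      refine (ae_restrict_iff' measurableSet_Icc).mpr ?_
      filter_upwards [hue, hve] with x h1 h2 hx
      obtain ⟨f, hf, hf'⟩ := h1 (ha.1.trans_le hx.1)
      obtain ⟨g, hg, hg'⟩ := h2 (ha.1.trans_le hx.1)
      have hd := (hf'.fun_sub hg').norm_sq
      rw [hd.deriv, show -f - -g = -(f - g) by abel, inner_neg_right, real_inner_comm]
      have := hA.mono hf hg
      linarith
    rw [hint, intervalIntegral.integral_zero] at hle
    exact (sq_le_sq₀ (norm_nonneg _) (norm_nonneg _)).mp (by linarith)
  have h0 : Tendsto (fun a => ‖u a - v a‖) (𝓝[>] 0) (𝓝 ‖u 0 - v 0‖) :=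
    (((hu 0 self_mem_Ici).mono Ioi_subset_Ici_self).sub
      ((hv 0 self_mem_Ici).mono Ioi_subset_Ici_self)).norm
  refine ge_of_tendsto h0 ?_
  filter_upwards [Ioc_mem_nhdsGT ht] with a ha using key a ha

/-- Solutions at all positive times, for which no absolute continuity is required, are determined by
their initial values. -/
lemma eq_of_hasDerivAt {A : H → H → Prop} (hA : MaxMonotone A) {u v : ℝ → H}
    (hu : ContinuousOn u (Ici 0)) (hv : ContinuousOn v (Ici 0))
    (hue : ∀ t : ℝ, 0 < t → ∃ f, A (u t) f ∧ HasDerivAt u (-f) t)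
    (hve : ∀ t : ℝ, 0 < t → ∃ f, A (v t) f ∧ HasDerivAt v (-f) t) (h0 : u 0 = v 0) {t : ℝ}
    (ht : 0 ≤ t) : u t = v t := by
  have hanti : AntitoneOn (fun t => ‖u t - v t‖ ^ 2) (Ici 0) := by
    refine antitoneOn_of_deriv_nonpos (convex_Ici 0) ((hu.sub hv).norm.pow 2) ?_ ?_
    · intro x hx
      rw [interior_Ici] at hx
      obtain ⟨f, hf, hf'⟩ := hue x hx
      obtain ⟨g, hg, hg'⟩ := hve x hx
      exact (hf'.fun_sub hg').norm_sq.differentiableAt.differentiableWithinAt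
    · intro x hx
      rw [interior_Ici] at hx
      obtain ⟨f, hf, hf'⟩ := hue x hx
      obtain ⟨g, hg, hg'⟩ := hve x hx
      rw [(hf'.fun_sub hg').norm_sq.deriv, show -f - -g = -(f - g) by abel, inner_neg_right,
        real_inner_comm]
      have := hA.mono hf hg
      linarith
  have := hanti self_mem_Ici ht ht
  simp only [h0, sub_self, norm_zero] at this
  have h1 : ‖u t - v t‖ = 0 := by
    have := sq_nonneg ‖u t - v t‖
    nlinarith
  exact sub_eq_zero.mp (norm_eq_zero.mp h1)

end Uniqueness

/-! ### The strong solutions -/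

section Solutions

variable {N : ℕ} {s p c : ℝ} {Ω : Set (Space N)} [Fact (1 ≤ ENNReal.ofReal p)]

lemma exists_isFracPLaplacian_hasDerivAt_semi (hN : 1 ≤ N) (hs0 : 0 < s) (hs1 : s < 1)
    (hp : 2 < p) (hc : 0 < c) (hΩ : IsOpen Ω) (hΩb : Bornology.IsBounded Ω) (x : L2 Ω) {t : ℝ}
    (ht : 0 < t) : ∃ f, IsFracPLaplacian c s p Ω (semi (IsFracPLaplacian c s p Ω) t x) f ∧
      HasDerivAt (fun t => semi (IsFracPLaplacian c s p Ω) t x) (-f) t :=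
  (maxMonotone_isFracPLaplacian hN hs0 hs1 hp hc hΩ hΩb).hasDerivAt_semi
    (dense_domain hN hs0 hs1 hp hc hΩ hΩb) (isFracPLaplacian_zero hN hs0 hs1 hp hΩ hΩb) hp
    (fun hκ => IsFracPLaplacian.smul hN hs0 hs1 hp hΩ hΩb hκ) (U := energyPow s Ω hp)
    (by positivity : 0 < p ^ 2 / (2 * c) + c)
    (fun hu hv => (energyPow_sub hN hs0 hs1 hp hc hΩ hΩb hu hv).1)
    (fun hu hv => (energyPow_sub hN hs0 hs1 hp hc hΩ hΩb hu hv).2) x ht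

/-- Orbits are Lipschitz on the compact subintervals of `(0, ∞)`, whatever the initial value. -/
lemma exists_lipschitzOnWith_semi (hN : 1 ≤ N) (hs0 : 0 < s) (hs1 : s < 1)
    (hp : 2 < p) (hc : 0 < c) (hΩ : IsOpen Ω) (hΩb : Bornology.IsBounded Ω) (x : L2 Ω) {a b : ℝ}
    (ha : 0 < a) (hab : a ≤ b) :
    ∃ K, LipschitzOnWith K (fun t => semi (IsFracPLaplacian c s p Ω) t x) (uIcc a b) := by
  have hp2 : 0 < p - 2 := by linarith
  have hM : 0 ≤ 2 / ((p - 2) * a) * ‖x‖ := by positivity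
  have key : ∀ r ∈ Icc a b, ∀ t ∈ Icc a b, r < t →
      dist (semi (IsFracPLaplacian c s p Ω) r x) (semi (IsFracPLaplacian c s p Ω) t x) ≤
        2 / ((p - 2) * a) * ‖x‖ * dist r t := by
    intro r hr t _ hrt
    have h := (maxMonotone_isFracPLaplacian hN hs0 hs1 hp hc hΩ hΩb).norm_semi_sub_le_of_homogeneous
      (dense_domain hN hs0 hs1 hp hc hΩ hΩb) (isFracPLaplacian_zero hN hs0 hs1 hp hΩ hΩb) hp
      (fun hκ => IsFracPLaplacian.smul hN hs0 hs1 hp hΩ hΩb hκ) (ha.trans_le hr.1)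
      (sub_pos.mpr hrt) x
    rw [add_sub_cancel] at h
    rw [dist_comm, dist_eq_norm, dist_comm, Real.dist_eq, abs_of_pos (sub_pos.mpr hrt), mul_comm]
    refine h.trans ?_
    have := hr.1
    have := sub_pos.mpr hrt
    gcongr
  refine ⟨⟨_, hM⟩, ?_⟩
  rw [uIcc_of_le hab]
  refine LipschitzOnWith.of_dist_le_mul fun r hr t ht => ?_
  rcases lt_trichotomy r t with h | h | h
  · exact key r hr t ht h
  · simp [h]
  · rw [dist_comm, dist_comm r]
    exact key t ht r hr h

lemma isStrongSolution_semi (hN : 1 ≤ N) (hs0 : 0 < s) (hs1 : s < 1)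
    (hp : 2 < p) (hc : 0 < c) (hΩ : IsOpen Ω) (hΩb : Bornology.IsBounded Ω) (x : L2 Ω) :
    IsStrongSolution c s p Ω fun t => semi (IsFracPLaplacian c s p Ω) t x where
  continuousOn := (maxMonotone_isFracPLaplacian hN hs0 hs1 hp hc hΩ hΩb).continuousOn_semi
    (dense_domain hN hs0 hs1 hp hc hΩ hΩb) x
  absolutelyContinuous _ _ ha hab :=
    (exists_lipschitzOnWith_semi hN hs0 hs1 hp hc hΩ hΩb x ha hab).choose_spec
      |>.absolutelyContinuousOnInterval
  equation := Eventually.of_forall fun _ ht =>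
    exists_isFracPLaplacian_hasDerivAt_semi hN hs0 hs1 hp hc hΩ hΩb x ht

lemma IsStrongSolution.eq_semi (hN : 1 ≤ N) (hs0 : 0 < s) (hs1 : s < 1)
    (hp : 2 < p) (hc : 0 < c) (hΩ : IsOpen Ω) (hΩb : Bornology.IsBounded Ω) {u : ℝ → L2 Ω}
    (hu : IsStrongSolution c s p Ω u) {t : ℝ} (ht : 0 ≤ t) :
    u t = semi (IsFracPLaplacian c s p Ω) t (u 0) := by
  have hA := maxMonotone_isFracPLaplacian hN hs0 hs1 hp hc hΩ hΩb
  have hv := isStrongSolution_semi hN hs0 hs1 hp hc hΩ hΩb (u 0)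
  have h := norm_sub_le_of_ae_hasDerivAt hA hu.continuousOn hv.continuousOn
    hu.absolutelyContinuous hv.absolutelyContinuous hu.equation hv.equation ht
  simp only [hA.semi_zero (dense_domain hN hs0 hs1 hp hc hΩ hΩb), sub_self, norm_zero,
    norm_le_zero_iff] at h
  exact sub_eq_zero.mp h

/-- The semigroup decreases `∫ (u - v - k)₊`, since the resolvents do. -/
lemma integral_max_sub_semi_le (hN : 1 ≤ N) (hs0 : 0 < s) (hs1 : s < 1)
    (hp : 2 < p) (hc : 0 < c) (hΩ : IsOpen Ω) (hΩb : Bornology.IsBounded Ω)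
    [IsFiniteMeasure (volume.restrict Ω)] {k t : ℝ} (hk : 0 ≤ k) (ht : 0 ≤ t) (x y : L2 Ω) :
    ∫ a in Ω, max ((semi (IsFracPLaplacian c s p Ω) t x -
        semi (IsFracPLaplacian c s p Ω) t y : L2 Ω) a - k) 0 ≤
      ∫ a in Ω, max ((x - y : L2 Ω) a - k) 0 := by
  have hA := maxMonotone_isFracPLaplacian hN hs0 hs1 hp hc hΩ hΩb
  set C := ∫ a in Ω, max ((x - y : L2 Ω) a - k) 0 with hC
  have hR : IsClosed {z : L2 Ω × L2 Ω | ∫ a in Ω, max ((z.1 - z.2 : L2 Ω) a - k) 0 ≤ C} :=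
    isClosed_le ((continuous_integral_max_sub hk).comp (continuous_fst.sub continuous_snd))
      continuous_const
  refine hA.semi_mem_of_isClosed (dense_domain hN hs0 hs1 hp hc hΩ hΩb) hR ?_ ht
    (x := x) (y := y) (by rw [mem_ofPred_eq])
  intro lam hl f g hfg
  refine le_trans (integral_max_sub_le (F := f - g) ?_ hk) hfg
  intro η L hη hmono hL h0
  have h := inner_sub_compLp_nonneg hN hs0 hs1 hp hc hΩ hΩb (hA.apply_resolv hl f)
    (hA.apply_resolv hl g) hη hmono hL h0
  have e : f - g - (resolv (IsFracPLaplacian c s p Ω) lam f -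
      resolv (IsFracPLaplacian c s p Ω) lam g) =
      lam • (yosida (IsFracPLaplacian c s p Ω) lam f - yosida (IsFracPLaplacian c s p Ω) lam g) := by
    nth_rw 1 [← MaxMonotone.resolv_add_smul_yosida (A := IsFracPLaplacian c s p Ω) hl f]
    nth_rw 1 [← MaxMonotone.resolv_add_smul_yosida (A := IsFracPLaplacian c s p Ω) hl g]
    module
  rw [e, real_inner_smul_left]
  positivity

end Solutions

theorem theorem2p1 (N : ℕ) (hN : 1 ≤ N) (s p c : ℝ) (hs0 : 0 < s) (hs1 : s < 1) (hp : 2 < p)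
    (hc : 0 < c) (Ω : Set (EuclideanSpace ℝ (Fin N))) (hΩo : IsOpen Ω)
    (hΩb : Bornology.IsBounded Ω) :
    (∀ u₀ : L2 Ω, ∃ u : ℝ → L2 Ω,
      IsStrongSolution c s p Ω u ∧ u 0 = u₀ ∧
      (∀ t : ℝ, 0 < t →
        ∃ f : L2 Ω, IsFracPLaplacian c s p Ω (u t) f ∧ HasDerivAt u (-f) t) ∧
      (∀ v : ℝ → L2 Ω, IsStrongSolution c s p Ω v → v 0 = u₀ → ∀ t : ℝ, 0 ≤ t → v t = u t)) ∧
    (∀ u : ℝ → L2 Ω, ContinuousOn u (Ici 0) →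
      (∀ t : ℝ, 0 < t →
        ∃ f : L2 Ω, IsFracPLaplacian c s p Ω (u t) f ∧ HasDerivAt u (-f) t) →
      IsStrongSolution c s p Ω u) ∧
    (∀ u₁ u₂ : ℝ → L2 Ω, IsStrongSolution c s p Ω u₁ → IsStrongSolution c s p Ω u₂ →
      ∀ t : ℝ, 0 < t →
        eLpNorm (fun x => max (u₁ t x - u₂ t x) 0) 1 (volume.restrict Ω) ≤
          eLpNorm (fun x => max (u₁ 0 x - u₂ 0 x) 0) 1 (volume.restrict Ω) ∧
        ∀ q : ℝ≥0∞, 1 ≤ q →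
          eLpNorm (fun x => u₁ t x - u₂ t x) q (volume.restrict Ω) ≤
            eLpNorm (fun x => u₁ 0 x - u₂ 0 x) q (volume.restrict Ω)) := by
  have : Fact (1 ≤ ENNReal.ofReal p) := ⟨by rw [ENNReal.one_le_ofReal]; linarith⟩
  have hA := maxMonotone_isFracPLaplacian hN hs0 hs1 hp hc hΩo hΩb
  have hd := dense_domain hN hs0 hs1 hp hc hΩo hΩb
  refine ⟨fun u₀ => ⟨fun t => semi (IsFracPLaplacian c s p Ω) t u₀,
    isStrongSolution_semi hN hs0 hs1 hp hc hΩo hΩb u₀, hA.semi_zero hd u₀,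
    fun t ht => exists_isFracPLaplacian_hasDerivAt_semi hN hs0 hs1 hp hc hΩo hΩb u₀ ht,
    fun v hv hv0 t ht => ?_⟩, fun u hu hue => ⟨hu, fun a b ha hab => ?_,
      Eventually.of_forall hue⟩, fun u₁ u₂ h₁ h₂ t ht => ?_⟩
  · rw [hv.eq_semi hN hs0 hs1 hp hc hΩo hΩb ht, hv0]
  · have hv := isStrongSolution_semi hN hs0 hs1 hp hc hΩo hΩb (u 0)
    have e : ∀ t, 0 ≤ t → u t = semi (IsFracPLaplacian c s p Ω) t (u 0) := fun t ht =>
      eq_of_hasDerivAt hA hu hv.continuousOn hue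
        (fun t ht => exists_isFracPLaplacian_hasDerivAt_semi hN hs0 hs1 hp hc hΩo hΩb (u 0) ht)
        (hA.semi_zero hd (u 0)).symm ht
    obtain ⟨K, hK⟩ := exists_lipschitzOnWith_semi hN hs0 hs1 hp hc hΩo hΩb (u 0) ha hab
    refine LipschitzOnWith.absolutelyContinuousOnInterval (K := K) fun r hr t ht => ?_
    have h := hK hr ht
    rw [uIcc_of_le hab] at hr ht
    rwa [e r (ha.le.trans hr.1), e t (ha.le.trans ht.1)]
  · have : IsFiniteMeasure ((volume : Measure (Space N)).restrict Ω) :=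
      ⟨by rw [Measure.restrict_apply_univ]; exact hΩb.measure_lt_top⟩
    have e : ∀ t, (fun x => u₁ t x - u₂ t x) =ᵐ[volume.restrict Ω] (u₁ t - u₂ t : L2 Ω) :=
      fun t => (Lp.coeFn_sub _ _).symm
    have e' : ∀ t, (fun x => max (u₁ t x - u₂ t x) 0) =ᵐ[volume.restrict Ω]
        fun x => max ((u₁ t - u₂ t : L2 Ω) x) 0 := fun t => by
      filter_upwards [e t] with x hx
      rw [hx]
    have key : ∀ {u v : ℝ → L2 Ω}, IsStrongSolution c s p Ω u → IsStrongSolution c s p Ω v →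
        ∀ k : ℝ, 0 ≤ k → ∫ a in Ω, max ((u t - v t : L2 Ω) a - k) 0 ≤
          ∫ a in Ω, max ((u 0 - v 0 : L2 Ω) a - k) 0 := by
      intro u v hu hv k hk
      rw [hu.eq_semi hN hs0 hs1 hp hc hΩo hΩb ht.le, hv.eq_semi hN hs0 hs1 hp hc hΩo hΩb ht.le]
      exact integral_max_sub_semi_le hN hs0 hs1 hp hc hΩo hΩb hk ht.le _ _
    constructor
    · rw [eLpNorm_congr_ae (e' t), eLpNorm_congr_ae (e' 0)]
      exact eLpNorm_max_le_of_integral_max_le (key h₁ h₂ 0 le_rfl)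
    · intro q hq
      rw [eLpNorm_congr_ae (e t), eLpNorm_congr_ae (e 0)]
      refine eLpNorm_le_of_integral_max_sub_le (key h₁ h₂) ?_ hq
      rw [neg_sub, neg_sub]
      exact key h₂ h₁
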